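/- **Parameters.** Let $L,v_m>0$ and, for $i\in\{1,2\}$, let $\rho_{m,i},\gamma_i,\tau_i>0$. Road $1$ (outgoing) is $I_1=[0,L]$, road $2$ (incoming) is $I_2=[-L,0]$. Let $\rho_i^\star$ be steady densities in the congested regime, $\rho_{m,i}(1+\gamma_i)^{-1/\gamma_i}<\rho_i^\star<\rho_{m,i}$, and put $$v_i^\star=v_m\Big(1-\big(\tfrac{\rho_i^\star}{\rho_{m,i}}\big)^{\gamma_i}\Big),\quad p_i^\star=\tfrac{v_m}{\rho_{m,i}^{\gamma_i}}(\rho_i^\star)^{\gamma_i},\quad r_i=-\frac{v_i^\star}{\gamma_ip_i^\star-v_i^\star},\quad c_i(x)=-\tfrac1{\tau_i}e^{-x/(\tau_iv_i^\star)},\quad E_i=e^{-L/(\tau_iv_i^\star)} ,$$ and assume that the steady fluxes agree: $\rho_1^\star v_1^\star=\rho_2^\star v_2^\star=:q^\star$. (Then $v_i^\star>0$ and $\gamma_ip_i^\star-v_i^\star>0$.) **System.** Consider the linearized Aw–Rascle–Zhang model on the two connected roads (in Riemann coordinates, after an exponential change of variables), for $x\in I_i$, $t>0$: $$\partial_t\bar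 w_i+v_i^\star\partial_x\bar w_i=0,\qquad \partial_t\tilde v_i-(\gamma_ip_i^\star-v_i^\star)\partial_x\tilde v_i=c_i(x)\bar w_i,$$ $$\tilde v_1(L,t)=r_1E_1\bar w_1(L,t),\qquad \bar w_1(0,t)=\bar w_2(0,t),\qquad \bar w_2(-L,t)=\tfrac{E_2}{r_2}\tilde v_2(-L,t),$$ $$\tilde v_2(0,t)=\tfrac{r_2}{r_1}\tilde v_1(0,t)+\tfrac{r_1-r_2}{1-r_1}\bar w_2(0,t)+\tfrac{v_2^\star(1-r_2)}{q^\star}U_0(t).$$ **Kernels and feedback.** On $\mathcal T_1=\{0\le x\le\xi\le L\}$ and $\mathcal T_2=\{-L\le\xi\le x\le0\}$ let $K_i^{vw},K_i^{vv}$ be bounded measurable functions which satisfy (along characteristics) $$(\gamma_ip_i^\star-v_i^\star)\partial_xK_i^{vw}-v_i^\star\partial_\xi K_i^{vw}=c_i(\xi)K_i^{vv},\qquad \partial_xK_i^{vv}+\partial_\xi K_i^{vv}=0,$$ $$K_1^{vw}(x,x)=\tfrac{c_1(x)}{\gamma_1p_1^\star},\quad K_2^{vw}(x,x)=-\tfrac{c_2(x)}{\gamma_2p_2^\star},\quad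 K_1^{vv}(x,L)=-\tfrac1{E_1}K_1^{vw}(x,L),\quad K_2^{vv}(x,-L)=-E_2K_2^{vw}(x,-L),$$ and let $$U_0(t)=\frac{q^\star}{v_2^\star(1-r_2)}\Big(\int_{-L}^0\!\big(K_2^{vw}(0,\xi)\bar w_2(\xi,t)+K_2^{vv}(0,\xi)\tilde v_2(\xi,t)\big)d\xi-\frac{r_2}{r_1}\int_0^L\!\big(K_1^{vw}(0,\xi)\bar w_1(\xi,t)+K_1^{vv}(0,\xi)\tilde v_1(\xi,t)\big)d\xi\Big).$$ **Assumption.** The matrix of the boundary couplings satisfies $$\mathrm{Sp}_1\begin{pmatrix}0&0&0&1\\0&0&\frac{r_2}{r_1}&\frac{r_1-r_2}{1-r_1}\\ r_1E_1&0&0&0\\0&\frac{E_2}{r_2}&0&0\end{pmatrix}<1,\qquad \mathrm{Sp}_1(H)=\inf\{\|\Delta H\Delta^{-1}\|:\ \Delta\text{ diagonal with positive diagonal}\},$$ where $\|\cdot\|$ is the Euclidean operator norm. **Theorem.** Under this assumption such kernels exist, and there are constants $C,\omega>0$, depending only on the parameters, such that, with the feedback $U_0$ built from any such kernels, the following holds.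 For every initial condition $(\bar w_i(\cdot,0),\tilde v_i(\cdot,0))_{i=1,2}\in L^2(I_i)^2$ the closed-loop system has a weak solution, continuous in time with values in $L^2$ and with boundary values in $L^2_{\mathrm{loc}}([0,\infty))$ that satisfy the boundary conditions for almost every $t$; and every such solution satisfies, for all $t\ge0$, $$\Big(\sum_{i=1}^2\|\bar w_i(\cdot,t)\|_{L^2(I_i)}^2+\|\tilde v_i(\cdot,t)\|_{L^2(I_i)}^2\Big)^{1/2}\le C e^{-\omega t}\Big(\sum_{i=1}^2\|\bar w_i(\cdot,0)\|_{L^2(I_i)}^2+\|\tilde v_i(\cdot,0)\|_{L^2(I_i)}^2\Big)^{1/2}.$$ Hence both road segments are stabilized simultaneously. -/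

import Mathlib

open MeasureTheory Set

noncomputable section

/-- The two road segments: `Road.one` is the outgoing (downstream) road on `[0, L]`,
`Road.two` is the incoming (upstream) road on `[-L, 0]`. -/
inductive Road : Type
  | one : Road
  | two : Road

/-- Parameters of the ARZ model on the two roads, together with a spatially uniform steady state
`ρ_i^⋆` in the congested regime on both roads, with the same flux on both roads. -/
structure ARZNetwork where
  /-- common length of the two roads -/
  L : ℝ
  /-- maximum velocity -/
  vm : ℝ
  /-- maximum densities `ρ_{m,i}` -/
  rhoMax : Road → ℝ
  /-- aggressiveness exponents `γ_i` -/
  gamma : Road → ℝ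
  /-- relaxation times `τ_i` -/
  tau : Road → ℝ
  /-- steady state densities `ρ_i^⋆` -/
  rhoStar : Road → ℝ
  L_pos : 0 < L
  vm_pos : 0 < vm
  rhoMax_pos : ∀ i, 0 < rhoMax i
  gamma_pos : ∀ i, 0 < gamma i
  tau_pos : ∀ i, 0 < tau i
  /-- the steady state densities are below the maximum, so steady velocities are positive -/
  rhoStar_lt : ∀ i, rhoStar i < rhoMax i
  /-- both steady states are congested: `ρ_i^⋆` exceeds the critical density -/
  congested : ∀ i, rhoMax i / (1 + gamma i) ^ (1 / gamma i) < rhoStar i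
  /-- `ρ_1^⋆ V_1(ρ_1^⋆) = ρ_2^⋆ V_2(ρ_2^⋆)` -/
  flux_balance :
    rhoStar .one * (vm * (1 - (rhoStar .one / rhoMax .one) ^ gamma .one)) =
      rhoStar .two * (vm * (1 - (rhoStar .two / rhoMax .two) ^ gamma .two))

namespace ARZNetwork

variable (S : ARZNetwork)

/-- Steady velocity `v_i^⋆ = V_i(ρ_i^⋆)` (Greenshields relation). -/
def vStar (i : Road) : ℝ := S.vm * (1 - (S.rhoStar i / S.rhoMax i) ^ S.gamma i)

/-- Steady traffic pressure `p_i^⋆ = c_i (ρ_i^⋆)^{γ_i}`, `c_i = v_m / ρ_{m,i}^{γ_i}`. -/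
def pStar (i : Road) : ℝ := S.vm / S.rhoMax i ^ S.gamma i * S.rhoStar i ^ S.gamma i

/-- The common steady flux `q^⋆ = ρ_1^⋆ v_1^⋆ = ρ_2^⋆ v_2^⋆`. -/
def qStar : ℝ := S.rhoStar .one * S.vStar .one

/-- The upstream characteristic speed `γ_i p_i^⋆ - v_i^⋆`. -/
def lam (i : Road) : ℝ := S.gamma i * S.pStar i - S.vStar i

/-- The ratio `r_i = - v_i^⋆ / (γ_i p_i^⋆ - v_i^⋆)`. -/
def r (i : Road) : ℝ := - (S.vStar i / (S.gamma i * S.pStar i - S.vStar i))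

/-- The in-domain coupling coefficient `c_i(x) = -(1/τ_i) exp(-x / (τ_i v_i^⋆))`. -/
def c (i : Road) (x : ℝ) : ℝ := -(1 / S.tau i) * Real.exp (-x / (S.tau i * S.vStar i))

/-- The factor `exp(-L / (τ_i v_i^⋆))`. -/
def decayFactor (i : Road) : ℝ := Real.exp (-S.L / (S.tau i * S.vStar i))

/-- Left end point of the road `i`. -/
def left : Road → ℝ
  | .one => 0
  | .two => -S.L

/-- Right end point of the road `i`. -/
def right : Road → ℝ
  | .one => S.L
  | .two => 0

/-- The matrix of the boundary couplings, in the order of the components `w̄_1, ṽ_2, ṽ_1, w̄_2`: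
it sends the outgoing boundary values `(w̄_1(L), ṽ_2(-L), ṽ_1(0), w̄_2(0))` to the incoming boundary
values `(w̄_1(0), ṽ_2(0), ṽ_1(L), w̄_2(-L))` when the control is switched off. -/
def boundaryMatrix : Matrix (Fin 4) (Fin 4) ℝ :=
  !![0, 0, 0, 1;
     0, 0, S.r .two / S.r .one, (S.r .one - S.r .two) / (1 - S.r .one);
     S.r .one * S.decayFactor .one, 0, 0, 0;
     0, S.decayFactor .two * (1 / S.r .two), 0, 0]

end ARZNetwork

/-- `Sp₁(H) = inf { ‖Δ H Δ⁻¹‖ }`, over the diagonal matrices `Δ` with positive diagonal entries;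
the norm is the operator norm for the Euclidean norm. -/
def Sp1 {n : ℕ} (H : Matrix (Fin n) (Fin n) ℝ) : ℝ :=
  sInf {s : ℝ | ∃ d : Fin n → ℝ, (∀ k, 0 < d k) ∧
    s = ‖Matrix.toEuclideanCLM (𝕜 := ℝ) (Matrix.diagonal d * H * (Matrix.diagonal d)⁻¹)‖}

namespace ARZNetwork

variable (S : ARZNetwork)

/-- The triangles `T_1 = {(x, ξ) ∈ [0, L]² : x ≤ ξ}` and `T_2 = {(x, ξ) ∈ [-L, 0]² : ξ ≤ x}`. -/
def triangle : Road → Set (ℝ × ℝ)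
  | .one => {z | 0 ≤ z.1 ∧ z.1 ≤ z.2 ∧ z.2 ≤ S.L}
  | .two => {z | -S.L ≤ z.2 ∧ z.2 ≤ z.1 ∧ z.1 ≤ 0}

/-- `Kvw i`, `Kvv i` are bounded measurable solutions of the kernel equations on the triangle of
the road `i`. The two first-order equations
`(γ_i p_i^⋆ - v_i^⋆) ∂_x K^{vw} - v_i^⋆ ∂_ξ K^{vw} = c_i(ξ) K^{vv}` and
`∂_x K^{vv} + ∂_ξ K^{vv} = 0` hold integrated along their characteristics. -/
structure IsKernel (Kvw Kvv : Road → ℝ → ℝ → ℝ) : Prop where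
  measurable_vw : ∀ i, Measurable (Function.uncurry (Kvw i))
  measurable_vv : ∀ i, Measurable (Function.uncurry (Kvv i))
  bounded_vw : ∀ i, ∃ M : ℝ, ∀ z ∈ S.triangle i, |Kvw i z.1 z.2| ≤ M
  bounded_vv : ∀ i, ∃ M : ℝ, ∀ z ∈ S.triangle i, |Kvv i z.1 z.2| ≤ M
  eq_vw : ∀ (i : Road) (x ξ s : ℝ), 0 ≤ s → (x, ξ) ∈ S.triangle i →
    (x + S.lam i * s, ξ - S.vStar i * s) ∈ S.triangle i →
    Kvw i (x + S.lam i * s) (ξ - S.vStar i * s) = Kvw i x ξ +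
      ∫ σ in (0 : ℝ)..s, S.c i (ξ - S.vStar i * σ) *
        Kvv i (x + S.lam i * σ) (ξ - S.vStar i * σ)
  eq_vv : ∀ (i : Road) (x ξ s : ℝ), 0 ≤ s → (x, ξ) ∈ S.triangle i →
    (x + s, ξ + s) ∈ S.triangle i → Kvv i (x + s) (ξ + s) = Kvv i x ξ
  diag_one : ∀ x ∈ Icc (0 : ℝ) S.L,
    Kvw .one x x = S.c .one x / (S.gamma .one * S.pStar .one)
  diag_two : ∀ x ∈ Icc (-S.L) (0 : ℝ),
    Kvw .two x x = -(S.c .two x / (S.gamma .two * S.pStar .two))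
  edge_one : ∀ x ∈ Icc (0 : ℝ) S.L,
    Kvv .one x S.L = -Real.exp (S.L / (S.tau .one * S.vStar .one)) * Kvw .one x S.L
  edge_two : ∀ x ∈ Icc (-S.L) (0 : ℝ),
    Kvv .two x (-S.L) = -Real.exp (-S.L / (S.tau .two * S.vStar .two)) * Kvw .two x (-S.L)

/-- The space `L²` over the road `i`. -/
abbrev L2 (i : Road) : Type := Lp ℝ 2 (volume.restrict (Icc (S.left i) (S.right i)))

/-- The `L²` norm of a state `(w̄_1, w̄_2, ṽ_1, ṽ_2)`. -/
def stateNorm (w v : (i : Road) → S.L2 i) : ℝ :=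
  Real.sqrt (‖w .one‖ ^ 2 + ‖w .two‖ ^ 2 + ‖v .one‖ ^ 2 + ‖v .two‖ ^ 2)

/-- The state feedback `U_0` with the kernels `Kvw`, `Kvv`, evaluated at a state. -/
def feedback (Kvw Kvv : Road → ℝ → ℝ → ℝ) (w v : (i : Road) → S.L2 i) : ℝ :=
  S.qStar / (S.vStar .two * (1 - S.r .two)) *
    ((∫ ξ in Icc (-S.L) (0 : ℝ), (Kvw .two 0 ξ * w .two ξ + Kvv .two 0 ξ * v .two ξ)) -
      S.r .two / S.r .one *
        ∫ ξ in Icc (0 : ℝ) S.L, (Kvw .one 0 ξ * w .one ξ + Kvv .one 0 ξ * v .one ξ))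

/-- `u`, a continuous curve in `L²` over the road `i`, is a weak solution on `t ≥ 0` of
`∂_t u + σ ∂_x u = g`, with the locally square integrable boundary values `ul` at the left end
and `ur` at the right end of the road. The test functions `φ t x` are `C¹` up to the boundary. -/
structure IsTransportSolution (i : Road) (σ : ℝ) (g : ℝ → ℝ → ℝ) (u : ℝ → S.L2 i)
    (ul ur : ℝ → ℝ) : Prop where
  continuous_curve : ContinuousOn u (Ici 0)
  left_trace : ∀ T : ℝ, MemLp ul 2 (volume.restrict (Icc 0 T))
  right_trace : ∀ T : ℝ, MemLp ur 2 (volume.restrict (Icc 0 T))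
  weak_form : ∀ φ : ℝ → ℝ → ℝ, ContDiff ℝ 1 (Function.uncurry φ) → ∀ T : ℝ, 0 ≤ T →
    (∫ x in Icc (S.left i) (S.right i), u T x * φ T x) -
        (∫ x in Icc (S.left i) (S.right i), u 0 x * φ 0 x) +
        σ * (∫ t in (0 : ℝ)..T, (ur t * φ t (S.right i) - ul t * φ t (S.left i))) =
      ∫ t in (0 : ℝ)..T, ∫ x in Icc (S.left i) (S.right i),
        (u t x * (deriv (fun s => φ s x) t + σ * deriv (fun y => φ t y) x) + g t x * φ t x)

/-- `(w i t, v i t) = (w̄_i(·, t), ṽ_i(·, t))` is an `L²` solution on `t ≥ 0` of the closed-loop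
system. The functions `wl i, wr i, vl i, vr i` of `t` are the values of `w̄_i` and `ṽ_i` at the
left and the right end of the road `i`. -/
def IsClosedLoopSolution (Kvw Kvv : Road → ℝ → ℝ → ℝ) (w v : (i : Road) → ℝ → S.L2 i) : Prop :=
  ∃ wl wr vl vr : Road → ℝ → ℝ,
    (∀ i, S.IsTransportSolution i (S.vStar i) (fun _ _ => 0) (w i) (wl i) (wr i)) ∧
    (∀ i, S.IsTransportSolution i (-(S.gamma i * S.pStar i - S.vStar i))
      (fun t x => S.c i x * w i t x) (v i) (vl i) (vr i)) ∧
    ∀ᵐ t ∂(volume.restrict (Ici (0 : ℝ))),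
      vr .one t = S.r .one * Real.exp (-S.L / (S.tau .one * S.vStar .one)) * wr .one t ∧
      wl .one t = wr .two t ∧
      wl .two t = Real.exp (-S.L / (S.tau .two * S.vStar .two)) * (1 / S.r .two) * vl .two t ∧
      vr .two t = S.r .two / S.r .one * vl .one t +
        (S.r .one - S.r .two) / (1 - S.r .one) * wr .two t +
        S.vStar .two * (1 - S.r .two) / S.qStar *
          S.feedback Kvw Kvv (fun i => w i t) (fun i => v i t)

end ARZNetwork

end

/-! ### Signs of the parameters. -/

namespace ARZNetwork

variable (S : ARZNetwork)

/-! Write `κ_i = γ_i p_i^⋆ = v_i^⋆ + λ_i`. Because `c_i' = -c_i / (τ_i v_i^⋆)`, the kernel equations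
have an explicit solution: up to a sign, `c_i(ξ) / κ_i` and the constant `1 / (τ_i κ_i)`
(`isKernel_kernel`). It is the only one on the triangles: `K^{vv}` is determined by its values on an
edge, and the difference of two solutions satisfies a homogeneous Volterra inequality there
(`eq_zero_of_volterra_bound`, `vv_unique`, `vw_unique`). Hence all admissible kernels give the same
feedback (`feedback_eq`), and the constants cannot depend on them.

The backstepping transformation is then `β_i = v_i + κ_i⁻¹ m_i`, where `m_i(x)` integrates `c_i w_i
+ v_i / τ_i` from the outer end of the road to `x`. The outer boundary condition says exactly that
`v_i^⋆ c_i w_i = λ_i v_i / τ_i` at that end, and this makes `m_i` a solution of `∂_t m_i - λ_i ∂_x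
m_i = -κ_i c_i w_i`. The sources of `v_i` and `κ_i⁻¹ m_i` cancel, so `β_i` is purely transported.
Moreover `m_i` vanishes at the outer end, and the feedback is designed to remove `m_1(0)` and
`m_2(0)` from the junction condition. The pair `(w, β)` thus solves decoupled transport equations
linked only by `boundaryMatrix`. The inverse transformation has the same shape, with an exponential
weight in the integral. Solutions being weak, all of this is proved by transposing the integral
operator onto the test functions (`isTransportSolution_moment`).

For decay, `Sp1 < 1` provides a weighted Euclidean norm in which the boundary map is a contraction.
Squares of weak solutions are conserved along characteristics (`IsTransportSolution.energy`), so
with the weight `e^{2ωt}` crossing a road costs a factor which tends to `1` as `ω → 0`. For small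
`ω` this cost is absorbed by the contraction (`exists_decay_target`), and the bounded
transformations carry the estimate back.

For existence, transport along the roads turns the target system into delay equations for the four
incoming boundary signals. These are solved by the method of steps (`exists_delay_solution`), and
the inverse transformation gives a closed-loop solution. -/

theorem rhoStar_pos (i : Road) : 0 < S.rhoStar i := by
  have h1 := S.rhoMax_pos i
  have h2 := S.gamma_pos i
  exact lt_trans (div_pos h1 (Real.rpow_pos_of_pos (by linarith) _)) (S.congested i)

theorem vStar_pos (i : Road) : 0 < S.vStar i := by
  have h1 := S.rhoMax_pos i
  have h2 := S.gamma_pos i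
  have h3 := S.rhoStar_pos i
  have : (S.rhoStar i / S.rhoMax i) ^ S.gamma i < 1 :=
    Real.rpow_lt_one (by positivity) ((div_lt_one h1).2 (S.rhoStar_lt i)) h2
  exact mul_pos S.vm_pos (by linarith)

theorem pStar_eq (i : Road) : S.pStar i = S.vm * (S.rhoStar i / S.rhoMax i) ^ S.gamma i := by
  rw [pStar, Real.div_rpow (S.rhoStar_pos i).le (S.rhoMax_pos i).le]
  ring

/-- With `y = (ρ^⋆/ρ_m)^γ` the speed is `v_m ((1 + γ) y - 1)`, and congestion, raised to the power
`γ`, reads `1 / (1 + γ) < y`. -/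
theorem lam_pos (i : Road) : 0 < S.lam i := by
  have h1 := S.rhoMax_pos i
  have h2 := S.gamma_pos i
  have h3 := S.rhoStar_pos i
  have h4 : 0 < 1 + S.gamma i := by linarith
  have h5 : 1 / (1 + S.gamma i) < (S.rhoStar i / S.rhoMax i) ^ S.gamma i := by
    have h6 : ((1 + S.gamma i) ^ (1 / S.gamma i))⁻¹ < S.rhoStar i / S.rhoMax i := by
      rw [lt_div_iff₀ h1, mul_comm, ← div_eq_mul_inv]
      exact S.congested i
    have h7 := Real.rpow_lt_rpow (by positivity) h6 h2
    rwa [Real.inv_rpow (by positivity), ← Real.rpow_mul h4.le, one_div_mul_cancel h2.ne',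
      Real.rpow_one, ← one_div] at h7
  rw [div_lt_iff₀ h4] at h5
  rw [lam, pStar_eq, vStar]
  have h8 := mul_pos S.vm_pos (sub_pos.2 h5)
  linarith

/-- The sum `γ_i p_i^⋆` of the two characteristic speeds. -/
noncomputable def kap (i : Road) : ℝ := S.gamma i * S.pStar i

theorem kap_eq (i : Road) : S.kap i = S.vStar i + S.lam i := by
  rw [kap, lam]; ring

theorem kap_pos (i : Road) : 0 < S.kap i := by
  rw [kap_eq]; exact add_pos (S.vStar_pos i) (S.lam_pos i)

theorem r_eq (i : Road) : S.r i = -(S.vStar i / S.lam i) := rfl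

theorem r_neg (i : Road) : S.r i < 0 := by
  rw [r_eq]; exact neg_lt_zero.2 (div_pos (S.vStar_pos i) (S.lam_pos i))

theorem one_sub_r_pos (i : Road) : 0 < 1 - S.r i := by linarith [S.r_neg i]

theorem qStar_pos : 0 < S.qStar := mul_pos (S.rhoStar_pos _) (S.vStar_pos _)

theorem left_lt_right (i : Road) : S.left i < S.right i := by
  have := S.L_pos
  cases i <;> simp [left, right, this]

theorem right_sub_left (i : Road) : S.right i - S.left i = S.L := by
  cases i <;> simp [left, right]

theorem hasDerivAt_c (i : Road) (x : ℝ) :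
    HasDerivAt (S.c i) (-(S.c i x / (S.tau i * S.vStar i))) x := by
  have h := (((hasDerivAt_id x).neg.div_const (S.tau i * S.vStar i)).exp).const_mul
    (-(1 / S.tau i))
  refine h.congr_deriv ?_
  simp only [c, id, Pi.neg_apply]
  ring

theorem contDiff_c (i : Road) {n : WithTop ℕ∞} : ContDiff ℝ n (S.c i) := by
  unfold c; fun_prop

theorem continuous_c (i : Road) : Continuous (S.c i) := (S.contDiff_c i (n := 0)).continuous

/-- The end of the road `i` away from the junction. -/
noncomputable def outerEnd : Road → ℝ
  | .one => S.L
  | .two => -S.L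

theorem outerEnd_mem (i : Road) : S.outerEnd i ∈ Icc (S.left i) (S.right i) := by
  have := S.L_pos
  cases i <;> simp [left, right, outerEnd, this.le]

end ARZNetwork

/-- A bounded function on `[0, L]` which satisfies a homogeneous linear Volterra inequality
vanishes. -/
theorem eq_zero_of_volterra_bound {L κ C M : ℝ} (hκ : 0 < κ) (hC : 0 ≤ C) {d : ℝ → ℝ}
    (hM : ∀ z ∈ Icc 0 L, |d z| ≤ M) {g : ℝ → ℝ → ℝ}
    (hg : ∀ z ∈ Icc 0 L, ∀ s ∈ Icc 0 (z / κ), |g z s| ≤ C)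
    (hd : ∀ z ∈ Icc 0 L, |d z| ≤ |∫ s in (0 : ℝ)..(z / κ), g z s * d (κ * s)|) :
    ∀ z ∈ Icc 0 L, d z = 0 := by
  -- In the sup norm weighted by `exp (-Λ z)` the Volterra operator has norm at most `C / (2C + 1) ≤
  -- 1/2`, so the a priori bound can be halved indefinitely. The `+ 1` keeps the rate positive when
  -- `C = 0`. No measurability of `d` is needed, since only the norm of the integral is bounded.
  set Λ : ℝ := (2 * C + 1) / κ with hΛ
  have hΛ0 : 0 < Λ := by positivity
  have step : ∀ M' : ℝ, (∀ z ∈ Icc 0 L, |d z| ≤ M' * Real.exp (Λ * z)) →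
      ∀ z ∈ Icc 0 L, |d z| ≤ M' / 2 * Real.exp (Λ * z) := by
    intro M' h z hz
    have hM' : 0 ≤ M' := nonneg_of_mul_nonneg_left ((abs_nonneg _).trans (h z hz)) (Real.exp_pos _)
    have hz' : 0 ≤ z / κ := div_nonneg hz.1 hκ.le
    have hder : ∀ s : ℝ, HasDerivAt (fun s => C * M' / (2 * C + 1) * Real.exp ((2 * C + 1) * s))
        (C * (M' * Real.exp (Λ * (κ * s)))) s := by
      intro s
      have := (((hasDerivAt_id s).const_mul (2 * C + 1)).exp).const_mul (C * M' / (2 * C + 1))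
      refine this.congr_deriv ?_
      have : Λ * (κ * s) = (2 * C + 1) * s := by rw [hΛ]; field_simp
      rw [this]
      field_simp
      rfl
    have hint : IntervalIntegrable (fun s => C * (M' * Real.exp (Λ * (κ * s)))) volume 0 (z / κ) :=
      Continuous.intervalIntegrable (by fun_prop) _ _
    refine (hd z hz).trans ?_
    rw [← Real.norm_eq_abs]
    refine (intervalIntegral.norm_integral_le_of_norm_le hz' (g := fun s =>
      C * (M' * Real.exp (Λ * (κ * s)))) (Filter.Eventually.of_forall fun s hs => ?_) hint).trans ?_
    · rw [norm_mul]
      have hs' : κ * s ∈ Icc 0 L := by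
        refine ⟨mul_nonneg hκ.le hs.1.le, le_trans ?_ hz.2⟩
        rw [mul_comm]; exact (le_div_iff₀ hκ).1 hs.2
      exact mul_le_mul (hg z hz s ⟨hs.1.le, hs.2⟩) (h _ hs') (abs_nonneg _) hC
    · rw [intervalIntegral.integral_eq_sub_of_hasDerivAt (fun s _ => hder s) hint]
      have h1 : (2 * C + 1) * (z / κ) = Λ * z := by rw [hΛ]; ring
      have h2 : C * M' / (2 * C + 1) ≤ M' / 2 := by
        rw [div_le_div_iff₀ (by positivity) (by positivity)]
        nlinarith
      have h3 : 0 ≤ C * M' / (2 * C + 1) := by positivity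
      rw [h1]
      simp only [mul_zero, Real.exp_zero, mul_one]
      have := mul_le_mul_of_nonneg_right h2 (Real.exp_pos (Λ * z)).le
      linarith
  have all : ∀ n : ℕ, ∀ z ∈ Icc 0 L, |d z| ≤ M * (1 / 2) ^ n * Real.exp (Λ * z) := by
    intro n
    induction n with
    | zero =>
      intro z hz
      have hM0 : 0 ≤ M := (abs_nonneg _).trans (hM z hz)
      have := Real.one_le_exp (mul_nonneg hΛ0.le hz.1)
      rw [pow_zero, mul_one]
      exact (hM z hz).trans (le_mul_of_one_le_right hM0 this)
    | succ n ih =>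
      intro z hz
      refine (step _ ih z hz).trans_eq ?_
      ring
  intro z hz
  have hlim : Filter.Tendsto (fun n : ℕ => M * (1 / 2 : ℝ) ^ n * Real.exp (Λ * z)) Filter.atTop
      (nhds (M * 0 * Real.exp (Λ * z))) :=
    ((tendsto_pow_atTop_nhds_zero_of_lt_one (by norm_num) (by norm_num)).const_mul M).mul_const _
  have := ge_of_tendsto' hlim fun n => all n z hz
  rw [mul_zero, zero_mul] at this
  exact abs_nonpos_iff.1 this

/-! ### The explicit kernels. -/

namespace ARZNetwork

variable (S : ARZNetwork)

/-- The sign of the explicit kernels. -/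
noncomputable def kernelSign : Road → ℝ
  | .one => 1
  | .two => -1

/-- The explicit kernel `K_i^{vw}`. -/
noncomputable def kernelVW (i : Road) (_x ξ : ℝ) : ℝ := kernelSign i * (S.c i ξ / S.kap i)

/-- The explicit, constant, kernel `K_i^{vv}`. -/
noncomputable def kernelVV (i : Road) (_x _ξ : ℝ) : ℝ := kernelSign i / (S.tau i * S.kap i)

theorem isCompact_triangle (i : Road) : IsCompact (S.triangle i) := by
  have hL := S.L_pos
  refine IsCompact.of_isClosed_subset
    ((isCompact_Icc (a := -S.L) (b := S.L)).prod (isCompact_Icc (a := -S.L) (b := S.L))) ?_ ?_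
  · cases i
    · exact (isClosed_le continuous_const continuous_fst).inter
        ((isClosed_le continuous_fst continuous_snd).inter
          (isClosed_le continuous_snd continuous_const))
    · exact (isClosed_le continuous_const continuous_snd).inter
        ((isClosed_le continuous_snd continuous_fst).inter
          (isClosed_le continuous_fst continuous_const))
  · rintro ⟨x, ξ⟩ h
    cases i <;> obtain ⟨h1, h2, h3⟩ := h <;>
      exact ⟨⟨by dsimp at *; linarith, by dsimp at *; linarith⟩,
        ⟨by dsimp at *; linarith, by dsimp at *; linarith⟩⟩

/-- Along a characteristic `ξ` moves with speed `-v^⋆`, so `c(ξ)` has derivative `c(ξ)/τ`; this is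
why a constant `K^{vv}` is compatible with a `K^{vw}` that does not depend on `x`. The edge
conditions hold because the exponential in `c`, evaluated at the outer end, is the inverse of the
reflection factor. -/
theorem isKernel_kernel : S.IsKernel S.kernelVW S.kernelVV where
  measurable_vw i := by
    have := (S.continuous_c i).measurable
    unfold kernelVW Function.uncurry
    fun_prop
  measurable_vv i := by
    unfold kernelVV Function.uncurry
    fun_prop
  bounded_vw i := by
    have hc := S.continuous_c i
    have : Continuous fun z : ℝ × ℝ => kernelSign i * (S.c i z.2 / S.kap i) := by fun_prop
    obtain ⟨M, hM⟩ := (S.isCompact_triangle i).exists_bound_of_continuousOn this.continuousOn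
    exact ⟨M, hM⟩
  bounded_vv i := ⟨|kernelSign i / (S.tau i * S.kap i)|, fun _ _ => le_rfl⟩
  eq_vw i x ξ s _ _ _ := by
    have hk := S.kap_pos i
    have hv := S.vStar_pos i
    have ht := S.tau_pos i
    have hder : ∀ σ : ℝ, HasDerivAt (fun σ => S.kernelVW i x (ξ - S.vStar i * σ))
        (S.c i (ξ - S.vStar i * σ) * S.kernelVV i (x + S.lam i * σ) (ξ - S.vStar i * σ)) σ := by
      intro σ
      have h1 : HasDerivAt (fun σ => ξ - S.vStar i * σ) (-(S.vStar i)) σ := by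
        simpa using ((hasDerivAt_id σ).const_mul (S.vStar i)).const_sub ξ
      have h2 := (((S.hasDerivAt_c i (ξ - S.vStar i * σ)).comp σ h1).div_const
        (S.kap i)).const_mul (kernelSign i)
      refine h2.congr_deriv ?_
      rw [kernelVV]
      field_simp
    have hc := S.continuous_c i
    rw [intervalIntegral.integral_eq_sub_of_hasDerivAt (fun σ _ => hder σ)
      (Continuous.intervalIntegrable (by unfold kernelVV; fun_prop) _ _)]
    simp [kernelVW]
  eq_vv i x ξ s _ _ _ := rfl
  diag_one x _ := by simp [kernelVW, kernelSign, kap]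
  diag_two x _ := by simp [kernelVW, kernelSign, kap]
  edge_one x _ := by
    have h : Real.exp (S.L / (S.tau .one * S.vStar .one)) *
        Real.exp (-S.L / (S.tau .one * S.vStar .one)) = 1 := by
      rw [← Real.exp_add, neg_div, add_neg_cancel, Real.exp_zero]
    rw [kernelVW, kernelVV, c, kernelSign]
    calc 1 / (S.tau .one * S.kap .one) = 1 / (S.tau .one * S.kap .one) *
        (Real.exp (S.L / (S.tau .one * S.vStar .one)) *
        Real.exp (-S.L / (S.tau .one * S.vStar .one))) := by rw [h, mul_one]
      _ = _ := by field_simp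
  edge_two x _ := by
    have h : Real.exp (-S.L / (S.tau .two * S.vStar .two)) *
        Real.exp (- -S.L / (S.tau .two * S.vStar .two)) = 1 := by
      rw [← Real.exp_add, neg_neg, neg_div, neg_add_cancel, Real.exp_zero]
    rw [kernelVW, kernelVV, c, kernelSign]
    calc -1 / (S.tau .two * S.kap .two) = -1 / (S.tau .two * S.kap .two) *
        (Real.exp (-S.L / (S.tau .two * S.vStar .two)) *
        Real.exp (- -S.L / (S.tau .two * S.vStar .two))) := by rw [h, mul_one]
      _ = _ := by field_simp

end ARZNetwork

/-! ### Uniqueness of the kernels. -/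

namespace ARZNetwork

variable {S : ARZNetwork}

/-- Convexity of the triangle. It is needed because the kernels are controlled only there. -/
theorem triangle_segment {i : Road} {x ξ s σ : ℝ} (h0 : (x, ξ) ∈ S.triangle i)
    (h1 : (x + S.lam i * s, ξ - S.vStar i * s) ∈ S.triangle i) (hσ : σ ∈ Icc 0 s) :
    (x + S.lam i * σ, ξ - S.vStar i * σ) ∈ S.triangle i := by
  have ha := mul_nonneg (S.lam_pos i).le hσ.1
  have hb := mul_nonneg (S.vStar_pos i).le hσ.1
  have hc := mul_le_mul_of_nonneg_left hσ.2 (S.lam_pos i).le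
  have hd := mul_le_mul_of_nonneg_left hσ.2 (S.vStar_pos i).le
  cases i <;> obtain ⟨h2, h3, h4⟩ := h0 <;> obtain ⟨h5, h6, h7⟩ := h1 <;>
    refine ⟨?_, ?_, ?_⟩ <;> dsimp only at * <;> linarith

variable {Kvw Kvv Kvw' Kvv' : Road → ℝ → ℝ → ℝ}

namespace IsKernel

theorem intervalIntegrable (hK : S.IsKernel Kvw Kvv) {i : Road} {x ξ s : ℝ} (hs : 0 ≤ s)
    (h0 : (x, ξ) ∈ S.triangle i) (h1 : (x + S.lam i * s, ξ - S.vStar i * s) ∈ S.triangle i) :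
    IntervalIntegrable (fun σ => S.c i (ξ - S.vStar i * σ) *
      Kvv i (x + S.lam i * σ) (ξ - S.vStar i * σ)) volume 0 s := by
  have hc := S.continuous_c i
  obtain ⟨M, hM⟩ := hK.bounded_vv i
  refine IntervalIntegrable.continuousOn_mul ?_ (by fun_prop)
  rw [intervalIntegrable_iff_integrableOn_Icc_of_le hs]
  refine Measure.integrableOn_of_bounded (M := M) (by simp) ?_ ?_
  · have : Measurable fun σ : ℝ => ((x + S.lam i * σ, ξ - S.vStar i * σ) : ℝ × ℝ) := by fun_prop
    exact ((hK.measurable_vv i).comp this).aestronglyMeasurable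
  · refine (ae_restrict_iff' measurableSet_Icc).2 (Filter.Eventually.of_forall fun σ hσ => ?_)
    exact hM _ (triangle_segment h0 h1 hσ)

theorem sub_eq_vw (hK : S.IsKernel Kvw Kvv) (hK' : S.IsKernel Kvw' Kvv') {i : Road} {x ξ s : ℝ}
    (hs : 0 ≤ s) (h0 : (x, ξ) ∈ S.triangle i)
    (h1 : (x + S.lam i * s, ξ - S.vStar i * s) ∈ S.triangle i) :
    (Kvw i (x + S.lam i * s) (ξ - S.vStar i * s) - Kvw' i (x + S.lam i * s) (ξ - S.vStar i * s)) =
      (Kvw i x ξ - Kvw' i x ξ) + ∫ σ in (0 : ℝ)..s, S.c i (ξ - S.vStar i * σ) *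
        (Kvv i (x + S.lam i * σ) (ξ - S.vStar i * σ) -
          Kvv' i (x + S.lam i * σ) (ξ - S.vStar i * σ)) := by
  simp only [mul_sub]
  rw [intervalIntegral.integral_sub (hK.intervalIntegrable hs h0 h1)
    (hK'.intervalIntegrable hs h0 h1), hK.eq_vw i x ξ s hs h0 h1, hK'.eq_vw i x ξ s hs h0 h1]
  ring

/-- `K^{vv}` is constant along the direction `(1, 1)`, so it depends only on `ξ - x` and can be read
off on the edge `ξ = L`. -/
theorem vv_one_eq (hK : S.IsKernel Kvw Kvv) {x ξ : ℝ} (h : (x, ξ) ∈ S.triangle .one) :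
    Kvv .one x ξ = Kvv .one (S.L - (ξ - x)) S.L := by
  obtain ⟨h1, h2, h3⟩ := h
  dsimp only at *
  have e1 : x + (S.L - ξ) = S.L - (ξ - x) := by ring
  have e2 : ξ + (S.L - ξ) = S.L := by ring
  have := hK.eq_vv .one x ξ (S.L - ξ) (by linarith) ⟨h1, h2, h3⟩
    (by rw [e1, e2]; exact ⟨by dsimp only; linarith, by dsimp only; linarith, le_rfl⟩)
  rw [← this, e1, e2]

theorem vv_two_eq (hK : S.IsKernel Kvw Kvv) {x ξ : ℝ} (h : (x, ξ) ∈ S.triangle .two) :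
    Kvv .two x ξ = Kvv .two (-S.L + (x - ξ)) (-S.L) := by
  obtain ⟨h1, h2, h3⟩ := h
  dsimp only at *
  have e1 : -S.L + (x - ξ) + (ξ + S.L) = x := by ring
  have e2 : -S.L + (ξ + S.L) = ξ := by ring
  have := hK.eq_vv .two (-S.L + (x - ξ)) (-S.L) (ξ + S.L) (by linarith)
    ⟨le_rfl, by dsimp only; linarith, by dsimp only; linarith⟩
    (by rw [e1, e2]; exact ⟨h1, h2, h3⟩)
  rw [← this, e1, e2]

theorem exists_bound_c (S : ARZNetwork) (i : Road) :
    ∃ C, 0 ≤ C ∧ ∀ x ∈ Icc (-S.L) S.L, |S.c i x| ≤ C := by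
  obtain ⟨C, hC⟩ := (isCompact_Icc (a := -S.L) (b := S.L)).exists_bound_of_continuousOn
    (S.continuous_c i).continuousOn
  exact ⟨C, (norm_nonneg _).trans (hC S.L ⟨by linarith [S.L_pos], le_rfl⟩), hC⟩

/-- From the edge point at distance `z` from the corner, the characteristic of `K^{vw}` reaches the
diagonal after the time `z / κ`, since `ξ - x` decreases at the rate `κ`. On the diagonal the two
kernels agree, so the difference at the edge is an integral of differences of `K^{vv}`. These again
take their values from the edge, at smaller distances; the edge condition closes the loop. -/
theorem edge_one_unique (hK : S.IsKernel Kvw Kvv) (hK' : S.IsKernel Kvw' Kvv') :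
    ∀ z ∈ Icc 0 S.L, Kvv .one (S.L - z) S.L - Kvv' .one (S.L - z) S.L = 0 := by
  obtain ⟨M, hM⟩ := hK.bounded_vv .one
  obtain ⟨M', hM'⟩ := hK'.bounded_vv .one
  obtain ⟨C, hC0, hC⟩ := exists_bound_c S .one
  have hκ := S.kap_pos .one
  have ha := S.vStar_pos .one
  have hl := S.lam_pos .one
  have hκe := S.kap_eq .one
  have hmem : ∀ z ∈ Icc 0 S.L, (S.L - z, S.L) ∈ S.triangle .one := fun z hz =>
    ⟨by dsimp only; linarith [hz.2], by dsimp only; linarith [hz.1], le_rfl⟩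
  set R := Real.exp (S.L / (S.tau .one * S.vStar .one)) with hR
  have hR0 : 0 < R := Real.exp_pos _
  refine eq_zero_of_volterra_bound (κ := S.kap .one) (C := R * C) (M := M + M') hκ (by positivity)
    (d := fun z => Kvv .one (S.L - z) S.L - Kvv' .one (S.L - z) S.L)
    (fun z hz => (abs_sub _ _).trans (add_le_add (hM _ (hmem z hz)) (hM' _ (hmem z hz))))
    (g := fun z s => R * S.c .one (S.L - S.vStar .one * (z / S.kap .one - s))) ?_ ?_
  · intro z hz s hs
    rw [abs_mul, abs_of_pos hR0]
    refine mul_le_mul_of_nonneg_left (hC _ ?_) hR0.le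
    have h1 : 0 ≤ S.vStar .one * (z / S.kap .one - s) := mul_nonneg ha.le (by linarith [hs.2])
    have h2 : S.vStar .one * (z / S.kap .one - s) ≤ S.kap .one * (z / S.kap .one - s) :=
      mul_le_mul_of_nonneg_right (by linarith) (by linarith [hs.2])
    have h3 : S.kap .one * (z / S.kap .one - s) = z - S.kap .one * s := by field_simp
    have h4 := mul_nonneg hκ.le hs.1
    exact ⟨by linarith [hz.2, S.L_pos], by linarith⟩
  · intro z hz
    have hs : 0 ≤ z / S.kap .one := div_nonneg hz.1 hκ.le
    have hzk : S.vStar .one * (z / S.kap .one) + S.lam .one * (z / S.kap .one) = z := by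
      rw [← add_mul, ← hκe]; field_simp
    have hend : S.L - z + S.lam .one * (z / S.kap .one) =
        S.L - S.vStar .one * (z / S.kap .one) := by linarith
    have hv0 := mul_nonneg ha.le hs
    have hl0 := mul_nonneg hl.le hs
    have hE : (S.L - z + S.lam .one * (z / S.kap .one), S.L - S.vStar .one * (z / S.kap .one)) ∈
        S.triangle .one := by
      rw [hend]
      exact ⟨by dsimp only; linarith [hz.2], le_rfl, by dsimp only; linarith⟩
    have hdiag : S.L - S.vStar .one * (z / S.kap .one) ∈ Icc 0 S.L :=
      ⟨by linarith [hz.2], by linarith⟩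
    have key := hK.sub_eq_vw hK' hs (hmem z hz) hE
    rw [hend, hK.diag_one _ hdiag, hK'.diag_one _ hdiag, sub_self] at key
    have hLz : S.L - z ∈ Icc 0 S.L := ⟨by linarith [hz.2], by linarith [hz.1]⟩
    have e1 := hK.edge_one _ hLz
    have e2 := hK'.edge_one _ hLz
    rw [← hR] at e1 e2
    have hint : ∫ s in (0 : ℝ)..(z / S.kap .one),
        R * S.c .one (S.L - S.vStar .one * (z / S.kap .one - s)) *
          (Kvv .one (S.L - S.kap .one * s) S.L - Kvv' .one (S.L - S.kap .one * s) S.L) =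
        R * ∫ σ in (0 : ℝ)..(z / S.kap .one), S.c .one (S.L - S.vStar .one * σ) *
          (Kvv .one (S.L - z + S.lam .one * σ) (S.L - S.vStar .one * σ) -
            Kvv' .one (S.L - z + S.lam .one * σ) (S.L - S.vStar .one * σ)) := by
      -- After the time `σ` the remaining distance is `κ (z/κ - σ)`; reversing time brings it to the
      -- form `κ s` of the Volterra inequality.
      have hrev := intervalIntegral.integral_comp_sub_left (a := 0) (b := z / S.kap .one)
        (fun s => R * S.c .one (S.L - S.vStar .one * (z / S.kap .one - s)) *
          (Kvv .one (S.L - S.kap .one * s) S.L - Kvv' .one (S.L - S.kap .one * s) S.L))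
        (z / S.kap .one)
      rw [sub_self, sub_zero] at hrev
      rw [← hrev, ← intervalIntegral.integral_const_mul]
      refine intervalIntegral.integral_congr fun σ hσ => ?_
      rw [uIcc_of_le hs] at hσ
      have hmemσ := triangle_segment (hmem z hz) hE hσ
      have e3 : S.L - (S.L - S.vStar .one * σ - (S.L - z + S.lam .one * σ)) =
          S.L - S.kap .one * (z / S.kap .one - σ) := by
        have : S.kap .one * (z / S.kap .one - σ) = z - S.kap .one * σ := by field_simp
        rw [this, hκe]; ring
      rw [hK.vv_one_eq hmemσ, hK'.vv_one_eq hmemσ, e3, sub_sub_cancel]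
      ring
    rw [hint]
    refine le_of_eq ?_
    rw [e1, e2]
    congr 1
    linear_combination R * key

/-- On the incoming road the characteristic runs from the diagonal point `(p, p)` to the edge `ξ =
-L`. The distance `x - ξ` is already `κ σ`, so no time reversal occurs. -/
theorem edge_two_unique (hK : S.IsKernel Kvw Kvv) (hK' : S.IsKernel Kvw' Kvv') :
    ∀ z ∈ Icc 0 S.L, Kvv .two (-S.L + z) (-S.L) - Kvv' .two (-S.L + z) (-S.L) = 0 := by
  obtain ⟨M, hM⟩ := hK.bounded_vv .two
  obtain ⟨M', hM'⟩ := hK'.bounded_vv .two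
  obtain ⟨C, hC0, hC⟩ := exists_bound_c S .two
  have hκ := S.kap_pos .two
  have ha := S.vStar_pos .two
  have hl := S.lam_pos .two
  have hκe := S.kap_eq .two
  have hmem : ∀ z ∈ Icc 0 S.L, (-S.L + z, -S.L) ∈ S.triangle .two := fun z hz =>
    ⟨le_rfl, by dsimp only; linarith [hz.1], by dsimp only; linarith [hz.2]⟩
  set R := Real.exp (-S.L / (S.tau .two * S.vStar .two)) with hR
  have hR0 : 0 < R := Real.exp_pos _
  refine eq_zero_of_volterra_bound (κ := S.kap .two) (C := R * C) (M := M + M') hκ (by positivity)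
    (d := fun z => Kvv .two (-S.L + z) (-S.L) - Kvv' .two (-S.L + z) (-S.L))
    (fun z hz => (abs_sub _ _).trans (add_le_add (hM _ (hmem z hz)) (hM' _ (hmem z hz))))
    (g := fun z s => R * S.c .two (-S.L + S.vStar .two * (z / S.kap .two) - S.vStar .two * s))
    ?_ ?_
  · intro z hz s hs
    rw [abs_mul, abs_of_pos hR0]
    refine mul_le_mul_of_nonneg_left (hC _ ?_) hR0.le
    have h1 : 0 ≤ S.vStar .two * (z / S.kap .two - s) := mul_nonneg ha.le (by linarith [hs.2])
    have h2 : S.vStar .two * (z / S.kap .two - s) ≤ S.kap .two * (z / S.kap .two - s) :=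
      mul_le_mul_of_nonneg_right (by linarith) (by linarith [hs.2])
    have h3 : S.kap .two * (z / S.kap .two - s) = z - S.kap .two * s := by field_simp
    have h4 := mul_nonneg hκ.le hs.1
    exact ⟨by linarith [hz.2, S.L_pos], by linarith [hz.2, S.L_pos]⟩
  · intro z hz
    have hs : 0 ≤ z / S.kap .two := div_nonneg hz.1 hκ.le
    set p := -S.L + S.vStar .two * (z / S.kap .two) with hp
    have hzk : S.vStar .two * (z / S.kap .two) + S.lam .two * (z / S.kap .two) = z := by
      rw [← add_mul, ← hκe]; field_simp
    have hend : p + S.lam .two * (z / S.kap .two) = -S.L + z := by linarith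
    have hend' : p - S.vStar .two * (z / S.kap .two) = -S.L := by linarith
    have hv0 := mul_nonneg ha.le hs
    have hl0 := mul_nonneg hl.le hs
    have hE : (p + S.lam .two * (z / S.kap .two), p - S.vStar .two * (z / S.kap .two)) ∈
        S.triangle .two := by
      rw [hend, hend']
      exact hmem z hz
    have hdiag : p ∈ Icc (-S.L) 0 := ⟨by linarith, by linarith [hz.2]⟩
    have hpp : (p, p) ∈ S.triangle .two := ⟨hdiag.1, le_rfl, hdiag.2⟩
    have key := hK.sub_eq_vw hK' hs hpp hE
    rw [hend, hend', hK.diag_two _ hdiag, hK'.diag_two _ hdiag, sub_self, zero_add] at key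
    have hLz : -S.L + z ∈ Icc (-S.L) 0 := ⟨by linarith [hz.1], by linarith [hz.2]⟩
    have e1 := hK.edge_two _ hLz
    have e2 := hK'.edge_two _ hLz
    rw [← hR] at e1 e2
    have hint : ∫ s in (0 : ℝ)..(z / S.kap .two),
        R * S.c .two (p - S.vStar .two * s) *
          (Kvv .two (-S.L + S.kap .two * s) (-S.L) - Kvv' .two (-S.L + S.kap .two * s) (-S.L)) =
        R * ∫ σ in (0 : ℝ)..(z / S.kap .two), S.c .two (p - S.vStar .two * σ) *
          (Kvv .two (p + S.lam .two * σ) (p - S.vStar .two * σ) -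
            Kvv' .two (p + S.lam .two * σ) (p - S.vStar .two * σ)) := by
      rw [← intervalIntegral.integral_const_mul]
      refine intervalIntegral.integral_congr fun σ hσ => ?_
      rw [uIcc_of_le hs] at hσ
      have hmemσ := triangle_segment hpp hE hσ
      have e3 : -S.L + (p + S.lam .two * σ - (p - S.vStar .two * σ)) =
          -S.L + S.kap .two * σ := by
        rw [hκe]; ring
      rw [hK.vv_two_eq hmemσ, hK'.vv_two_eq hmemσ, e3]
      ring
    rw [hint, ← key, e1, e2, ← abs_neg]
    refine le_of_eq ?_
    congr 1
    ring

theorem vv_unique (hK : S.IsKernel Kvw Kvv) (hK' : S.IsKernel Kvw' Kvv') {i : Road} {x ξ : ℝ}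
    (h : (x, ξ) ∈ S.triangle i) : Kvv i x ξ - Kvv' i x ξ = 0 := by
  cases i
  · rw [hK.vv_one_eq h, hK'.vv_one_eq h]
    obtain ⟨h1, h2, h3⟩ := h
    exact hK.edge_one_unique hK' _ ⟨by dsimp only at *; linarith, by dsimp only at *; linarith⟩
  · rw [hK.vv_two_eq h, hK'.vv_two_eq h]
    obtain ⟨h1, h2, h3⟩ := h
    exact hK.edge_two_unique hK' _ ⟨by dsimp only at *; linarith, by dsimp only at *; linarith⟩

theorem diag_unique (hK : S.IsKernel Kvw Kvv) (hK' : S.IsKernel Kvw' Kvv') {i : Road} {x : ℝ}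
    (h : (x, x) ∈ S.triangle i) : Kvw i x x - Kvw' i x x = 0 := by
  cases i <;> obtain ⟨h1, h2, h3⟩ := h
  · rw [hK.diag_one x ⟨h1, h3⟩, hK'.diag_one x ⟨h1, h3⟩, sub_self]
  · rw [hK.diag_two x ⟨h1, h3⟩, hK'.diag_two x ⟨h1, h3⟩, sub_self]

theorem sub_vw_eq (hK : S.IsKernel Kvw Kvv) (hK' : S.IsKernel Kvw' Kvv') {i : Road} {x ξ s : ℝ}
    (hs : 0 ≤ s) (h0 : (x, ξ) ∈ S.triangle i)
    (h1 : (x + S.lam i * s, ξ - S.vStar i * s) ∈ S.triangle i) :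
    (Kvw i (x + S.lam i * s) (ξ - S.vStar i * s) - Kvw' i (x + S.lam i * s) (ξ - S.vStar i * s)) =
      Kvw i x ξ - Kvw' i x ξ := by
  rw [hK.sub_eq_vw hK' hs h0 h1, add_eq_left]
  refine intervalIntegral.integral_zero_ae (Filter.Eventually.of_forall fun σ hσ => ?_)
  rw [uIoc_of_le hs] at hσ
  rw [hK.vv_unique hK' (triangle_segment h0 h1 ⟨hσ.1.le, hσ.2⟩), mul_zero]

/-- A characteristic joins each point to the diagonal, where `K^{vw}` is prescribed, and along it
the difference is constant because the two `K^{vv}` agree. The characteristic ends on the diagonal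
for the outgoing road and starts there for the incoming one. -/
theorem vw_unique (hK : S.IsKernel Kvw Kvv) (hK' : S.IsKernel Kvw' Kvv') {i : Road} {x ξ : ℝ}
    (h : (x, ξ) ∈ S.triangle i) : Kvw i x ξ - Kvw' i x ξ = 0 := by
  have hκ := S.kap_pos i
  have ha := S.vStar_pos i
  have hl := S.lam_pos i
  have hκe := S.kap_eq i
  cases i
  · obtain ⟨h1, h2, h3⟩ := h
    dsimp only at *
    set s := (ξ - x) / S.kap .one with hs
    have hs0 : 0 ≤ s := div_nonneg (by linarith) hκ.le
    have hsk : S.vStar .one * s + S.lam .one * s = ξ - x := by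
      rw [← add_mul, ← hκe, hs]; field_simp
    have hv0 := mul_nonneg ha.le hs0
    have hl0 := mul_nonneg hl.le hs0
    have e : x + S.lam .one * s = ξ - S.vStar .one * s := by linarith
    have hm : (ξ - S.vStar .one * s, ξ - S.vStar .one * s) ∈ S.triangle .one :=
      ⟨by dsimp only; linarith, le_rfl, by dsimp only; linarith⟩
    have := hK.sub_vw_eq hK' hs0 (i := .one) (x := x) (ξ := ξ) ⟨h1, h2, h3⟩ (by rw [e]; exact hm)
    rw [← this, e]
    exact hK.diag_unique hK' hm
  · obtain ⟨h1, h2, h3⟩ := h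
    dsimp only at *
    set s := (x - ξ) / S.kap .two with hs
    have hs0 : 0 ≤ s := div_nonneg (by linarith) hκ.le
    have hsk : S.vStar .two * s + S.lam .two * s = x - ξ := by
      rw [← add_mul, ← hκe, hs]; field_simp
    have hv0 := mul_nonneg ha.le hs0
    have hl0 := mul_nonneg hl.le hs0
    set p := ξ + S.vStar .two * s with hp
    have e : p + S.lam .two * s = x := by linarith
    have e' : p - S.vStar .two * s = ξ := by linarith
    have hm : (p, p) ∈ S.triangle .two :=
      ⟨by dsimp only; linarith, le_rfl, by dsimp only; linarith⟩
    have := hK.sub_vw_eq hK' hs0 hm (by rw [e, e']; exact ⟨h1, h2, h3⟩)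
    rw [e, e'] at this
    rw [this]
    exact hK.diag_unique hK' hm

/-- The feedback does not depend on the choice of the kernels. -/
theorem feedback_eq (hK : S.IsKernel Kvw Kvv) (w v : (i : Road) → S.L2 i) :
    S.feedback Kvw Kvv w v = S.feedback S.kernelVW S.kernelVV w v := by
  have h := S.isKernel_kernel
  unfold feedback
  congr 2
  · refine setIntegral_congr_fun measurableSet_Icc fun ξ hξ => ?_
    have hm : ((0 : ℝ), ξ) ∈ S.triangle .two := ⟨hξ.1, hξ.2, le_rfl⟩
    rw [sub_eq_zero.1 (hK.vw_unique h hm), sub_eq_zero.1 (hK.vv_unique h hm)]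
  · congr 1
    refine setIntegral_congr_fun measurableSet_Icc fun ξ hξ => ?_
    have hm : ((0 : ℝ), ξ) ∈ S.triangle .one := ⟨le_rfl, hξ.1, hξ.2⟩
    rw [sub_eq_zero.1 (hK.vw_unique h hm), sub_eq_zero.1 (hK.vv_unique h hm)]

end IsKernel

end ARZNetwork

/-- Integration by parts of a primitive of an integrable function against a `C¹` function. -/
theorem integral_primitive_mul {f φ φ' : ℝ → ℝ} {α β b : ℝ} (hb : b ∈ uIcc α β)
    (hf : IntervalIntegrable f volume α β) (hφ : ∀ x, HasDerivAt φ (φ' x) x)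
    (hφ' : Continuous φ') :
    ∫ x in α..β, (f x * φ x + (∫ y in b..x, f y) * φ' x) =
      (∫ y in b..β, f y) * φ β - (∫ y in b..α, f y) * φ α := by
  have hN := hf.absolutelyContinuousOnInterval_intervalIntegral hb
  -- As `f` is merely integrable, its primitive is differentiable only almost everywhere; both
  -- factors are absolutely continuous, which suffices for integration by parts.
  have hφeq : φ = fun x => φ b + ∫ y in b..x, φ' y := by
    funext x
    rw [intervalIntegral.integral_eq_sub_of_hasDerivAt (fun y _ => hφ y)
      (hφ'.intervalIntegrable _ _)]
    ring
  have hφac : AbsolutelyContinuousOnInterval φ α β := by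
    have hi : IntervalIntegrable φ' volume α β := hφ'.intervalIntegrable _ _
    have := (LipschitzOnWith.absolutelyContinuousOnInterval (f := fun _ : ℝ => φ b) (K := 0)
      (a := α) (b := β)
      (LipschitzWith.const _).lipschitzOnWith).add
      (hi.absolutelyContinuousOnInterval_intervalIntegral hb)
    rw [hφeq]
    exact this
  rw [← hN.integral_deriv_mul_eq_sub hφac]
  refine intervalIntegral.integral_congr_ae ?_
  filter_upwards [hf.ae_hasDerivAt_integral] with x hx hx'
  rw [(hx (uIoc_subset_uIcc hx') b hb).deriv, (hφ x).deriv]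

/-- A function of two variables with continuous partial derivatives is `C¹`. -/
theorem contDiff_one_of_partials {f f₁ f₂ : ℝ → ℝ → ℝ}
    (h₁ : ∀ t x, HasDerivAt (fun s => f s x) (f₁ t x) t)
    (h₂ : ∀ t x, HasDerivAt (fun y => f t y) (f₂ t x) x)
    (c₁ : Continuous (Function.uncurry f₁)) (c₂ : Continuous (Function.uncurry f₂)) :
    ContDiff ℝ 1 (Function.uncurry f) := by
  have d₁ : Continuous (Function.uncurry fun t x => f₁ t x • ContinuousLinearMap.id ℝ ℝ) :=
    c₁.smul continuous_const
  have d₂ : Continuous (Function.uncurry fun t x => f₂ t x • ContinuousLinearMap.id ℝ ℝ) :=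
    c₂.smul continuous_const
  have key : ∀ a : ℝ, a • ContinuousLinearMap.id ℝ ℝ = ContinuousLinearMap.toSpanSingleton ℝ a := by
    intro a; ext; simp
  refine contDiff_one_iff_hasFDerivAt.2 ⟨fun u =>
    f₁ u.1 u.2 • ContinuousLinearMap.fst ℝ ℝ ℝ + f₂ u.1 u.2 • ContinuousLinearMap.snd ℝ ℝ ℝ,
    (c₁.smul continuous_const).add (c₂.smul continuous_const), fun u => ?_⟩
  have h := (hasStrictFDerivAt_uncurry_coprod (u := u) (f := f)
      (f₁ := fun t x => f₁ t x • ContinuousLinearMap.id ℝ ℝ)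
      (f₂ := fun t x => f₂ t x • ContinuousLinearMap.id ℝ ℝ)
      (Filter.Eventually.of_forall fun v => by
        have := (h₁ v.1 v.2).hasFDerivAt
        rw [← key] at this; exact this)
      (Filter.Eventually.of_forall fun v => by
        have := (h₂ v.1 v.2).hasFDerivAt
        rw [← key] at this; exact this)
      d₁.continuousAt d₂.continuousAt).hasFDerivAt
  refine h.congr_fderiv ?_
  ext <;> simp [Function.HasUncurry.uncurry]

/-! ### Partial derivatives of test functions. -/

section Partials

variable {φ : ℝ → ℝ → ℝ}

theorem hasDerivAt_fst_of_contDiff (hφ : ContDiff ℝ 1 (Function.uncurry φ)) (t x : ℝ) :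
    HasDerivAt (fun s => φ s x) (fderiv ℝ (Function.uncurry φ) (t, x) (1, 0)) t := by
  have h := ((hφ.differentiable one_ne_zero) (t, x)).hasFDerivAt
  exact h.comp_hasDerivAt t ((hasDerivAt_id t).prodMk (hasDerivAt_const t x))

theorem hasDerivAt_snd_of_contDiff (hφ : ContDiff ℝ 1 (Function.uncurry φ)) (t x : ℝ) :
    HasDerivAt (fun y => φ t y) (fderiv ℝ (Function.uncurry φ) (t, x) (0, 1)) x := by
  have h := ((hφ.differentiable one_ne_zero) (t, x)).hasFDerivAt
  exact h.comp_hasDerivAt x ((hasDerivAt_const x t).prodMk (hasDerivAt_id x))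

theorem continuous_deriv_fst (hφ : ContDiff ℝ 1 (Function.uncurry φ)) :
    Continuous (Function.uncurry fun t x => deriv (fun s => φ s x) t) := by
  have : (Function.uncurry fun t x => deriv (fun s => φ s x) t) =
      fun z => fderiv ℝ (Function.uncurry φ) z (1, 0) := by
    funext z
    exact (hasDerivAt_fst_of_contDiff hφ z.1 z.2).deriv
  rw [this]
  exact (hφ.continuous_fderiv one_ne_zero).clm_apply continuous_const

theorem continuous_deriv_snd (hφ : ContDiff ℝ 1 (Function.uncurry φ)) :
    Continuous (Function.uncurry fun t x => deriv (fun y => φ t y) x) := by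
  have : (Function.uncurry fun t x => deriv (fun y => φ t y) x) =
      fun z => fderiv ℝ (Function.uncurry φ) z (0, 1) := by
    funext z
    exact (hasDerivAt_snd_of_contDiff hφ z.1 z.2).deriv
  rw [this]
  exact (hφ.continuous_fderiv one_ne_zero).clm_apply continuous_const

theorem hasDerivAt_primitive_fst (hφ : ContDiff ℝ 1 (Function.uncurry φ)) (t x : ℝ) :
    HasDerivAt (fun s => ∫ y in (0 : ℝ)..x, φ s y)
      (∫ y in (0 : ℝ)..x, deriv (fun s => φ s y) t) t := by
  have hc := continuous_deriv_fst hφ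
  have hφc := hφ.continuous
  obtain ⟨C, hC⟩ := ((isCompact_Icc (a := t - 1) (b := t + 1)).prod
    (isCompact_uIcc (a := 0) (b := x))).exists_bound_of_continuousOn hc.continuousOn
  refine (intervalIntegral.hasDerivAt_integral_of_dominated_loc_of_deriv_le (𝕜 := ℝ)
    (F := φ) (F' := fun s y => deriv (fun s => φ s y) s) (bound := fun _ => C)
    (Icc_mem_nhds (by linarith : t - 1 < t) (by linarith : t < t + 1)) ?_ ?_ ?_ ?_ ?_ ?_).2
  · exact Filter.Eventually.of_forall fun s =>
      (hφc.comp (Continuous.prodMk_right s)).aestronglyMeasurable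
  · exact (hφc.comp (Continuous.prodMk_right t)).intervalIntegrable _ _
  · exact (hc.comp (Continuous.prodMk_right t)).aestronglyMeasurable
  · exact Filter.Eventually.of_forall fun y hy s hs => hC (s, y) ⟨hs, uIoc_subset_uIcc hy⟩
  · exact intervalIntegrable_const
  · exact Filter.Eventually.of_forall fun y _ s _ =>
      (hasDerivAt_fst_of_contDiff hφ s y).differentiableAt.hasDerivAt

end Partials

/-- The `L²` norm of the constant `1` on `[l, r]`. -/
noncomputable def l2One (l r : ℝ) : ℝ :=
  (measureUnivNNReal (volume.restrict (Icc l r)) : ℝ) ^ (2 : ENNReal).toReal⁻¹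

theorem l2One_nonneg (l r : ℝ) : 0 ≤ l2One l r := Real.rpow_nonneg (NNReal.coe_nonneg _) _

/-! ### Pairings of `L²` states with continuous functions. -/

section Pairing

variable {l r : ℝ}

theorem integral_mul_eq_inner (u : Lp ℝ 2 (volume.restrict (Icc l r))) {ψ : ℝ → ℝ}
    (hψ : MemLp ψ 2 (volume.restrict (Icc l r))) :
    ∫ x in Icc l r, u x * ψ x = inner ℝ (hψ.toLp ψ) u := by
  rw [L2.inner_def]
  refine integral_congr_ae ?_
  filter_upwards [hψ.coeFn_toLp] with x hx
  rw [hx]; rfl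

theorem integral_sq_eq_norm_sq (u : Lp ℝ 2 (volume.restrict (Icc l r))) :
    ∫ x in Icc l r, u x ^ 2 = ‖u‖ ^ 2 := by
  rw [← real_inner_self_eq_norm_sq, L2.inner_def]
  refine integral_congr_ae (Filter.Eventually.of_forall fun x => ?_)
  simp [sq]

theorem norm_toLp_le {ψ : ℝ → ℝ} (hψ : MemLp ψ 2 (volume.restrict (Icc l r))) {C : ℝ} (hC : 0 ≤ C)
    (h : ∀ x ∈ Icc l r, |ψ x| ≤ C) : ‖hψ.toLp ψ‖ ≤ l2One l r * C := by
  refine Lp.norm_le_of_ae_bound hC ?_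
  filter_upwards [hψ.coeFn_toLp, ae_restrict_mem measurableSet_Icc] with x hx hx'
  rw [hx]
  exact h x hx'

theorem memLp_two_of_bound {ψ : ℝ → ℝ} (hψ : AEStronglyMeasurable ψ (volume.restrict (Icc l r)))
    {C : ℝ} (h : ∀ x ∈ Icc l r, |ψ x| ≤ C) : MemLp ψ 2 (volume.restrict (Icc l r)) :=
  MemLp.of_bound hψ C ((ae_restrict_mem measurableSet_Icc).mono fun x hx => h x hx)

theorem abs_integral_mul_le (u : Lp ℝ 2 (volume.restrict (Icc l r))) {ψ : ℝ → ℝ}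
    (hψ : AEStronglyMeasurable ψ (volume.restrict (Icc l r))) {C : ℝ} (hC : 0 ≤ C)
    (h : ∀ x ∈ Icc l r, |ψ x| ≤ C) :
    |∫ x in Icc l r, u x * ψ x| ≤ l2One l r * C * ‖u‖ := by
  rw [integral_mul_eq_inner u (memLp_two_of_bound hψ h)]
  exact (abs_real_inner_le_norm _ _).trans
    (mul_le_mul_of_nonneg_right (norm_toLp_le _ hC h) (norm_nonneg _))

theorem exists_bound_Icc {ψ : ℝ → ℝ} (hψ : Continuous ψ) (l r : ℝ) :
    ∃ C, 0 ≤ C ∧ ∀ x ∈ Icc l r, |ψ x| ≤ C := by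
  obtain ⟨C, hC⟩ := (isCompact_Icc (a := l) (b := r)).exists_bound_of_continuousOn hψ.continuousOn
  exact ⟨max C 0, le_max_right _ _, fun x hx => (hC x hx).trans (le_max_left _ _)⟩

theorem memLp_two_of_continuous {ψ : ℝ → ℝ} (hψ : Continuous ψ) :
    MemLp ψ 2 (volume.restrict (Icc l r)) := by
  obtain ⟨C, -, hC⟩ := exists_bound_Icc hψ l r
  exact memLp_two_of_bound hψ.aestronglyMeasurable hC

theorem integrable_coe (u : Lp ℝ 2 (volume.restrict (Icc l r))) :
    IntegrableOn u (Icc l r) :=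
  (Lp.memLp u).integrable one_le_two

theorem integrable_coe_mul (u : Lp ℝ 2 (volume.restrict (Icc l r))) {ψ : ℝ → ℝ}
    (hψ : Continuous ψ) : IntegrableOn (fun x => u x * ψ x) (Icc l r) :=
  (integrable_coe u).mul_continuousOn hψ.continuousOn isCompact_Icc

/-- Currying makes `t ↦ ψ t` continuous for the sup norm on the compact interval, and the sup norm
dominates the `L²` norm up to `l2One`. -/
theorem continuous_toLp_curve {ψ : ℝ → ℝ → ℝ} (hψ : Continuous (Function.uncurry ψ)) :
    Continuous fun t => (memLp_two_of_continuous (l := l) (r := r)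
      (hψ.uncurry_left t)).toLp (ψ t) := by
  let F : C(ℝ, C(Icc l r, ℝ)) := ContinuousMap.curry
    ⟨fun p : ℝ × Icc l r => ψ p.1 p.2, hψ.comp (continuous_fst.prodMk
      (continuous_subtype_val.comp continuous_snd))⟩
  rw [continuous_iff_continuousAt]
  intro t₀
  have hF : Filter.Tendsto (fun t => l2One l r * dist (F t) (F t₀)) (nhds t₀) (nhds 0) := by
    have := (F.continuous.tendsto t₀).dist (tendsto_const_nhds (x := F t₀))
    rw [dist_self] at this
    simpa using this.const_mul (l2One l r)
  refine tendsto_iff_norm_sub_tendsto_zero.2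
    (squeeze_zero (fun _ => norm_nonneg _) (fun t => ?_) hF)
  dsimp only
  rw [← MemLp.toLp_sub]
  refine norm_toLp_le _ dist_nonneg fun x hx => ?_
  exact ContinuousMap.dist_apply_le_dist (f := F t) (g := F t₀) ⟨x, hx⟩

theorem continuousOn_integral_mul {u : ℝ → Lp ℝ 2 (volume.restrict (Icc l r))} {s : Set ℝ}
    (hu : ContinuousOn u s) {ψ : ℝ → ℝ → ℝ} (hψ : Continuous (Function.uncurry ψ)) :
    ContinuousOn (fun t => ∫ x in Icc l r, u t x * ψ t x) s := by
  have : (fun t => ∫ x in Icc l r, u t x * ψ t x) = fun t =>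
      inner ℝ ((memLp_two_of_continuous (l := l) (r := r)
        (hψ.uncurry_left t)).toLp (ψ t)) (u t) := by
    funext t
    exact integral_mul_eq_inner (u t) _
  rw [this]
  exact (continuous_toLp_curve hψ).continuousOn.inner hu

theorem intervalIntegrable_integral_mul {u : ℝ → Lp ℝ 2 (volume.restrict (Icc l r))}
    (hu : ContinuousOn u (Ici 0)) {ψ : ℝ → ℝ → ℝ} (hψ : Continuous (Function.uncurry ψ)) {T : ℝ}
    (hT : 0 ≤ T) :
    IntervalIntegrable (fun t => ∫ x in Icc l r, u t x * ψ t x) volume 0 T := by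
  refine ContinuousOn.intervalIntegrable ?_
  rw [uIcc_of_le hT]
  exact (continuousOn_integral_mul hu hψ).mono Icc_subset_Ici_self

end Pairing

/-! ### Volterra operators on `L²`. -/

section Volterra

variable {l r b : ℝ}

theorem intervalIntegrable_coe_mul (hlr : l ≤ r) (u : Lp ℝ 2 (volume.restrict (Icc l r)))
    {m : ℝ → ℝ} (hm : Continuous m) : IntervalIntegrable (fun x => m x * u x) volume l r := by
  rw [intervalIntegrable_iff_integrableOn_Icc_of_le hlr]
  simpa only [mul_comm] using integrable_coe_mul u hm

/-- Up to sign the primitive is the pairing of `u` with `m` cut off to the interval between `b` and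
`x`, so Cauchy–Schwarz applies, uniformly in `x`. -/
theorem abs_primitive_le (u : Lp ℝ 2 (volume.restrict (Icc l r))) {m : ℝ → ℝ} (hm : Continuous m)
    {C : ℝ} (hC0 : 0 ≤ C) (hC : ∀ x ∈ Icc l r, |m x| ≤ C) {b x : ℝ} (hb : b ∈ Icc l r)
    (hx : x ∈ Icc l r) : |∫ y in b..x, m y * u y| ≤ l2One l r * C * ‖u‖ := by
  rw [intervalIntegral.abs_integral_eq_abs_integral_uIoc]
  have hsub : uIoc b x ⊆ Icc l r := uIoc_subset_uIcc.trans (uIcc_subset_Icc hb hx)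
  have h := abs_integral_mul_le u (ψ := (uIoc b x).indicator m)
    (hm.aestronglyMeasurable.indicator measurableSet_uIoc) hC0 (fun y hy => by
      by_cases h : y ∈ uIoc b x
      · rw [indicator_of_mem h]; exact hC y hy
      · rw [indicator_of_notMem h, abs_zero]; exact hC0)
  have e : ∫ y in Icc l r, u y * (uIoc b x).indicator m y = ∫ y in uIoc b x, m y * u y := by
    have : (fun y => u y * (uIoc b x).indicator m y) =
        (uIoc b x).indicator fun y => m y * u y := by
      funext y
      by_cases h : y ∈ uIoc b x
      · rw [indicator_of_mem h, indicator_of_mem h, mul_comm]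
      · rw [indicator_of_notMem h, indicator_of_notMem h, mul_zero]
    rw [this, setIntegral_indicator measurableSet_uIoc, inter_eq_self_of_subset_right hsub]
  rwa [e] at h

theorem continuousOn_primitive_coe (hlr : l ≤ r) (u : Lp ℝ 2 (volume.restrict (Icc l r)))
    {m : ℝ → ℝ} (hm : Continuous m) (hb : b ∈ Icc l r) :
    ContinuousOn (fun x => ∫ y in b..x, m y * u y) (Icc l r) := by
  have h := intervalIntegral.continuousOn_primitive_interval' (μ := volume) (b₁ := l) (b₂ := r)
    (intervalIntegrable_coe_mul hlr u hm) (a := b) (by rwa [uIcc_of_le hlr])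
  rwa [uIcc_of_le hlr] at h

theorem intervalIntegrable_coe_mul_sub (hlr : l ≤ r) (u : Lp ℝ 2 (volume.restrict (Icc l r)))
    {m : ℝ → ℝ} (hm : Continuous m) {x y : ℝ} (hx : x ∈ Icc l r) (hy : y ∈ Icc l r) :
    IntervalIntegrable (fun x => m x * u x) volume x y :=
  (intervalIntegrable_coe_mul hlr u hm).mono_set
    (by rw [uIcc_of_le hlr]; exact uIcc_subset_Icc hx hy)

/-- The Volterra operator `u ↦ (x ↦ m₁(x) ∫_b^x m₂(y) u(y) dy)` on `L²(l, r)`. -/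
theorem exists_volterra (hlr : l ≤ r) (hb : b ∈ Icc l r) {m₁ m₂ : ℝ → ℝ} (h₁ : Continuous m₁)
    (h₂ : Continuous m₂) :
    ∃ V : Lp ℝ 2 (volume.restrict (Icc l r)) →L[ℝ] Lp ℝ 2 (volume.restrict (Icc l r)),
      ∀ u, (V u : ℝ → ℝ) =ᵐ[volume.restrict (Icc l r)]
        fun x => m₁ x * ∫ y in b..x, m₂ y * u y := by
  obtain ⟨C₁, hC₁0, hC₁⟩ := exists_bound_Icc h₁ l r
  obtain ⟨C₂, hC₂0, hC₂⟩ := exists_bound_Icc h₂ l r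
  have hbd : ∀ (u : Lp ℝ 2 (volume.restrict (Icc l r))), ∀ x ∈ Icc l r,
      |m₁ x * ∫ y in b..x, m₂ y * u y| ≤ C₁ * (l2One l r * C₂ * ‖u‖) := by
    intro u x hx
    rw [abs_mul]
    exact mul_le_mul (hC₁ x hx) (abs_primitive_le u h₂ hC₂0 hC₂ hb hx) (abs_nonneg _) hC₁0
  have hmem : ∀ u : Lp ℝ 2 (volume.restrict (Icc l r)),
      MemLp (fun x => m₁ x * ∫ y in b..x, m₂ y * u y) 2 (volume.restrict (Icc l r)) := by
    intro u
    refine memLp_two_of_bound ?_ (hbd u)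
    exact (h₁.continuousOn.mul (continuousOn_primitive_coe hlr u h₂ hb)).aestronglyMeasurable
      measurableSet_Icc
  let V₀ : Lp ℝ 2 (volume.restrict (Icc l r)) →ₗ[ℝ] Lp ℝ 2 (volume.restrict (Icc l r)) :=
    { toFun := fun u => (hmem u).toLp _
      map_add' := by
        intro u v
        rw [← MemLp.toLp_add, MemLp.toLp_eq_toLp_iff]
        filter_upwards [ae_restrict_mem measurableSet_Icc] with x hx
        rw [Pi.add_apply, ← mul_add, ← intervalIntegral.integral_add
          (intervalIntegrable_coe_mul_sub hlr u h₂ hb hx)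
          (intervalIntegrable_coe_mul_sub hlr v h₂ hb hx)]
        congr 1
        refine intervalIntegral.integral_congr_ae ?_
        filter_upwards [(ae_restrict_iff' measurableSet_Icc).1 (Lp.coeFn_add u v)] with y hy hy'
        rw [hy (uIcc_subset_Icc hb hx (uIoc_subset_uIcc hy')), Pi.add_apply, mul_add]
      map_smul' := by
        intro a u
        rw [RingHom.id_apply, ← MemLp.toLp_const_smul, MemLp.toLp_eq_toLp_iff]
        filter_upwards [ae_restrict_mem measurableSet_Icc] with x hx
        have e : ∫ y in b..x, m₂ y * (a • u : Lp ℝ 2 (volume.restrict (Icc l r))) y =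
            a * ∫ y in b..x, m₂ y * u y := by
          rw [← intervalIntegral.integral_const_mul]
          refine intervalIntegral.integral_congr_ae ?_
          filter_upwards [(ae_restrict_iff' measurableSet_Icc).1 (Lp.coeFn_smul a u)] with y hy hy'
          rw [hy (uIcc_subset_Icc hb hx (uIoc_subset_uIcc hy')), Pi.smul_apply, smul_eq_mul,
            mul_left_comm]
        rw [Pi.smul_apply, smul_eq_mul, e, mul_left_comm] }
  refine ⟨V₀.mkContinuous (l2One l r * (C₁ * (l2One l r * C₂))) fun u => ?_,
    fun u => (hmem u).coeFn_toLp⟩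
  have hK := l2One_nonneg l r
  refine (norm_toLp_le (hmem u) (C := C₁ * (l2One l r * C₂ * ‖u‖)) (by positivity)
    (hbd u)).trans_eq ?_
  ring

end Volterra

/-! ### Change of variables to the foot of a characteristic. -/

section ChangeOfVariables

/-- Substitution `y = e - σ t`: the characteristic through the end point `e` at time `t` has the
foot `y` at time `0`. A boundary trace thereby becomes a function on the same line as the initial
and final profiles. -/
theorem integral_indicator_boundary (p q : ℝ → ℝ) {σ : ℝ} (hσ : σ ≠ 0) (e : ℝ) {T : ℝ}
    (hT : 0 ≤ T) :
    ∫ y, (Ioo 0 T).indicator p ((e - y) / σ) * q y = |σ| * ∫ t in (0 : ℝ)..T, p t * q (e - σ * t) := by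
  set F : ℝ → ℝ := (Ioo 0 T).indicator fun t => p t * q (e - σ * t) with hF
  have h1 : (fun y => (Ioo 0 T).indicator p ((e - y) / σ) * q y) = fun y => F ((e - y) / σ) := by
    funext y
    by_cases h : (e - y) / σ ∈ Ioo 0 T
    · rw [hF, indicator_of_mem h, indicator_of_mem h, mul_div_cancel₀ _ hσ, sub_sub_cancel]
    · rw [hF, indicator_of_notMem h, indicator_of_notMem h, zero_mul]
  rw [h1, integral_sub_left_eq_self (fun y => F (y / σ)) volume e, Measure.integral_comp_div,
    smul_eq_mul, hF, integral_indicator measurableSet_Ioo, intervalIntegral.integral_of_le hT,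
    integral_Ioc_eq_integral_Ioo]

theorem integrable_indicator_boundary {p q : ℝ → ℝ} {σ : ℝ} (hσ : σ ≠ 0) (e : ℝ) {T : ℝ}
    (hp : IntegrableOn p (Icc 0 T)) (hq : Continuous q) :
    Integrable fun y => (Ioo 0 T).indicator p ((e - y) / σ) * q y := by
  set F : ℝ → ℝ := (Ioo 0 T).indicator fun t => p t * q (e - σ * t) with hF
  have h1 : (fun y => (Ioo 0 T).indicator p ((e - y) / σ) * q y) = fun y => F ((e - y) / σ) := by
    funext y
    by_cases h : (e - y) / σ ∈ Ioo 0 T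
    · rw [hF, indicator_of_mem h, indicator_of_mem h, mul_div_cancel₀ _ hσ, sub_sub_cancel]
    · rw [hF, indicator_of_notMem h, indicator_of_notMem h, zero_mul]
  have h2 : Integrable F := by
    refine IntegrableOn.integrable_indicator ?_ measurableSet_Ioo
    exact (hp.mul_continuousOn (g' := fun t => q (e - σ * t)) (by fun_prop) isCompact_Icc).mono_set
      Ioo_subset_Icc_self
  rw [h1]
  exact (h2.comp_div hσ).comp_sub_left e

theorem integral_indicator_interior (p q : ℝ → ℝ) (l r s : ℝ) :
    ∫ y, (Icc l r).indicator p (y + s) * q y = ∫ x in Icc l r, p x * q (x - s) := by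
  rw [← integral_indicator measurableSet_Icc,
    ← integral_add_right_eq_self ((Icc l r).indicator fun x => p x * q (x - s)) s]
  congr 1
  funext y
  by_cases h : y + s ∈ Icc l r
  · rw [indicator_of_mem h, indicator_of_mem h, add_sub_cancel_right]
  · rw [indicator_of_notMem h, indicator_of_notMem h, zero_mul]

theorem integrable_indicator_interior {p q : ℝ → ℝ} {l r : ℝ} (s : ℝ)
    (hp : IntegrableOn p (Icc l r)) (hq : Continuous q) :
    Integrable fun y => (Icc l r).indicator p (y + s) * q y := by
  have h2 : Integrable ((Icc l r).indicator fun x => p x * q (x - s)) := by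
    refine IntegrableOn.integrable_indicator ?_ measurableSet_Icc
    exact hp.mul_continuousOn (g' := fun x => q (x - s)) (by fun_prop) isCompact_Icc
  convert h2.comp_add_right s using 1
  funext y
  by_cases h : y + s ∈ Icc l r
  · rw [indicator_of_mem h, indicator_of_mem h, add_sub_cancel_right]
  · rw [indicator_of_notMem h, indicator_of_notMem h, zero_mul]

theorem indicator_sq (s : Set ℝ) (p : ℝ → ℝ) (x : ℝ) :
    s.indicator p x ^ 2 = s.indicator (fun x => p x ^ 2) x := by
  by_cases h : x ∈ s
  · rw [indicator_of_mem h, indicator_of_mem h]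
  · rw [indicator_of_notMem h, indicator_of_notMem h, sq, zero_mul]

/-- Two pairs of functions with disjoint supports and with the same sum in the sense of
distributions: the sums of the squares agree. -/
theorem integral_sq_eq_of_weak_eq {A B C D : ℝ → ℝ} (hA : Integrable A) (hB : Integrable B)
    (hC : Integrable C) (hD : Integrable D) (hAB : ∀ y, A y * B y = 0) (hCD : ∀ y, C y * D y = 0)
    (h : ∀ ψ : ℝ → ℝ, ContDiff ℝ 1 ψ →
      (∫ y, A y * ψ y) + (∫ y, B y * ψ y) = (∫ y, C y * ψ y) + ∫ y, D y * ψ y)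
    {q : ℝ → ℝ} (iA : Integrable fun y => A y ^ 2 * q y) (iB : Integrable fun y => B y ^ 2 * q y)
    (iC : Integrable fun y => C y ^ 2 * q y) (iD : Integrable fun y => D y ^ 2 * q y) :
    (∫ y, A y ^ 2 * q y) + (∫ y, B y ^ 2 * q y) =
      (∫ y, C y ^ 2 * q y) + ∫ y, D y ^ 2 * q y := by
  -- Equality as distributions gives equality almost everywhere; squaring then produces no cross
  -- terms, because the supports are disjoint.
  have hae : ∀ᵐ y, A y + B y = C y + D y := by
    refine ae_eq_of_integral_contDiff_smul_eq (hA.add hB).locallyIntegrable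
      (hC.add hD).locallyIntegrable fun ψ hψ hs => ?_
    have hψc := hψ.continuous
    obtain ⟨M, hM⟩ := hs.exists_bound_of_continuous hψc
    have int : ∀ {F : ℝ → ℝ}, Integrable F → Integrable fun y => F y * ψ y := fun hF =>
      hF.mul_bdd (c := M) hψc.aestronglyMeasurable (Filter.Eventually.of_forall hM)
    have := h ψ (hψ.of_le (by exact_mod_cast le_top))
    rw [← integral_add (int hA) (int hB), ← integral_add (int hC) (int hD)] at this
    simpa only [smul_eq_mul, Pi.add_apply, mul_comm, mul_add] using this
  rw [← integral_add iA iB, ← integral_add iC iD]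
  refine integral_congr_ae ?_
  filter_upwards [hae] with y hy
  have h1 : (A y + B y) ^ 2 = (C y + D y) ^ 2 := by rw [hy]
  linear_combination q y * h1 - 2 * q y * hAB y + 2 * q y * hCD y

end ChangeOfVariables

theorem integrableOn_sq_of_memLp_two {p : ℝ → ℝ} {s : Set ℝ} (h : MemLp p 2 (volume.restrict s)) :
    IntegrableOn (fun x => p x ^ 2) s := h.integrable_sq

/-! ### The energy identity for weak solutions. -/

namespace ARZNetwork

variable {S : ARZNetwork}

namespace IsTransportSolution

variable {i : Road} {σ : ℝ} {u : ℝ → S.L2 i} {ul ur : ℝ → ℝ}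

/-- A test function of `x - σ t` alone is annihilated by the transport operator, so only the
initial, final and boundary terms survive. -/
theorem weak_form_characteristic (h : S.IsTransportSolution i σ (fun _ _ => 0) u ul ur) {T : ℝ}
    (hT : 0 ≤ T) {ψ : ℝ → ℝ} (hψ : ContDiff ℝ 1 ψ) :
    (∫ x in Icc (S.left i) (S.right i), u T x * ψ (x - σ * T)) -
      (∫ x in Icc (S.left i) (S.right i), u 0 x * ψ x) +
      σ * ((∫ t in (0 : ℝ)..T, ur t * ψ (S.right i - σ * t)) -
        ∫ t in (0 : ℝ)..T, ul t * ψ (S.left i - σ * t)) = 0 := by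
  have hφ : ContDiff ℝ 1 (Function.uncurry fun t x : ℝ => ψ (x - σ * t)) :=
    hψ.comp (contDiff_snd.sub (contDiff_const.mul contDiff_fst))
  have key := h.weak_form _ hφ T hT
  have hz : ∀ t x : ℝ, deriv (fun s => ψ (x - σ * s)) t + σ * deriv (fun y => ψ (y - σ * t)) x
      = 0 := by
    intro t x
    have hd := (hψ.differentiable one_ne_zero (x - σ * t)).hasDerivAt
    have h1 : HasDerivAt (fun s => x - σ * s) (-σ) t := by
      simpa using ((hasDerivAt_id t).const_mul σ).const_sub x
    have h2 : HasDerivAt (fun y => y - σ * t) 1 x := (hasDerivAt_id x).sub_const _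
    have e1 := (hd.comp t h1).deriv
    have e2 := (hd.comp x h2).deriv
    simp only [Function.comp_def] at e1 e2
    rw [e1, e2]
    ring
  have hψc := hψ.continuous
  simp only [hz, mul_zero, zero_mul, add_zero, integral_zero, intervalIntegral.integral_zero,
    sub_zero] at key
  have hint : ∀ {p : ℝ → ℝ} (e : ℝ), MemLp p 2 (volume.restrict (Icc 0 T)) →
      IntervalIntegrable (fun t => p t * ψ (e - σ * t)) volume 0 T := by
    intro p e hp
    rw [intervalIntegrable_iff_integrableOn_Icc_of_le hT]
    exact IntegrableOn.mul_continuousOn (hp.integrable one_le_two)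
      (g' := fun t => ψ (e - σ * t)) (by fun_prop) isCompact_Icc
  rwa [intervalIntegral.integral_sub (hint _ (h.right_trace T)) (hint _ (h.left_trace T))] at key

/-- Conservation of the squares along the characteristics, with an arbitrary weight. -/
theorem energy (h : S.IsTransportSolution i σ (fun _ _ => 0) u ul ur) (hσ : σ ≠ 0) {T : ℝ}
    (hT : 0 ≤ T) {q : ℝ → ℝ} (hq : Continuous q) :
    (∫ x in Icc (S.left i) (S.right i), u T x ^ 2 * q (x - σ * T)) +
      σ * ((∫ t in (0 : ℝ)..T, ur t ^ 2 * q (S.right i - σ * t)) -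
        ∫ t in (0 : ℝ)..T, ul t ^ 2 * q (S.left i - σ * t)) =
      ∫ x in Icc (S.left i) (S.right i), u 0 x ^ 2 * q x := by
  set l := S.left i
  set r := S.right i
  -- All data are indexed by the foot `y` of the characteristic: final state, right trace, initial
  -- state, left trace. The open interval `Ioo 0 T` makes the relevant supports exactly disjoint.
  set A : ℝ → ℝ := fun y => (Icc l r).indicator (u T) (y + σ * T) with hA
  set B : ℝ → ℝ := fun y => (Ioo 0 T).indicator ur ((r - y) / σ) with hB
  set C : ℝ → ℝ := fun y => (Icc l r).indicator (u 0) (y + 0) with hC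
  set D : ℝ → ℝ := fun y => (Ioo 0 T).indicator ul ((l - y) / σ) with hD
  have h1 : Continuous fun _ : ℝ => (1 : ℝ) := continuous_const
  have jl := (h.left_trace T).integrable one_le_two
  have jr := (h.right_trace T).integrable one_le_two
  have sl := integrableOn_sq_of_memLp_two (h.left_trace T)
  have sr := integrableOn_sq_of_memLp_two (h.right_trace T)
  have s0 := integrableOn_sq_of_memLp_two (Lp.memLp (u 0))
  have sT := integrableOn_sq_of_memLp_two (Lp.memLp (u T))
  have iA : Integrable A := by
    simpa only [mul_one] using integrable_indicator_interior (σ * T) (integrable_coe (u T)) h1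
  have iB : Integrable B := by simpa only [mul_one] using integrable_indicator_boundary hσ r jr h1
  have iC : Integrable C := by
    simpa only [mul_one] using integrable_indicator_interior 0 (integrable_coe (u 0)) h1
  have iD : Integrable D := by simpa only [mul_one] using integrable_indicator_boundary hσ l jl h1
  have qA : Integrable fun y => A y ^ 2 * q y := by
    simpa only [hA, indicator_sq] using integrable_indicator_interior (σ * T) sT hq
  have qB : Integrable fun y => B y ^ 2 * q y := by
    simpa only [hB, indicator_sq] using integrable_indicator_boundary hσ r sr hq
  have qC : Integrable fun y => C y ^ 2 * q y := by
    simpa only [hC, indicator_sq] using integrable_indicator_interior 0 s0 hq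
  have qD : Integrable fun y => D y ^ 2 * q y := by
    simpa only [hD, indicator_sq] using integrable_indicator_boundary hσ l sl hq
  have eA : ∀ ψ : ℝ → ℝ, ∫ y, A y * ψ y = ∫ x in Icc l r, u T x * ψ (x - σ * T) := fun ψ =>
    integral_indicator_interior _ _ _ _ _
  have eB : ∀ ψ : ℝ → ℝ, ∫ y, B y * ψ y = |σ| * ∫ t in (0 : ℝ)..T, ur t * ψ (r - σ * t) := fun ψ =>
    integral_indicator_boundary _ _ hσ _ hT
  have eC : ∀ ψ : ℝ → ℝ, ∫ y, C y * ψ y = ∫ x in Icc l r, u 0 x * ψ x := fun ψ => by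
    simpa only [sub_zero] using integral_indicator_interior (u 0) ψ l r 0
  have eD : ∀ ψ : ℝ → ℝ, ∫ y, D y * ψ y = |σ| * ∫ t in (0 : ℝ)..T, ul t * ψ (l - σ * t) := fun ψ =>
    integral_indicator_boundary _ _ hσ _ hT
  have fA : ∫ y, A y ^ 2 * q y = ∫ x in Icc l r, u T x ^ 2 * q (x - σ * T) := by
    simpa only [hA, indicator_sq] using integral_indicator_interior (fun x => u T x ^ 2) q l r (σ * T)
  have fB : ∫ y, B y ^ 2 * q y = |σ| * ∫ t in (0 : ℝ)..T, ur t ^ 2 * q (r - σ * t) := by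
    simpa only [hB, indicator_sq] using
      integral_indicator_boundary (fun x => ur x ^ 2) q hσ r hT
  have fC : ∫ y, C y ^ 2 * q y = ∫ x in Icc l r, u 0 x ^ 2 * q x := by
    simpa only [hC, indicator_sq, sub_zero] using
      integral_indicator_interior (fun x => u 0 x ^ 2) q l r 0
  have fD : ∫ y, D y ^ 2 * q y = |σ| * ∫ t in (0 : ℝ)..T, ul t ^ 2 * q (l - σ * t) := by
    simpa only [hD, indicator_sq] using
      integral_indicator_boundary (fun x => ul x ^ 2) q hσ l hT
  have disj : ∀ {f g : ℝ → ℝ} (e s y : ℝ), ((e - y) / σ ∈ Ioo 0 T → y + s ∉ Icc l r) →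
      (Icc l r).indicator f (y + s) * (Ioo 0 T).indicator g ((e - y) / σ) = 0 := by
    intro f g e s y hy
    by_cases h : (e - y) / σ ∈ Ioo 0 T
    · rw [indicator_of_notMem (hy h), zero_mul]
    · rw [indicator_of_notMem h, mul_zero]
  -- What leaves equals what enters. For `σ > 0` the final state and the right trace balance the
  -- initial state and the left trace; for `σ < 0` the two traces exchange their roles.
  rcases lt_or_gt_of_ne hσ with hneg | hpos
  · have hm : ∀ {e y : ℝ}, (e - y) / σ ∈ Ioo 0 T → e < y ∧ y + σ * T < e := by
      intro e y hy
      have h2 := (div_lt_iff_of_neg hneg).1 hy.2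
      have h3 := (lt_div_iff_of_neg hneg).1 hy.1
      constructor <;> nlinarith
    have key := integral_sq_eq_of_weak_eq iA iD iC iB
      (fun y => disj l _ y fun hy hc => by linarith [(hm hy).2, hc.1])
      (fun y => disj r _ y fun hy hc => by linarith [(hm hy).1, hc.2])
      (fun ψ hψ => by
        have := h.weak_form_characteristic hT hψ
        rw [eA, eB, eC, eD, abs_of_neg hneg]
        linear_combination this) qA qD qC qB
    rw [fA, fB, fC, fD, abs_of_neg hneg] at key
    linear_combination key
  · have hm : ∀ {e y : ℝ}, (e - y) / σ ∈ Ioo 0 T → y < e ∧ e < y + σ * T := by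
      intro e y hy
      have h2 := (div_lt_iff₀ hpos).1 hy.2
      have h3 := (lt_div_iff₀ hpos).1 hy.1
      constructor <;> nlinarith
    have key := integral_sq_eq_of_weak_eq iA iB iC iD
      (fun y => disj r _ y fun hy hc => by linarith [(hm hy).2, hc.2])
      (fun y => disj l _ y fun hy hc => by linarith [(hm hy).1, hc.1])
      (fun ψ hψ => by
        have := h.weak_form_characteristic hT hψ
        rw [eA, eB, eC, eD, abs_of_pos hpos]
        linear_combination this) qA qB qC qD
    rw [fA, fB, fC, fD, abs_of_pos hpos] at key
    linear_combination key

end IsTransportSolution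

end ARZNetwork

/-! ### The moment, and the equation it satisfies. -/

namespace ARZNetwork

variable {S : ARZNetwork} {i : Road}

/-- The `L²` pairing of a state on the road `i` with a test function. -/
noncomputable def pair (u : S.L2 i) (ψ : ℝ → ℝ) : ℝ :=
  ∫ x in Icc (S.left i) (S.right i), u x * ψ x

theorem pair_add (u : S.L2 i) {ψ χ : ℝ → ℝ} (hψ : Continuous ψ) (hχ : Continuous χ) :
    pair u (fun x => ψ x + χ x) = pair u ψ + pair u χ := by
  unfold pair
  rw [← integral_add (integrable_coe_mul u hψ) (integrable_coe_mul u hχ)]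
  simp only [mul_add]

theorem pair_const_mul (u : S.L2 i) (k : ℝ) (ψ : ℝ → ℝ) :
    pair u (fun x => k * ψ x) = k * pair u ψ := by
  unfold pair
  rw [← integral_const_mul]
  simp only [mul_left_comm]

theorem pair_add_left (u v : S.L2 i) {ψ : ℝ → ℝ} (hψ : Continuous ψ) :
    pair (u + v) ψ = pair u ψ + pair v ψ := by
  unfold pair
  rw [← integral_add (integrable_coe_mul u hψ) (integrable_coe_mul v hψ)]
  refine integral_congr_ae ?_
  filter_upwards [Lp.coeFn_add u v] with x hx
  rw [hx, Pi.add_apply, add_mul]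

theorem pair_smul_left (k : ℝ) (u : S.L2 i) (ψ : ℝ → ℝ) : pair (k • u) ψ = k * pair u ψ := by
  unfold pair
  rw [← integral_const_mul]
  refine integral_congr_ae ?_
  filter_upwards [Lp.coeFn_smul k u] with x hx
  rw [hx, Pi.smul_apply, smul_eq_mul, mul_assoc]

theorem intervalIntegrable_pair {u : ℝ → S.L2 i} (hu : ContinuousOn u (Ici 0)) {ψ : ℝ → ℝ → ℝ}
    (hψ : Continuous (Function.uncurry ψ)) {T : ℝ} (hT : 0 ≤ T) :
    IntervalIntegrable (fun t => pair (u t) (ψ t)) volume 0 T :=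
  intervalIntegrable_integral_mul hu hψ hT

theorem integral_pair_add (u w : S.L2 i) {ψ m χ : ℝ → ℝ} (hψ : Continuous ψ) (hm : Continuous m)
    (hχ : Continuous χ) :
    ∫ x in Icc (S.left i) (S.right i), (u x * ψ x + m x * w x * χ x) =
      pair u ψ + pair w (fun x => m x * χ x) := by
  unfold pair
  rw [← integral_add (integrable_coe_mul u hψ)
    (integrable_coe_mul w (ψ := fun x => m x * χ x) (hm.mul hχ))]
  congr 1
  funext x
  ring

/-- The weak form of a transport equation, in terms of pairings. -/
theorem IsTransportSolution.weak_form_pair {σ : ℝ} {m : ℝ → ℝ} (hm : Continuous m)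
    {u w : ℝ → S.L2 i} {ul ur : ℝ → ℝ}
    (h : S.IsTransportSolution i σ (fun t x => m x * w t x) u ul ur)
    {φ φt φx : ℝ → ℝ → ℝ} (h₁ : ∀ t x, HasDerivAt (fun s => φ s x) (φt t x) t)
    (h₂ : ∀ t x, HasDerivAt (fun y => φ t y) (φx t x) x)
    (c₁ : Continuous (Function.uncurry φt)) (c₂ : Continuous (Function.uncurry φx))
    {T : ℝ} (hT : 0 ≤ T) :
    pair (u T) (φ T) - pair (u 0) (φ 0) +
        σ * (∫ t in (0 : ℝ)..T, (ur t * φ t (S.right i) - ul t * φ t (S.left i))) =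
      ∫ t in (0 : ℝ)..T, (pair (u t) (fun x => φt t x + σ * φx t x) +
        pair (w t) (fun x => m x * φ t x)) := by
  have hφ := contDiff_one_of_partials h₁ h₂ c₁ c₂
  refine (h.weak_form φ hφ T hT).trans ?_
  congr 1
  funext t
  rw [← integral_pair_add (u t) (w t) (ψ := fun x => φt t x + σ * φx t x)
    ((c₁.uncurry_left t).add (continuous_const.mul (c₂.uncurry_left t))) hm (hφ.continuous.uncurry_left t)]
  simp only [(h₁ _ _).deriv, (h₂ _ _).deriv]

theorem isTransportSolution_of_pair {σ : ℝ} {m : ℝ → ℝ} (hm : Continuous m)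
    {u w : ℝ → S.L2 i} {ul ur : ℝ → ℝ} (hu : ContinuousOn u (Ici 0))
    (hl : ∀ T : ℝ, MemLp ul 2 (volume.restrict (Icc 0 T)))
    (hr : ∀ T : ℝ, MemLp ur 2 (volume.restrict (Icc 0 T)))
    (h : ∀ φ φt φx : ℝ → ℝ → ℝ, ContDiff ℝ 1 (Function.uncurry φ) →
      (∀ t x, HasDerivAt (fun s => φ s x) (φt t x) t) →
      (∀ t x, HasDerivAt (fun y => φ t y) (φx t x) x) →
      Continuous (Function.uncurry φt) → Continuous (Function.uncurry φx) → ∀ T, 0 ≤ T →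
      pair (u T) (φ T) - pair (u 0) (φ 0) +
        σ * (∫ t in (0 : ℝ)..T, (ur t * φ t (S.right i) - ul t * φ t (S.left i))) =
      ∫ t in (0 : ℝ)..T, (pair (u t) (fun x => φt t x + σ * φx t x) +
        pair (w t) (fun x => m x * φ t x))) :
    S.IsTransportSolution i σ (fun t x => m x * w t x) u ul ur where
  continuous_curve := hu
  left_trace := hl
  right_trace := hr
  weak_form φ hφ T hT := by
    have c₁ := continuous_deriv_fst hφ
    have c₂ := continuous_deriv_snd hφ
    refine (h φ _ _ hφ
      (fun t x => (hasDerivAt_fst_of_contDiff hφ t x).differentiableAt.hasDerivAt)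
      (fun t x => (hasDerivAt_snd_of_contDiff hφ t x).differentiableAt.hasDerivAt)
      c₁ c₂ T hT).trans ?_
    congr 1
    funext t
    exact (integral_pair_add (u t) (w t) ((c₁.uncurry_left t).add
      (continuous_const.mul (c₂.uncurry_left t))) hm (hφ.continuous.uncurry_left t)).symm

/-- The value at `x` of `e^{-αx} ∫_b^x e^{αξ} (c w + y/τ) dξ`, where `b` is the outer end of the
road. -/
noncomputable def moment (α : ℝ) (w y : S.L2 i) (x : ℝ) : ℝ :=
  Real.exp (-(α * x)) * ((∫ ξ in S.outerEnd i..x, Real.exp (α * ξ) * S.c i ξ * w ξ) +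
    ∫ ξ in S.outerEnd i..x, Real.exp (α * ξ) / S.tau i * y ξ)

section Stationary

variable {α : ℝ} {w y m : S.L2 i}

theorem continuous_exp_mul_c (S : ARZNetwork) (i : Road) (α : ℝ) :
    Continuous fun ξ => Real.exp (α * ξ) * S.c i ξ := by
  have := S.continuous_c i
  fun_prop

/-- Integration by parts against the moment. -/
theorem pair_moment (hm : (m : ℝ → ℝ) =ᵐ[volume.restrict (Icc (S.left i) (S.right i))] moment α w y)
    {X X' : ℝ → ℝ} (hX : ∀ x, HasDerivAt X (X' x) x) (hX' : Continuous X') :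
    pair w (fun x => S.c i x * (Real.exp (α * x) * X x)) +
      pair y (fun x => Real.exp (α * x) * X x) / S.tau i +
      pair m (fun x => Real.exp (α * x) * X' x) =
      moment α w y (S.right i) * (Real.exp (α * S.right i) * X (S.right i)) -
        moment α w y (S.left i) * (Real.exp (α * S.left i) * X (S.left i)) := by
  have hlr := (S.left_lt_right i).le
  have hc := S.continuous_c i
  have c₁ := continuous_exp_mul_c S i α
  have c₂ : Continuous fun ξ => Real.exp (α * ξ) / S.tau i := by fun_prop
  have hXc : Continuous X := continuous_iff_continuousAt.2 fun x => (hX x).continuousAt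
  have hb := S.outerEnd_mem i
  set f : ℝ → ℝ := fun ξ => Real.exp (α * ξ) * S.c i ξ * w ξ + Real.exp (α * ξ) / S.tau i * y ξ
    with hf
  have if₁ := intervalIntegrable_coe_mul hlr w c₁
  have if₂ := intervalIntegrable_coe_mul hlr y c₂
  have hif : IntervalIntegrable f volume (S.left i) (S.right i) := if₁.add if₂
  -- Without its exponential prefactor the moment is the primitive of an integrable density, to
  -- which integration by parts applies.
  have hN : ∀ x ∈ Icc (S.left i) (S.right i), moment α w y x * Real.exp (α * x) =
      ∫ ξ in S.outerEnd i..x, f ξ := by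
    intro x hx
    rw [hf, intervalIntegral.integral_add (intervalIntegrable_coe_mul_sub hlr w c₁ hb hx)
      (intervalIntegrable_coe_mul_sub hlr y c₂ hb hx), moment]
    have : Real.exp (-(α * x)) * Real.exp (α * x) = 1 := by
      rw [← Real.exp_add, neg_add_cancel, Real.exp_zero]
    linear_combination ((∫ ξ in S.outerEnd i..x, Real.exp (α * ξ) * S.c i ξ * w ξ) +
      ∫ ξ in S.outerEnd i..x, Real.exp (α * ξ) / S.tau i * y ξ) * this
  have key := integral_primitive_mul (b := S.outerEnd i) (by rwa [uIcc_of_le hlr]) hif hX hX'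
  rw [← mul_assoc, ← mul_assoc, hN _ (right_mem_Icc.2 hlr), hN _ (left_mem_Icc.2 hlr), ← key,
    intervalIntegral.integral_of_le hlr, ← integral_Icc_eq_integral_Ioc]
  have e : ∫ x in Icc (S.left i) (S.right i), (f x * X x + (∫ ξ in S.outerEnd i..x, f ξ) * X' x) =
      ∫ x in Icc (S.left i) (S.right i),
        (w x * (S.c i x * (Real.exp (α * x) * X x)) +
          (y x * (Real.exp (α * x) * X x)) / S.tau i +
          m x * (Real.exp (α * x) * X' x)) := by
    refine integral_congr_ae ?_
    filter_upwards [hm, ae_restrict_mem measurableSet_Icc] with x hx hx'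
    rw [← hN x hx', hx]
    simp only [hf]
    ring
  have i₁ := integrable_coe_mul w (ψ := fun x => S.c i x * (Real.exp (α * x) * X x)) (by fun_prop)
  have i₂ := integrable_coe_mul y (ψ := fun x => Real.exp (α * x) * X x) (by fun_prop)
  have i₃ := integrable_coe_mul m (ψ := fun x => Real.exp (α * x) * X' x) (by fun_prop)
  have i₁₂ : IntegrableOn (fun x => w x * (S.c i x * (Real.exp (α * x) * X x)) +
      y x * (Real.exp (α * x) * X x) / S.tau i) (Icc (S.left i) (S.right i)) :=
    i₁.add (i₂.div_const _)
  rw [e, integral_add i₁₂ i₃, integral_add i₁ (i₂.div_const _),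
    integral_div]
  rfl

/-- The test function dual to `φ`. -/
noncomputable def dualTest (α : ℝ) (φ : ℝ → ℝ) (x : ℝ) : ℝ :=
  Real.exp (α * x) * ∫ z in (0 : ℝ)..x, Real.exp (-(α * z)) * φ z

theorem moment_outer (hx : S.outerEnd i = x) : moment α w y x = 0 := by
  subst hx; simp [moment]

theorem dualTest_zero (φ : ℝ → ℝ) : dualTest α φ 0 = 0 := by simp [dualTest]

theorem exp_mul_exp_neg (x : ℝ) : Real.exp (α * x) * Real.exp (-(α * x)) = 1 := by
  rw [← Real.exp_add, add_neg_cancel, Real.exp_zero]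

/-- The pairing with the moment, by duality. -/
theorem pair_moment_eq_dual
    (hm : (m : ℝ → ℝ) =ᵐ[volume.restrict (Icc (S.left i) (S.right i))] moment α w y)
    {φ : ℝ → ℝ} (hφ : Continuous φ) :
    pair w (fun x => S.c i x * dualTest α φ x) + pair y (dualTest α φ) / S.tau i + pair m φ = 0 := by
  have hcont : Continuous fun z => Real.exp (-(α * z)) * φ z := by fun_prop
  -- This choice of `X` transposes the Volterra operator. Both boundary terms vanish: the moment is
  -- zero at the outer end, and the dual test function is zero at the junction.
  have key := pair_moment hm (X := fun x => ∫ z in (0 : ℝ)..x, Real.exp (-(α * z)) * φ z)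
    (fun x => (hcont.integral_hasStrictDerivAt 0 x).hasDerivAt) hcont
  have hb : moment α w y (S.right i) * dualTest α φ (S.right i) -
      moment α w y (S.left i) * dualTest α φ (S.left i) = 0 := by
    cases i
    · rw [moment_outer (x := S.right .one) rfl, show S.left .one = 0 from rfl, dualTest_zero]
      ring
    · rw [moment_outer (x := S.left .two) rfl, show S.right .two = 0 from rfl, dualTest_zero]
      ring
  refine Eq.trans ?_ (key.trans hb)
  congr 2
  funext x
  rw [← mul_assoc, exp_mul_exp_neg, one_mul]

/-- The pairing with the derivative, by integration by parts. -/
theorem pair_moment_deriv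
    (hm : (m : ℝ → ℝ) =ᵐ[volume.restrict (Icc (S.left i) (S.right i))] moment α w y)
    {φ φ' : ℝ → ℝ} (hφ : ∀ x, HasDerivAt φ (φ' x) x) (hφ' : Continuous φ') :
    pair w (fun x => S.c i x * φ x) + pair y φ / S.tau i + (pair m φ' - α * pair m φ) =
      moment α w y (S.right i) * φ (S.right i) - moment α w y (S.left i) * φ (S.left i) := by
  have hφc : Continuous φ := continuous_iff_continuousAt.2 fun x => (hφ x).continuousAt
  have hX : ∀ x, HasDerivAt (fun x => Real.exp (-(α * x)) * φ x)
      (Real.exp (-(α * x)) * (φ' x + -α * φ x)) x := by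
    intro x
    have h1 : HasDerivAt (fun x => Real.exp (-(α * x))) (Real.exp (-(α * x)) * -(α * 1)) x :=
      ((hasDerivAt_id x).const_mul α).neg.exp
    refine (h1.mul (hφ x)).congr_deriv ?_
    ring
  have key := pair_moment hm hX (by fun_prop)
  simp only [← mul_assoc, exp_mul_exp_neg, one_mul] at key
  rw [pair_add m hφ' (by fun_prop), pair_const_mul m (-α) φ] at key
  linear_combination key

end Stationary

end ARZNetwork

/-- The value of a primitive at a fixed point is a bounded functional on `L²`. Hence the boundary
values of the moment are continuous in time and serve as traces. -/
theorem exists_primitive_eq_inner {l r b x : ℝ} (hb : b ∈ Icc l r) (hx : x ∈ Icc l r) {m : ℝ → ℝ}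
    (hm : Continuous m) : ∃ g : Lp ℝ 2 (volume.restrict (Icc l r)),
      ∀ u : Lp ℝ 2 (volume.restrict (Icc l r)), ∫ y in b..x, m y * u y = inner ℝ g u := by
  obtain ⟨C, hC0, hC⟩ := exists_bound_Icc hm l r
  have hsub : uIoc b x ⊆ Icc l r := uIoc_subset_uIcc.trans (uIcc_subset_Icc hb hx)
  have hmem : MemLp ((uIoc b x).indicator m) 2 (volume.restrict (Icc l r)) := by
    refine memLp_two_of_bound (hm.aestronglyMeasurable.indicator measurableSet_uIoc)
      (C := C) fun y hy => ?_
    by_cases h : y ∈ uIoc b x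
    · rw [indicator_of_mem h]; exact hC y hy
    · rw [indicator_of_notMem h, abs_zero]; exact hC0
  refine ⟨(if b ≤ x then 1 else -1 : ℝ) • hmem.toLp _, fun u => ?_⟩
  rw [real_inner_smul_left, ← integral_mul_eq_inner,
    intervalIntegral.intervalIntegral_eq_integral_uIoc, smul_eq_mul]
  congr 1
  have : (fun y => u y * (uIoc b x).indicator m y) = (uIoc b x).indicator fun y => m y * u y := by
    funext y
    by_cases h : y ∈ uIoc b x
    · rw [indicator_of_mem h, indicator_of_mem h, mul_comm]
    · rw [indicator_of_notMem h, indicator_of_notMem h, mul_zero]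
  rw [this, setIntegral_indicator measurableSet_uIoc, inter_eq_self_of_subset_right hsub]

theorem memLp_two_of_continuousOn {f : ℝ → ℝ} (hf : ContinuousOn f (Ici 0)) (T : ℝ) :
    MemLp f 2 (volume.restrict (Icc 0 T)) := by
  have hf' : ContinuousOn f (Icc 0 T) := hf.mono Icc_subset_Ici_self
  obtain ⟨C, hC⟩ := isCompact_Icc.exists_bound_of_continuousOn hf'
  exact memLp_two_of_bound (hf'.aestronglyMeasurable measurableSet_Icc) hC

namespace ARZNetwork

variable {S : ARZNetwork} {i : Road}

theorem continuousOn_moment {α : ℝ} {w y : ℝ → S.L2 i} (hw : ContinuousOn w (Ici 0))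
    (hy : ContinuousOn y (Ici 0)) {x : ℝ} (hx : x ∈ Icc (S.left i) (S.right i)) :
    ContinuousOn (fun t => moment α (w t) (y t) x) (Ici 0) := by
  obtain ⟨g₁, h₁⟩ := exists_primitive_eq_inner (S.outerEnd_mem i) hx (continuous_exp_mul_c S i α)
  obtain ⟨g₂, h₂⟩ := exists_primitive_eq_inner (S.outerEnd_mem i) hx
    (m := fun ξ => Real.exp (α * ξ) / S.tau i) (by fun_prop)
  simp only [moment, h₁, h₂]
  exact continuousOn_const.mul ((continuousOn_const.inner hw).add (continuousOn_const.inner hy))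

section DualTest

variable {α : ℝ} {φ φt : ℝ → ℝ → ℝ}

theorem hasDerivAt_dualTest_fst (hφ : ContDiff ℝ 1 (Function.uncurry φ))
    (h₁ : ∀ t x, HasDerivAt (fun s => φ s x) (φt t x) t) (t x : ℝ) :
    HasDerivAt (fun s => dualTest α (φ s) x) (dualTest α (φt t) x) t := by
  have hE : ContDiff ℝ 1 (Function.uncurry fun t z : ℝ => Real.exp (-(α * z)) * φ t z) :=
    (Real.contDiff_exp.comp (contDiff_const.mul contDiff_snd).neg).mul hφ
  refine ((hasDerivAt_primitive_fst hE t x).const_mul (Real.exp (α * x))).congr_deriv ?_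
  rw [dualTest]
  congr 2
  funext z
  exact ((h₁ t z).const_mul _).deriv

theorem hasDerivAt_dualTest {φ : ℝ → ℝ} (hφ : Continuous φ) (x : ℝ) :
    HasDerivAt (dualTest α φ) (α * dualTest α φ x + φ x) x := by
  have hcont : Continuous fun z => Real.exp (-(α * z)) * φ z := by fun_prop
  have h1 : HasDerivAt (fun x => Real.exp (α * x)) (Real.exp (α * x) * (α * 1)) x :=
    ((hasDerivAt_id x).const_mul α).exp
  refine (h1.mul (hcont.integral_hasStrictDerivAt 0 x).hasDerivAt).congr_deriv ?_
  rw [dualTest]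
  linear_combination φ x * exp_mul_exp_neg (α := α) x

theorem continuous_dualTest (hφ : Continuous (Function.uncurry φ)) :
    Continuous (Function.uncurry fun t => dualTest α (φ t)) := by
  have h : Continuous (Function.uncurry fun t z : ℝ => Real.exp (-(α * z)) * φ t z) :=
    (Real.continuous_exp.comp (continuous_const.mul continuous_snd).neg).mul hφ
  exact (Real.continuous_exp.comp (continuous_const.mul continuous_snd)).mul
    (intervalIntegral.continuous_parametric_primitive_of_continuous h)

end DualTest

/-- The moment of a solution solves a transport equation with a local source term. -/
theorem isTransportSolution_moment {k α : ℝ} (hα : S.tau i * S.kap i * α = 1 - k)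
    {w y m : ℝ → S.L2 i} {wl wr yl yr : ℝ → ℝ}
    (hw : S.IsTransportSolution i (S.vStar i) (fun _ _ => 0) w wl wr)
    (hy : S.IsTransportSolution i (-S.lam i) (fun t x => k * S.c i x * w t x) y yl yr)
    (hbl : ∀ᵐ t ∂(volume.restrict (Ici (0 : ℝ))), S.left i ≠ 0 →
      S.tau i * S.vStar i * S.c i (S.left i) * wl t = S.lam i * yl t)
    (hbr : ∀ᵐ t ∂(volume.restrict (Ici (0 : ℝ))), S.right i ≠ 0 →
      S.tau i * S.vStar i * S.c i (S.right i) * wr t = S.lam i * yr t)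
    (hmc : ContinuousOn m (Ici 0))
    (hm : ∀ t, (m t : ℝ → ℝ) =ᵐ[volume.restrict (Icc (S.left i) (S.right i))]
      moment α (w t) (y t)) :
    S.IsTransportSolution i (-S.lam i) (fun t x => -S.kap i * S.c i x * w t x) m
      (fun t => moment α (w t) (y t) (S.left i)) (fun t => moment α (w t) (y t) (S.right i)) := by
  have hlr := (S.left_lt_right i).le
  have hc := S.continuous_c i
  have hwc := hw.continuous_curve
  have hyc := hy.continuous_curve
  have ha := (S.vStar_pos i).ne'
  have ht := (S.tau_pos i).ne'
  have hκ := S.kap_eq i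
  refine isTransportSolution_of_pair (m := fun x => -S.kap i * S.c i x) (by fun_prop) hmc
    (memLp_two_of_continuousOn (continuousOn_moment hwc hyc (left_mem_Icc.2 hlr)))
    (memLp_two_of_continuousOn (continuousOn_moment hwc hyc (right_mem_Icc.2 hlr))) ?_
  intro φ φt φx hφ h₁ h₂ c₁ c₂ T hT
  have c₀ := hφ.continuous
  -- `Ψ` solves `∂_x Ψ = α Ψ + φ` with `Ψ = 0` at the junction. By duality, testing `m` with `φ`
  -- amounts to testing `w` with `-c Ψ` and `y` with `-Ψ / τ`, which are admissible in the weak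
  -- forms of `w` and `y`.
  set Ψ : ℝ → ℝ → ℝ := fun t => dualTest α (φ t) with hΨ
  set Ψt : ℝ → ℝ → ℝ := fun t => dualTest α (φt t) with hΨt
  have cΨ : Continuous (Function.uncurry Ψ) := continuous_dualTest c₀
  have cΨt : Continuous (Function.uncurry Ψt) := continuous_dualTest c₁
  have dΨt : ∀ t x, HasDerivAt (fun s => Ψ s x) (Ψt t x) t := hasDerivAt_dualTest_fst hφ h₁
  have dΨx : ∀ t x, HasDerivAt (Ψ t) (α * Ψ t x + φ t x) x := fun t x =>
    hasDerivAt_dualTest (c₀.uncurry_left t) x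
  have cΨx : Continuous (Function.uncurry fun t x => α * Ψ t x + φ t x) :=
    (continuous_const.mul cΨ).add c₀
  have cc : Continuous fun z : ℝ × ℝ => S.c i z.2 := hc.comp continuous_snd
  have hw' : S.IsTransportSolution i (S.vStar i) (fun t x => (fun _ => 0) x * w t x) w wl wr := by
    simpa only [zero_mul] using hw
  have eW := hw'.weak_form_pair continuous_const
    (φ := fun t x => S.c i x * Ψ t x) (φt := fun t x => S.c i x * Ψt t x)
    (φx := fun t x => -(S.c i x / (S.tau i * S.vStar i)) * Ψ t x +
      S.c i x * (α * Ψ t x + φ t x))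
    (fun t x => (dΨt t x).const_mul _) (fun t x => (S.hasDerivAt_c i x).mul (dΨx t x))
    (cc.mul cΨt) (((cc.div_const _).neg.mul cΨ).add (cc.mul cΨx)) hT
  have eY := hy.weak_form_pair (m := fun x => k * S.c i x) (by fun_prop) (φ := Ψ) (φt := Ψt)
    (φx := fun t x => α * Ψ t x + φ t x) dΨt dΨx cΨt cΨx hT
  have dT : pair (w T) (fun x => S.c i x * Ψ T x) + pair (y T) (Ψ T) / S.tau i +
      pair (m T) (φ T) = 0 := pair_moment_eq_dual (hm T) (c₀.uncurry_left T)
  have d0 : pair (w 0) (fun x => S.c i x * Ψ 0 x) + pair (y 0) (Ψ 0) / S.tau i +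
      pair (m 0) (φ 0) = 0 := pair_moment_eq_dual (hm 0) (c₀.uncurry_left 0)
  -- The boundary terms from `w` and `y` cancel: at the junction because `Ψ` vanishes, and at the
  -- outer end because of the reflection condition there.
  have hbdry : S.vStar i * (∫ t in (0 : ℝ)..T, (wr t * (S.c i (S.right i) * Ψ t (S.right i)) -
      wl t * (S.c i (S.left i) * Ψ t (S.left i)))) = S.lam i / S.tau i *
      ∫ t in (0 : ℝ)..T, (yr t * Ψ t (S.right i) - yl t * Ψ t (S.left i)) := by
    rw [← intervalIntegral.integral_const_mul, ← intervalIntegral.integral_const_mul]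
    refine intervalIntegral.integral_congr_ae ?_
    filter_upwards [(ae_restrict_iff' measurableSet_Ici).1 hbl,
      (ae_restrict_iff' measurableSet_Ici).1 hbr] with t h3 h4 ht'
    rw [uIoc_of_le hT] at ht'
    replace h3 := h3 ht'.1.le
    replace h4 := h4 ht'.1.le
    have e3 : S.tau i * S.vStar i * S.c i (S.left i) * wl t * Ψ t (S.left i) =
        S.lam i * yl t * Ψ t (S.left i) := by
      by_cases h : S.left i = 0
      · simp only [hΨ, h, dualTest_zero, mul_zero]
      · rw [h3 h]
    have e4 : S.tau i * S.vStar i * S.c i (S.right i) * wr t * Ψ t (S.right i) =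
        S.lam i * yr t * Ψ t (S.right i) := by
      by_cases h : S.right i = 0
      · simp only [hΨ, h, dualTest_zero, mul_zero]
      · rw [h4 h]
    field_simp
    linear_combination e4 - e3
  have iW : IntervalIntegrable (fun t => pair (w t) (fun x => S.c i x * Ψt t x + S.vStar i *
      (-(S.c i x / (S.tau i * S.vStar i)) * Ψ t x + S.c i x * (α * Ψ t x + φ t x))) +
      pair (w t) (fun x => (fun _ => (0 : ℝ)) x * (S.c i x * Ψ t x))) volume 0 T :=
    (intervalIntegrable_pair hwc (ψ := fun t x => S.c i x * Ψt t x + S.vStar i *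
      (-(S.c i x / (S.tau i * S.vStar i)) * Ψ t x + S.c i x * (α * Ψ t x + φ t x)))
      ((cc.mul cΨt).add (continuous_const.mul
      (((cc.div_const _).neg.mul cΨ).add (cc.mul cΨx)))) hT).add
      (intervalIntegrable_pair hwc (ψ := fun t x => (fun _ => (0 : ℝ)) x * (S.c i x * Ψ t x))
        (continuous_const.mul (cc.mul cΨ)) hT)
  have iY : IntervalIntegrable (fun t => pair (y t) (fun x => Ψt t x + -S.lam i *
      (α * Ψ t x + φ t x)) + pair (w t) (fun x => k * S.c i x * Ψ t x)) volume 0 T :=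
    (intervalIntegrable_pair hyc (ψ := fun t x => Ψt t x + -S.lam i * (α * Ψ t x + φ t x))
      (cΨt.add (continuous_const.mul cΨx)) hT).add
      (intervalIntegrable_pair hwc (ψ := fun t x => k * S.c i x * Ψ t x)
        ((continuous_const.mul cc).mul cΨ) hT)
  have iM : IntervalIntegrable (fun t => pair (m t) (fun x => φt t x + -S.lam i * φx t x) +
      pair (w t) (fun x => -S.kap i * S.c i x * φ t x)) volume 0 T :=
    (intervalIntegrable_pair hmc (ψ := fun t x => φt t x + -S.lam i * φx t x) (c₁.add (continuous_const.mul c₂)) hT).add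
      (intervalIntegrable_pair hwc (ψ := fun t x => -S.kap i * S.c i x * φ t x)
        ((continuous_const.mul cc).mul c₀) hT)
  -- The identity behind the weak form, at a fixed time. Duality is applied to `φ` (`E1`) and `∂_t
  -- φ` (`E2`), while `∂_x φ` is integrated by parts (`E3`), which creates the traces of the moment.
  have point : ∀ t, -S.lam i * (moment α (w t) (y t) (S.right i) * φ t (S.right i) -
      moment α (w t) (y t) (S.left i) * φ t (S.left i)) =
      (pair (m t) (fun x => φt t x + -S.lam i * φx t x) +
      pair (w t) (fun x => -S.kap i * S.c i x * φ t x)) +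
      ((pair (w t) (fun x => S.c i x * Ψt t x + S.vStar i *
      (-(S.c i x / (S.tau i * S.vStar i)) * Ψ t x + S.c i x * (α * Ψ t x + φ t x))) +
      pair (w t) (fun x => (fun _ => (0 : ℝ)) x * (S.c i x * Ψ t x))) +
      1 / S.tau i * (pair (y t) (fun x => Ψt t x + -S.lam i *
      (α * Ψ t x + φ t x)) + pair (w t) (fun x => k * S.c i x * Ψ t x))) := by
    intro t
    have q₀ := c₀.uncurry_left t
    have q₁ := c₁.uncurry_left t
    have q₂ := c₂.uncurry_left t
    have q₃ := cΨ.uncurry_left t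
    have q₄ := cΨt.uncurry_left t
    have E1 := pair_moment_eq_dual (hm t) q₀
    have E2 := pair_moment_eq_dual (hm t) q₁
    have E3 := pair_moment_deriv (hm t) (h₂ t) q₂
    have f₁ : pair (m t) (fun x => φt t x + -S.lam i * φx t x) =
        pair (m t) (φt t) + -S.lam i * pair (m t) (φx t) := by
      rw [pair_add _ q₁ (by fun_prop), pair_const_mul]
    have f₂ : pair (w t) (fun x => -S.kap i * S.c i x * φ t x) =
        -S.kap i * pair (w t) (fun x => S.c i x * φ t x) := by
      rw [← pair_const_mul]; simp only [mul_assoc]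
    have f₃ : pair (w t) (fun x => S.c i x * Ψt t x + S.vStar i *
        (-(S.c i x / (S.tau i * S.vStar i)) * Ψ t x + S.c i x * (α * Ψ t x + φ t x))) =
        pair (w t) (fun x => S.c i x * Ψt t x) +
        ((S.vStar i * α - 1 / S.tau i) * pair (w t) (fun x => S.c i x * Ψ t x) +
          S.vStar i * pair (w t) (fun x => S.c i x * φ t x)) := by
      rw [← pair_const_mul, ← pair_const_mul, ← pair_add _ (by fun_prop) (by fun_prop),
        ← pair_add _ (by fun_prop) (by fun_prop)]
      congr 1
      funext x
      field_simp
      ring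
    have f₄ : pair (w t) (fun x => (fun _ => (0 : ℝ)) x * (S.c i x * Ψ t x)) = 0 := by
      rw [show (fun x => (fun _ : ℝ => (0 : ℝ)) x * (S.c i x * Ψ t x)) =
        fun x => 0 * (S.c i x * Ψ t x) from rfl, pair_const_mul, zero_mul]
    have f₅ : pair (y t) (fun x => Ψt t x + -S.lam i * (α * Ψ t x + φ t x)) =
        pair (y t) (Ψt t) + (-S.lam i * (α * pair (y t) (Ψ t)) +
          -S.lam i * pair (y t) (φ t)) := by
      rw [pair_add _ q₄ (by fun_prop), pair_const_mul, pair_add _ (by fun_prop) q₀, pair_const_mul]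
      ring
    have f₆ : pair (w t) (fun x => k * S.c i x * Ψ t x) =
        k * pair (w t) (fun x => S.c i x * Ψ t x) := by
      rw [← pair_const_mul]; simp only [mul_assoc]
    rw [f₁, f₂, f₃, f₄, f₅, f₆]
    -- This is where `τ κ α = 1 - k` enters: it makes the nonlocal terms in `w` and in `y` combine
    -- into one multiple of the moment, which cancels, so that the remaining source is local.
    have hk : S.vStar i * α - 1 / S.tau i + k / S.tau i = -(S.lam i * α) := by
      field_simp
      linear_combination -S.tau i * α * hκ + hα
    simp only [hΨ, hΨt] at *
    linear_combination S.lam i * E3 - E2 + S.lam i * α * E1 -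
      pair (w t) (fun x => S.c i x * dualTest α (φ t) x) * hk +
      pair (w t) (fun x => S.c i x * φ t x) * hκ
  have hsum : ∫ t in (0 : ℝ)..T, -S.lam i *
      (moment α (w t) (y t) (S.right i) * φ t (S.right i) -
        moment α (w t) (y t) (S.left i) * φ t (S.left i)) = _ :=
    (intervalIntegral.integral_congr fun t _ => point t).trans
      ((intervalIntegral.integral_add iM (iW.add (iY.const_mul _))).trans
        (congrArg _ ((intervalIntegral.integral_add iW (iY.const_mul _)).trans
          (congrArg _ (intervalIntegral.integral_const_mul _ _)))))
  rw [intervalIntegral.integral_const_mul] at hsum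
  rw [hsum, ← eW, ← eY]
  linear_combination dT - d0 + hbdry

end ARZNetwork

/-! ### The backstepping transformation and its inverse. -/

namespace ARZNetwork

variable {S : ARZNetwork} {i : Road}

theorem IsTransportSolution.add_const_mul {σ k : ℝ} {m₁ m₂ : ℝ → ℝ} (hm₁ : Continuous m₁)
    (hm₂ : Continuous m₂) {u u' w : ℝ → S.L2 i} {ul ur ul' ur' : ℝ → ℝ}
    (hw : ContinuousOn w (Ici 0))
    (h : S.IsTransportSolution i σ (fun t x => m₁ x * w t x) u ul ur)
    (h' : S.IsTransportSolution i σ (fun t x => m₂ x * w t x) u' ul' ur') :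
    S.IsTransportSolution i σ (fun t x => (m₁ x + k * m₂ x) * w t x) (fun t => u t + k • u' t)
      (fun t => ul t + k * ul' t) (fun t => ur t + k * ur' t) := by
  refine isTransportSolution_of_pair (m := fun x => m₁ x + k * m₂ x) (by fun_prop)
    (h.continuous_curve.add (h'.continuous_curve.const_smul k))
    (fun T => (h.left_trace T).add ((h'.left_trace T).const_mul k))
    (fun T => (h.right_trace T).add ((h'.right_trace T).const_mul k)) ?_
  intro φ φt φx hφ h₁ h₂ c₁ c₂ T hT
  have e := h.weak_form_pair hm₁ h₁ h₂ c₁ c₂ hT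
  have e' := h'.weak_form_pair hm₂ h₁ h₂ c₁ c₂ hT
  have c₀ := hφ.continuous
  have cm₁ : Continuous fun z : ℝ × ℝ => m₁ z.2 := hm₁.comp continuous_snd
  have cm₂ : Continuous fun z : ℝ × ℝ => m₂ z.2 := hm₂.comp continuous_snd
  have int : ∀ {m : ℝ → ℝ} {u : ℝ → S.L2 i}, Continuous m → ContinuousOn u (Ici 0) →
      IntervalIntegrable (fun t => pair (u t) (fun x => φt t x + σ * φx t x) +
        pair (w t) (fun x => m x * φ t x)) volume 0 T := fun {m u} hm hu =>
    (intervalIntegrable_pair hu (ψ := fun t x => φt t x + σ * φx t x)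
      (c₁.add (continuous_const.mul c₂)) hT).add
    (intervalIntegrable_pair hw (ψ := fun t x => m x * φ t x)
      ((hm.comp continuous_snd).mul c₀) hT)
  have rhs : ∫ t in (0 : ℝ)..T, (pair (u t + k • u' t) (fun x => φt t x + σ * φx t x) +
      pair (w t) (fun x => (m₁ x + k * m₂ x) * φ t x)) =
      (∫ t in (0 : ℝ)..T, (pair (u t) (fun x => φt t x + σ * φx t x) +
        pair (w t) (fun x => m₁ x * φ t x))) + k *
      ∫ t in (0 : ℝ)..T, (pair (u' t) (fun x => φt t x + σ * φx t x) +
        pair (w t) (fun x => m₂ x * φ t x)) := by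
    rw [← intervalIntegral.integral_const_mul, ← intervalIntegral.integral_add
      (int hm₁ h.continuous_curve) ((int hm₂ h'.continuous_curve).const_mul k)]
    congr 1
    funext t
    have q₀ := c₀.uncurry_left t
    have q₁ := c₁.uncurry_left t
    have q₂ := c₂.uncurry_left t
    rw [pair_add_left _ _ (by fun_prop), pair_smul_left]
    have : pair (w t) (fun x => (m₁ x + k * m₂ x) * φ t x) =
        pair (w t) (fun x => m₁ x * φ t x) + k * pair (w t) (fun x => m₂ x * φ t x) := by
      rw [← pair_const_mul, ← pair_add _ (by fun_prop) (by fun_prop)]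
      congr 1
      funext x
      ring
    rw [this]
    ring
  have bint : ∀ {f : ℝ → ℝ} (x : ℝ), MemLp f 2 (volume.restrict (Icc 0 T)) →
      IntervalIntegrable (fun t => f t * φ t x) volume 0 T := by
    intro f x hf
    rw [intervalIntegrable_iff_integrableOn_Icc_of_le hT]
    exact IntegrableOn.mul_continuousOn (hf.integrable one_le_two)
      (g' := fun t => φ t x) (c₀.uncurry_right x).continuousOn isCompact_Icc
  have lhs : ∫ t in (0 : ℝ)..T, ((ur t + k * ur' t) * φ t (S.right i) -
      (ul t + k * ul' t) * φ t (S.left i)) =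
      (∫ t in (0 : ℝ)..T, (ur t * φ t (S.right i) - ul t * φ t (S.left i))) + k *
      ∫ t in (0 : ℝ)..T, (ur' t * φ t (S.right i) - ul' t * φ t (S.left i)) := by
    rw [← intervalIntegral.integral_const_mul, ← intervalIntegral.integral_add
      ((bint _ (h.right_trace T)).sub (bint _ (h.left_trace T)))
      (((bint _ (h'.right_trace T)).sub (bint _ (h'.left_trace T))).const_mul k)]
    congr 1
    funext t
    ring
  rw [rhs, lhs, ← e, ← e', pair_add_left _ _ (c₀.uncurry_left T),
    pair_add_left _ _ (c₀.uncurry_left 0), pair_smul_left, pair_smul_left]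
  ring

/-- The exponent of the kernels of the inverse transformation. -/
noncomputable def expo (S : ARZNetwork) (i : Road) : ℝ := 1 / (S.tau i * S.kap i)

theorem moment_eq {α : ℝ} {w y : S.L2 i} {x : ℝ} (hx : x ∈ Icc (S.left i) (S.right i)) :
    moment α w y x = Real.exp (-(α * x)) *
      ∫ ξ in S.outerEnd i..x, Real.exp (α * ξ) * (S.c i ξ * w ξ + y ξ / S.tau i) := by
  have hlr := (S.left_lt_right i).le
  rw [moment, ← intervalIntegral.integral_add
    (intervalIntegrable_coe_mul_sub hlr w (continuous_exp_mul_c S i α) (S.outerEnd_mem i) hx)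
    (intervalIntegrable_coe_mul_sub hlr y (m := fun ξ => Real.exp (α * ξ) / S.tau i)
      (by fun_prop) (S.outerEnd_mem i) hx)]
  congr 2
  funext ξ
  ring

theorem moment_zero_eq {w y : S.L2 i} {x : ℝ} (hx : x ∈ Icc (S.left i) (S.right i)) :
    moment 0 w y x = ∫ ξ in S.outerEnd i..x, (S.c i ξ * w ξ + y ξ / S.tau i) := by
  simp [moment_eq hx]

theorem intervalIntegrable_momentDensity (α : ℝ) (w y : S.L2 i) {x : ℝ}
    (hx : x ∈ Icc (S.left i) (S.right i)) :
    IntervalIntegrable (fun ξ => Real.exp (α * ξ) * (S.c i ξ * w ξ + y ξ / S.tau i)) volume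
      (S.outerEnd i) x := by
  have hlr := (S.left_lt_right i).le
  have h := (intervalIntegrable_coe_mul_sub hlr w (continuous_exp_mul_c S i α)
    (S.outerEnd_mem i) hx).add
    (intervalIntegrable_coe_mul_sub hlr y (m := fun ξ => Real.exp (α * ξ) / S.tau i)
      (by fun_prop) (S.outerEnd_mem i) hx)
  convert h using 1
  funext ξ
  ring

theorem hasDerivAt_exp_mul (α x : ℝ) :
    HasDerivAt (fun x => Real.exp (α * x)) (α * Real.exp (α * x)) x := by
  refine ((hasDerivAt_id x).const_mul α).exp.congr_deriv ?_
  simp [mul_comm]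

/-- Since `β / τ = v / τ + α m` with `α = 1 / (τ κ)` and `m` the unweighted moment, the density
`e^{αξ} (c w + β / τ)` is the derivative of `e^{αξ} m`. The two moments coincide, so subtracting
what was added recovers `v`. -/
theorem moment_forward {w v β : S.L2 i}
    (h : (β : ℝ → ℝ) =ᵐ[volume.restrict (Icc (S.left i) (S.right i))]
      fun x => v x + (S.kap i)⁻¹ * moment 0 w v x) {x : ℝ}
    (hx : x ∈ Icc (S.left i) (S.right i)) :
    moment (S.expo i) w β x = moment 0 w v x := by
  have hb := S.outerEnd_mem i
  have ht := (S.tau_pos i).ne'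
  have hk := (S.kap_pos i).ne'
  have hi := intervalIntegrable_momentDensity 0 w v hx
  simp only [zero_mul, Real.exp_zero, one_mul] at hi
  have key := integral_primitive_mul (b := S.outerEnd i) left_mem_uIcc hi
    (hasDerivAt_exp_mul (S.expo i)) (by fun_prop)
  rw [intervalIntegral.integral_same, zero_mul, sub_zero, ← moment_zero_eq hx] at key
  rw [moment_eq hx]
  have e : ∫ ξ in S.outerEnd i..x,
      Real.exp (S.expo i * ξ) * (S.c i ξ * w ξ + β ξ / S.tau i) =
      moment 0 w v x * Real.exp (S.expo i * x) := by
    rw [← key]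
    refine intervalIntegral.integral_congr_ae ?_
    filter_upwards [(ae_restrict_iff' measurableSet_Icc).1 h] with ξ hξ hξ'
    have hm : ξ ∈ Icc (S.left i) (S.right i) := uIcc_subset_Icc hb hx (uIoc_subset_uIcc hξ')
    rw [hξ hm, ← moment_zero_eq hm, expo]
    field_simp
    ring
  rw [e, mul_left_comm, ← Real.exp_add, neg_add_cancel, Real.exp_zero, mul_one]

/-- The same product rule in the opposite direction, with the factor `e^{-αξ}` applied to the
weighted primitive. -/
theorem moment_backward {w v β : S.L2 i}
    (h : (v : ℝ → ℝ) =ᵐ[volume.restrict (Icc (S.left i) (S.right i))]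
      fun x => β x - (S.kap i)⁻¹ * moment (S.expo i) w β x) {x : ℝ}
    (hx : x ∈ Icc (S.left i) (S.right i)) :
    moment (S.expo i) w β x = moment 0 w v x := by
  have hb := S.outerEnd_mem i
  have ht := (S.tau_pos i).ne'
  have hk := (S.kap_pos i).ne'
  have hi := intervalIntegrable_momentDensity (S.expo i) w β hx
  have key := integral_primitive_mul (b := S.outerEnd i) left_mem_uIcc hi
    (hasDerivAt_exp_mul (-S.expo i)) (by fun_prop)
  rw [intervalIntegral.integral_same, zero_mul, sub_zero] at key
  rw [moment_zero_eq hx, moment_eq hx, mul_comm, ← neg_mul, ← key]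
  refine (intervalIntegral.integral_congr_ae ?_).symm
  filter_upwards [(ae_restrict_iff' measurableSet_Icc).1 h] with ξ hξ hξ'
  have hm : ξ ∈ Icc (S.left i) (S.right i) := uIcc_subset_Icc hb hx (uIoc_subset_uIcc hξ')
  rw [hξ hm, moment_eq hm]
  have e1 : Real.exp (S.expo i * ξ) * Real.exp (-S.expo i * ξ) = 1 := by
    rw [neg_mul]; exact exp_mul_exp_neg ξ
  have e2 : (S.kap i)⁻¹ / S.tau i = S.expo i := by rw [expo]; field_simp
  rw [← neg_mul]
  generalize (∫ ζ in S.outerEnd i..ξ, Real.exp (S.expo i * ζ) *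
    (S.c i ζ * w ζ + β ζ / S.tau i)) = N
  linear_combination -(S.c i ξ * w ξ + β ξ / S.tau i) * e1 - Real.exp (-S.expo i * ξ) * N * e2

theorem exists_momentOp (S : ARZNetwork) (i : Road) (α : ℝ) :
    ∃ P : (S.L2 i × S.L2 i) →L[ℝ] S.L2 i, ∀ w y,
      (P (w, y) : ℝ → ℝ) =ᵐ[volume.restrict (Icc (S.left i) (S.right i))] moment α w y := by
  have hlr := (S.left_lt_right i).le
  obtain ⟨A, hA⟩ := exists_volterra hlr (S.outerEnd_mem i)
    (m₁ := fun x => Real.exp (-(α * x))) (by fun_prop) (continuous_exp_mul_c S i α)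
  obtain ⟨B, hB⟩ := exists_volterra hlr (S.outerEnd_mem i)
    (m₁ := fun x => Real.exp (-(α * x))) (by fun_prop)
    (m₂ := fun ξ => Real.exp (α * ξ) / S.tau i) (by fun_prop)
  refine ⟨A.coprod B, fun w y => ?_⟩
  filter_upwards [hA w, hB y, Lp.coeFn_add (A w) (B y)] with x h1 h2 h3
  rw [ContinuousLinearMap.coprod_apply, h3, Pi.add_apply, h1, h2, moment, mul_add]

/-- The operator `(w, y) ↦ moment α w y` on `L²`. -/
noncomputable def momentOp (S : ARZNetwork) (i : Road) (α : ℝ) : (S.L2 i × S.L2 i) →L[ℝ] S.L2 i :=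
  (S.exists_momentOp i α).choose

theorem momentOp_ae (α : ℝ) (w y : S.L2 i) :
    (S.momentOp i α (w, y) : ℝ → ℝ) =ᵐ[volume.restrict (Icc (S.left i) (S.right i))]
      moment α w y := (S.exists_momentOp i α).choose_spec w y

/-- The backstepping transformation `(w, v) ↦ β`. -/
noncomputable def toTarget (S : ARZNetwork) (i : Road) : (S.L2 i × S.L2 i) →L[ℝ] S.L2 i :=
  ContinuousLinearMap.snd ℝ _ _ + (S.kap i)⁻¹ • S.momentOp i 0

/-- The inverse backstepping transformation `(w, β) ↦ v`. -/
noncomputable def ofTarget (S : ARZNetwork) (i : Road) : (S.L2 i × S.L2 i) →L[ℝ] S.L2 i :=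
  ContinuousLinearMap.snd ℝ _ _ + (-(S.kap i)⁻¹) • S.momentOp i (S.expo i)

theorem toTarget_apply (w v : S.L2 i) :
    S.toTarget i (w, v) = v + (S.kap i)⁻¹ • S.momentOp i 0 (w, v) := rfl

theorem ofTarget_apply (w β : S.L2 i) :
    S.ofTarget i (w, β) = β + (-(S.kap i)⁻¹) • S.momentOp i (S.expo i) (w, β) := rfl

theorem moment_toTarget (w v : S.L2 i) {x : ℝ} (hx : x ∈ Icc (S.left i) (S.right i)) :
    moment (S.expo i) w (S.toTarget i (w, v)) x = moment 0 w v x := by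
  refine moment_forward ?_ hx
  rw [toTarget_apply]
  filter_upwards [momentOp_ae 0 w v, Lp.coeFn_add v ((S.kap i)⁻¹ • S.momentOp i 0 (w, v)),
    Lp.coeFn_smul (S.kap i)⁻¹ (S.momentOp i 0 (w, v))] with x h1 h2 h3
  rw [h2, Pi.add_apply, h3, Pi.smul_apply, h1, smul_eq_mul]

theorem moment_ofTarget (w β : S.L2 i) {x : ℝ} (hx : x ∈ Icc (S.left i) (S.right i)) :
    moment (S.expo i) w β x = moment 0 w (S.ofTarget i (w, β)) x := by
  refine moment_backward ?_ hx
  rw [ofTarget_apply]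
  filter_upwards [momentOp_ae (S.expo i) w β,
    Lp.coeFn_add β ((-(S.kap i)⁻¹) • S.momentOp i (S.expo i) (w, β)),
    Lp.coeFn_smul (-(S.kap i)⁻¹) (S.momentOp i (S.expo i) (w, β))] with x h1 h2 h3
  rw [h2, Pi.add_apply, h3, Pi.smul_apply, h1, smul_eq_mul]
  ring

/-- This one-sided inverse is enough: it returns decay estimates to `v` and shows that solutions
built in target coordinates have the right initial value. -/
theorem ofTarget_toTarget (w v : S.L2 i) : S.ofTarget i (w, S.toTarget i (w, v)) = v := by
  have : S.momentOp i (S.expo i) (w, S.toTarget i (w, v)) = S.momentOp i 0 (w, v) := by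
    refine Lp.ext ?_
    filter_upwards [momentOp_ae (S.expo i) w (S.toTarget i (w, v)), momentOp_ae 0 w v,
      ae_restrict_mem measurableSet_Icc] with x h1 h2 hx
    rw [h1, h2, moment_toTarget w v hx]
  rw [ofTarget_apply, this, toTarget_apply, neg_smul, add_neg_cancel_right]

section Transform

variable {w v β : ℝ → S.L2 i} {wl wr vl vr βl βr : ℝ → ℝ}

theorem IsTransportSolution.toTarget
    (hw : S.IsTransportSolution i (S.vStar i) (fun _ _ => 0) w wl wr)
    (hv : S.IsTransportSolution i (-S.lam i) (fun t x => S.c i x * w t x) v vl vr)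
    (hbl : ∀ᵐ t ∂(volume.restrict (Ici (0 : ℝ))), S.left i ≠ 0 →
      S.tau i * S.vStar i * S.c i (S.left i) * wl t = S.lam i * vl t)
    (hbr : ∀ᵐ t ∂(volume.restrict (Ici (0 : ℝ))), S.right i ≠ 0 →
      S.tau i * S.vStar i * S.c i (S.right i) * wr t = S.lam i * vr t) :
    S.IsTransportSolution i (-S.lam i) (fun _ _ => 0) (fun t => S.toTarget i (w t, v t))
      (fun t => vl t + (S.kap i)⁻¹ * moment 0 (w t) (v t) (S.left i))
      (fun t => vr t + (S.kap i)⁻¹ * moment 0 (w t) (v t) (S.right i)) := by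
  have hc := S.continuous_c i
  have hk := (S.kap_pos i).ne'
  -- The field `v` has the full source `c w`, hence `k = 1`, which forces `α = 0`. Adding `κ⁻¹`
  -- times the moment cancels this source.
  have hM := isTransportSolution_moment (k := 1) (α := 0) (by ring) hw (by simpa using hv) hbl hbr
    (m := fun t => S.momentOp i 0 (w t, v t))
    ((S.momentOp i 0).continuous.comp_continuousOn
      (hw.continuous_curve.prodMk hv.continuous_curve)) (fun t => momentOp_ae 0 _ _)
  have h := IsTransportSolution.add_const_mul (k := (S.kap i)⁻¹) hc
    (m₂ := fun x => -S.kap i * S.c i x) (by fun_prop) hw.continuous_curve hv hM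
  have e : (fun t x => (S.c i x + (S.kap i)⁻¹ * (-S.kap i * S.c i x)) * w t x) =
      fun _ _ => (0 : ℝ) := by
    funext t x
    field_simp
    ring
  rw [e] at h
  exact h

theorem IsTransportSolution.ofTarget
    (hw : S.IsTransportSolution i (S.vStar i) (fun _ _ => 0) w wl wr)
    (hβ : S.IsTransportSolution i (-S.lam i) (fun _ _ => 0) β βl βr)
    (hbl : ∀ᵐ t ∂(volume.restrict (Ici (0 : ℝ))), S.left i ≠ 0 →
      S.tau i * S.vStar i * S.c i (S.left i) * wl t = S.lam i * βl t)
    (hbr : ∀ᵐ t ∂(volume.restrict (Ici (0 : ℝ))), S.right i ≠ 0 →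
      S.tau i * S.vStar i * S.c i (S.right i) * wr t = S.lam i * βr t) :
    S.IsTransportSolution i (-S.lam i) (fun t x => S.c i x * w t x)
      (fun t => S.ofTarget i (w t, β t))
      (fun t => βl t - (S.kap i)⁻¹ * moment (S.expo i) (w t) (β t) (S.left i))
      (fun t => βr t - (S.kap i)⁻¹ * moment (S.expo i) (w t) (β t) (S.right i)) := by
  have hc := S.continuous_c i
  have hk := (S.kap_pos i).ne'
  have ht := (S.tau_pos i).ne'
  -- The field `β` has no source, hence `k = 0`, and `α = 1 / (τ κ)` follows. Subtracting `κ⁻¹`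
  -- times the moment restores the source `c w`.
  have hM := isTransportSolution_moment (k := 0) (α := S.expo i) (by rw [expo]; field_simp; ring) hw
    (by simpa using hβ) hbl hbr (m := fun t => S.momentOp i (S.expo i) (w t, β t))
    ((S.momentOp i (S.expo i)).continuous.comp_continuousOn
      (hw.continuous_curve.prodMk hβ.continuous_curve)) (fun t => momentOp_ae _ _ _)
  have hβ' : S.IsTransportSolution i (-S.lam i) (fun t x => (fun _ => 0) x * w t x) β βl βr := by
    simpa only [zero_mul] using hβ
  have h := IsTransportSolution.add_const_mul (k := -(S.kap i)⁻¹) continuous_const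
    (m₂ := fun x => -S.kap i * S.c i x) (by fun_prop) hw.continuous_curve hβ' hM
  have e : (fun t x => ((fun _ => (0 : ℝ)) x + -(S.kap i)⁻¹ * (-S.kap i * S.c i x)) * w t x) =
      fun t x => S.c i x * w t x := by
    funext t x
    field_simp
    ring
  rw [e] at h
  simp only [neg_mul, ← sub_eq_add_neg] at h
  exact h

end Transform

end ARZNetwork

/-! ### Equivalence of the closed loop and the target system. -/

namespace ARZNetwork

variable {S : ARZNetwork}

/-- The state `(w, β)` solves the decoupled target system, with pure transport in the interior of
the roads and the given boundary values. -/
structure IsTargetSolution (w β : (i : Road) → ℝ → S.L2 i) (wl wr βl βr : Road → ℝ → ℝ) :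
    Prop where
  transport_w : ∀ i, S.IsTransportSolution i (S.vStar i) (fun _ _ => 0) (w i) (wl i) (wr i)
  transport_β : ∀ i, S.IsTransportSolution i (-S.lam i) (fun _ _ => 0) (β i) (βl i) (βr i)
  boundary : ∀ᵐ t ∂(volume.restrict (Ici (0 : ℝ))),
    βr .one t = S.r .one * S.decayFactor .one * wr .one t ∧
    wl .one t = wr .two t ∧
    wl .two t = S.decayFactor .two * (1 / S.r .two) * βl .two t ∧
    βr .two t = S.r .two / S.r .one * βl .one t +
      (S.r .one - S.r .two) / (1 - S.r .one) * wr .two t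

theorem moment_right_one {α : ℝ} (w y : S.L2 .one) : moment α w y (S.right .one) = 0 :=
  moment_outer rfl

theorem moment_left_two {α : ℝ} (w y : S.L2 .two) : moment α w y (S.left .two) = 0 :=
  moment_outer rfl

/-- The opposite kernel signs compensate the orientations: the moment at the junction integrates
from right to left on the outgoing road and from left to right on the incoming one. -/
theorem integral_kernel (i : Road) (w v : S.L2 i) :
    ∫ ξ in Icc (S.left i) (S.right i), (S.kernelVW i 0 ξ * w ξ + S.kernelVV i 0 ξ * v ξ) =
      -((S.kap i)⁻¹ * moment 0 w v 0) := by
  have hlr := (S.left_lt_right i).le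
  have ht := (S.tau_pos i).ne'
  have hk := (S.kap_pos i).ne'
  have h0 : (0 : ℝ) ∈ Icc (S.left i) (S.right i) := by
    have := S.L_pos
    cases i <;> simp [left, right, this.le]
  have e : (fun ξ => S.kernelVW i 0 ξ * w ξ + S.kernelVV i 0 ξ * v ξ) =
      fun ξ => kernelSign i * (S.kap i)⁻¹ * (S.c i ξ * w ξ + v ξ / S.tau i) := by
    funext ξ
    rw [kernelVW, kernelVV]
    field_simp
  rw [e, integral_const_mul, integral_Icc_eq_integral_Ioc, ← intervalIntegral.integral_of_le hlr,
    moment_zero_eq h0]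
  cases i
  · simp only [kernelSign, left, right, outerEnd]
    rw [intervalIntegral.integral_symm 0 S.L]
    ring
  · simp only [kernelSign, left, right, outerEnd]
    ring

/-- These are precisely the terms by which the junction condition changes when `v` is replaced by
`β`. -/
theorem feedback_kernel (w v : (i : Road) → S.L2 i) :
    S.vStar .two * (1 - S.r .two) / S.qStar * S.feedback S.kernelVW S.kernelVV w v =
      -((S.kap .two)⁻¹ * moment 0 (w .two) (v .two) 0) +
        S.r .two / S.r .one * ((S.kap .one)⁻¹ * moment 0 (w .one) (v .one) 0) := by
  have h1 := (S.vStar_pos .two).ne'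
  have h2 := (S.one_sub_r_pos .two).ne'
  have h3 := S.qStar_pos.ne'
  have e1 : ∫ ξ in Icc (0 : ℝ) S.L, (S.kernelVW .one 0 ξ * w .one ξ +
      S.kernelVV .one 0 ξ * v .one ξ) = _ := integral_kernel .one (w .one) (v .one)
  have e2 : ∫ ξ in Icc (-S.L) (0 : ℝ), (S.kernelVW .two 0 ξ * w .two ξ +
      S.kernelVV .two 0 ξ * v .two ξ) = _ := integral_kernel .two (w .two) (v .two)
  rw [feedback, e1, e2]
  field_simp
  ring

/-- As `r = -v^⋆ / λ` and `c` at the outer end is `-1/τ` times the decay factor, the reflection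
condition is the flux balance that the moment requires. -/
theorem outer_boundary_one {wr vr : ℝ} (h : vr = S.r .one * S.decayFactor .one * wr) :
    S.tau .one * S.vStar .one * S.c .one (S.right .one) * wr = S.lam .one * vr := by
  have h1 := (S.lam_pos .one).ne'
  have h2 := (S.tau_pos .one).ne'
  rw [h, r_eq, decayFactor, c, right]
  field_simp

theorem outer_boundary_two {wl vl : ℝ} (h : wl = S.decayFactor .two * (1 / S.r .two) * vl) :
    S.tau .two * S.vStar .two * S.c .two (S.left .two) * wl = S.lam .two * vl := by
  have h1 := (S.lam_pos .two).ne'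
  have h2 := (S.tau_pos .two).ne'
  have h3 := (S.vStar_pos .two).ne'
  have e : Real.exp (- -S.L / (S.tau .two * S.vStar .two)) *
      Real.exp (-S.L / (S.tau .two * S.vStar .two)) = 1 := by
    rw [← Real.exp_add, neg_neg, neg_div, add_neg_cancel, Real.exp_zero]
  rw [h, r_eq, decayFactor, c, left]
  generalize Real.exp (- -S.L / (S.tau .two * S.vStar .two)) = a at e ⊢
  generalize Real.exp (-S.L / (S.tau .two * S.vStar .two)) = b at e ⊢
  field_simp
  linear_combination vl * e

/-- The junction condition is left abstract as `p`, so the lemma serves both the original and the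
target system. Only the incoming road has its outer end on the left. -/
theorem outer_boundary_left {i : Road} {wl wr vl vr : Road → ℝ → ℝ} {p : ℝ → Prop}
    (h : ∀ᵐ t ∂(volume.restrict (Ici (0 : ℝ))), vr .one t = S.r .one * S.decayFactor .one * wr .one t ∧
      wl .one t = wr .two t ∧ wl .two t = S.decayFactor .two * (1 / S.r .two) * vl .two t ∧ p t) :
    ∀ᵐ t ∂(volume.restrict (Ici (0 : ℝ))), S.left i ≠ 0 →
      S.tau i * S.vStar i * S.c i (S.left i) * wl i t = S.lam i * vl i t := by
  filter_upwards [h] with t ht h0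
  cases i
  · exact absurd rfl h0
  · exact outer_boundary_two ht.2.2.1

theorem outer_boundary_right {i : Road} {wl wr vl vr : Road → ℝ → ℝ} {p : ℝ → Prop}
    (h : ∀ᵐ t ∂(volume.restrict (Ici (0 : ℝ))), vr .one t = S.r .one * S.decayFactor .one * wr .one t ∧
      wl .one t = wr .two t ∧ wl .two t = S.decayFactor .two * (1 / S.r .two) * vl .two t ∧ p t) :
    ∀ᵐ t ∂(volume.restrict (Ici (0 : ℝ))), S.right i ≠ 0 →
      S.tau i * S.vStar i * S.c i (S.right i) * wr i t = S.lam i * vr i t := by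
  filter_upwards [h] with t ht h0
  cases i
  · exact outer_boundary_one ht.1
  · exact absurd rfl h0

theorem IsClosedLoopSolution.exists_target {Kvw Kvv : Road → ℝ → ℝ → ℝ} (hK : S.IsKernel Kvw Kvv)
    {w v : (i : Road) → ℝ → S.L2 i} (h : S.IsClosedLoopSolution Kvw Kvv w v) :
    ∃ wl wr βl βr, IsTargetSolution w (fun i t => S.toTarget i (w i t, v i t)) wl wr βl βr := by
  obtain ⟨wl, wr, vl, vr, hw, hv, hb⟩ := h
  refine ⟨wl, wr, _, _, hw, fun i => IsTransportSolution.toTarget (hw i) (hv i)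
    (outer_boundary_left hb) (outer_boundary_right hb), ?_⟩
  filter_upwards [hb] with t ht
  obtain ⟨h1, h2, h3, h4⟩ := ht
  refine ⟨?_, h2, ?_, ?_⟩
  · rw [moment_right_one, mul_zero, add_zero]; exact h1
  · rw [moment_left_two, mul_zero, add_zero]; exact h3
  · rw [hK.feedback_eq, feedback_kernel] at h4
    rw [h4]
    simp only [left, right]
    ring

theorem IsTargetSolution.isClosedLoopSolution {Kvw Kvv : Road → ℝ → ℝ → ℝ}
    (hK : S.IsKernel Kvw Kvv) {w β : (i : Road) → ℝ → S.L2 i} {wl wr βl βr : Road → ℝ → ℝ}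
    (h : IsTargetSolution w β wl wr βl βr) :
    S.IsClosedLoopSolution Kvw Kvv w (fun i t => S.ofTarget i (w i t, β i t)) := by
  refine ⟨wl, wr, _, _, h.transport_w, fun i => IsTransportSolution.ofTarget (h.transport_w i)
    (h.transport_β i) (outer_boundary_left h.boundary) (outer_boundary_right h.boundary), ?_⟩
  filter_upwards [h.boundary] with t ht
  obtain ⟨h1, h2, h3, h4⟩ := ht
  have hlr := fun i => (S.left_lt_right i).le
  refine ⟨?_, h2, ?_, ?_⟩
  · rw [moment_right_one, mul_zero, sub_zero]; exact h1
  · rw [moment_left_two, mul_zero, sub_zero]; exact h3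
  · rw [hK.feedback_eq, feedback_kernel, h4, moment_ofTarget _ _ (right_mem_Icc.2 (hlr _)),
      moment_ofTarget _ _ (left_mem_Icc.2 (hlr _))]
    simp only [left, right]
    ring

end ARZNetwork

/-- If `Sp₁(H) < 1`, then `H` is a contraction for some weighted Euclidean norm. -/
theorem exists_weights_of_Sp1_lt_one {n : ℕ} {H : Matrix (Fin n) (Fin n) ℝ} (hH : Sp1 H < 1) :
    ∃ (d : Fin n → ℝ) (s : ℝ), (∀ k, 0 < d k) ∧ 0 ≤ s ∧ s < 1 ∧
      ∀ x : Fin n → ℝ, ∑ k, d k * (H.mulVec x k) ^ 2 ≤ s * ∑ k, d k * x k ^ 2 := by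
  have hne : {s : ℝ | ∃ d : Fin n → ℝ, (∀ k, 0 < d k) ∧ s = ‖Matrix.toEuclideanCLM (𝕜 := ℝ)
      (Matrix.diagonal d * H * (Matrix.diagonal d)⁻¹)‖}.Nonempty :=
    ⟨_, fun _ => 1, fun _ => one_pos, rfl⟩
  obtain ⟨s, ⟨d, hd, hs⟩, hs1⟩ := exists_lt_of_csInf_lt hne hH
  have hs0 : 0 ≤ s := by rw [hs]; exact norm_nonneg _
  -- The operator norm bound for `Δ H Δ⁻¹`, applied to the vector `Δ x` and squared.
  refine ⟨fun k => d k ^ 2, s ^ 2, fun k => pow_pos (hd k) 2, sq_nonneg s,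
    pow_lt_one₀ hs0 hs1 two_ne_zero, fun x => ?_⟩
  set A := Matrix.diagonal d * H * (Matrix.diagonal d)⁻¹ with hA
  have hdet : IsUnit (Matrix.diagonal d).det := by
    rw [Matrix.det_diagonal]
    exact (Finset.prod_ne_zero_iff.2 fun k _ => (hd k).ne').isUnit
  set z : EuclideanSpace ℝ (Fin n) := WithLp.toLp 2 ((Matrix.diagonal d).mulVec x) with hz
  have h := (Matrix.toEuclideanCLM (𝕜 := ℝ) A).le_opNorm z
  rw [← hs] at h
  have e : Matrix.toEuclideanCLM (𝕜 := ℝ) A z =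
      WithLp.toLp 2 ((Matrix.diagonal d).mulVec (H.mulVec x)) := by
    rw [hz, Matrix.toEuclideanCLM_toLp, hA, Matrix.mulVec_mulVec, Matrix.mul_assoc,
      Matrix.nonsing_inv_mul _ hdet, Matrix.mul_one, Matrix.mulVec_mulVec]
  have h2 := pow_le_pow_left₀ (norm_nonneg _) h 2
  rw [e, mul_pow, EuclideanSpace.real_norm_sq_eq, EuclideanSpace.real_norm_sq_eq] at h2
  simpa only [hz, Matrix.mulVec_diagonal, mul_pow] using h2

/-! ### Exponential decay of the target system and of the closed loop. -/

namespace ARZNetwork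

variable {S : ARZNetwork}

section Component

variable {i : Road} {u : ℝ → S.L2 i} {ul ur : ℝ → ℝ} {σ ω θ T : ℝ}

theorem integral_sq_mul_mem {u : S.L2 i} {q : ℝ → ℝ} (hq : Continuous q) {a b : ℝ}
    (ha : ∀ x ∈ Icc (S.left i) (S.right i), a ≤ q x)
    (hb : ∀ x ∈ Icc (S.left i) (S.right i), q x ≤ b) :
    a * ‖u‖ ^ 2 ≤ ∫ x in Icc (S.left i) (S.right i), u x ^ 2 * q x ∧
      ∫ x in Icc (S.left i) (S.right i), u x ^ 2 * q x ≤ b * ‖u‖ ^ 2 := by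
  have i₁ : IntegrableOn (fun x => u x ^ 2) (Icc (S.left i) (S.right i)) :=
    integrableOn_sq_of_memLp_two (Lp.memLp u)
  have i₂ := i₁.mul_continuousOn hq.continuousOn isCompact_Icc
  rw [← integral_sq_eq_norm_sq, ← integral_const_mul, ← integral_const_mul]
  constructor
  · refine setIntegral_mono_on (i₁.const_mul _) i₂ measurableSet_Icc fun x hx => ?_
    rw [mul_comm]
    exact mul_le_mul_of_nonneg_left (ha x hx) (sq_nonneg _)
  · refine setIntegral_mono_on i₂ (i₁.const_mul _) measurableSet_Icc fun x hx => ?_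
    rw [mul_comm b]
    exact mul_le_mul_of_nonneg_left (hb x hx) (sq_nonneg _)

/-- The exponentially weighted energy balance of a component moving to the right. -/
theorem IsTransportSolution.energy_right
    (h : S.IsTransportSolution i σ (fun _ _ => 0) u ul ur) (hσ : 0 < σ) (hω : 0 ≤ ω)
    (hθ : θ ≤ Real.exp (-(2 * ω / σ * S.L))) (hT : 0 ≤ T) :
    θ * Real.exp (2 * ω * T) * (‖u T‖ ^ 2 / σ) +
      θ * (∫ t in (0 : ℝ)..T, ur t ^ 2 * Real.exp (2 * ω * t)) ≤
      ‖u 0‖ ^ 2 / σ + ∫ t in (0 : ℝ)..T, ul t ^ 2 * Real.exp (2 * ω * t) := by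
  -- With `μ σ = 2 ω`, a spatial weight of rate `μ` at the foot of the characteristic becomes
  -- `e^{2ωt}` on the inflow trace and `e^{-μL} e^{2ωt}` on the outflow trace.
  set μ := 2 * ω / σ with hμ
  have hμ0 : 0 ≤ μ := by positivity
  have hμσ : μ * σ = 2 * ω := by rw [hμ]; field_simp
  have hrl := S.right_sub_left i
  have hq : Continuous fun y => Real.exp (-(μ * (y - S.left i))) := by fun_prop
  have key := h.energy hσ.ne' hT hq
  have e₁ : (fun t => ur t ^ 2 * Real.exp (-(μ * (S.right i - σ * t - S.left i)))) =
      fun t => Real.exp (-(μ * S.L)) * (ur t ^ 2 * Real.exp (2 * ω * t)) := by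
    funext t
    rw [mul_left_comm, ← Real.exp_add, ← hrl, ← hμσ]
    ring_nf
  have e₂ : (fun t => ul t ^ 2 * Real.exp (-(μ * (S.left i - σ * t - S.left i)))) =
      fun t => ul t ^ 2 * Real.exp (2 * ω * t) := by
    funext t
    rw [← hμσ]
    ring_nf
  rw [e₁, e₂, intervalIntegral.integral_const_mul] at key
  have b₁ := (integral_sq_mul_mem (u := u T)
    (q := fun x => Real.exp (-(μ * (x - σ * T - S.left i)))) (by fun_prop)
    (a := θ * Real.exp (2 * ω * T)) (b := Real.exp (2 * ω * T)) (fun x hx => by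
      refine (mul_le_mul_of_nonneg_right hθ (Real.exp_pos _).le).trans ?_
      rw [← Real.exp_add, ← hμσ, ← hrl]
      refine Real.exp_le_exp.2 ?_
      nlinarith [mul_nonneg hμ0 (sub_nonneg.2 hx.2)])
    (fun x hx => by
      rw [← hμσ]
      refine Real.exp_le_exp.2 ?_
      nlinarith [mul_nonneg hμ0 (sub_nonneg.2 hx.1)])).1
  have b₂ := (integral_sq_mul_mem (u := u 0) hq (a := 0) (b := 1)
    (fun x _ => (Real.exp_pos _).le) (fun x hx => by
      rw [Real.exp_le_one_iff, neg_nonpos]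
      exact mul_nonneg hμ0 (sub_nonneg.2 hx.1))).2
  have hO : 0 ≤ ∫ t in (0 : ℝ)..T, ur t ^ 2 * Real.exp (2 * ω * t) :=
    intervalIntegral.integral_nonneg hT fun t _ => by positivity
  have b₃ := mul_le_mul_of_nonneg_right hθ hO
  have hfin : σ * (θ * Real.exp (2 * ω * T) * (‖u T‖ ^ 2 / σ) +
      θ * (∫ t in (0 : ℝ)..T, ur t ^ 2 * Real.exp (2 * ω * t))) ≤
      σ * (‖u 0‖ ^ 2 / σ + ∫ t in (0 : ℝ)..T, ul t ^ 2 * Real.exp (2 * ω * t)) := by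
    have g₁ : σ * (θ * Real.exp (2 * ω * T) * (‖u T‖ ^ 2 / σ)) =
        θ * Real.exp (2 * ω * T) * ‖u T‖ ^ 2 := by field_simp
    have g₂ : σ * (‖u 0‖ ^ 2 / σ) = ‖u 0‖ ^ 2 := by field_simp
    rw [mul_add, mul_add, g₁, g₂]
    nlinarith [mul_le_mul_of_nonneg_left b₃ hσ.le]
  exact le_of_mul_le_mul_left hfin hσ

/-- The exponentially weighted energy balance of a component moving to the left. -/
theorem IsTransportSolution.energy_left
    (h : S.IsTransportSolution i (-σ) (fun _ _ => 0) u ul ur) (hσ : 0 < σ) (hω : 0 ≤ ω)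
    (hθ : θ ≤ Real.exp (-(2 * ω / σ * S.L))) (hT : 0 ≤ T) :
    θ * Real.exp (2 * ω * T) * (‖u T‖ ^ 2 / σ) +
      θ * (∫ t in (0 : ℝ)..T, ul t ^ 2 * Real.exp (2 * ω * t)) ≤
      ‖u 0‖ ^ 2 / σ + ∫ t in (0 : ℝ)..T, ur t ^ 2 * Real.exp (2 * ω * t) := by
  -- The mirror image of the rightward case: the weight decays away from the right end, where the
  -- inflow now is.
  set μ := 2 * ω / σ with hμ
  have hμ0 : 0 ≤ μ := by positivity
  have hμσ : μ * σ = 2 * ω := by rw [hμ]; field_simp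
  have hrl := S.right_sub_left i
  have hq : Continuous fun y => Real.exp (-(μ * (S.right i - y))) := by fun_prop
  have key := h.energy (neg_ne_zero.2 hσ.ne') hT hq
  have e₁ : (fun t => ul t ^ 2 * Real.exp (-(μ * (S.right i - (S.left i - -σ * t))))) =
      fun t => Real.exp (-(μ * S.L)) * (ul t ^ 2 * Real.exp (2 * ω * t)) := by
    funext t
    rw [mul_left_comm, ← Real.exp_add, ← hrl, ← hμσ]
    ring_nf
  have e₂ : (fun t => ur t ^ 2 * Real.exp (-(μ * (S.right i - (S.right i - -σ * t))))) =
      fun t => ur t ^ 2 * Real.exp (2 * ω * t) := by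
    funext t
    rw [← hμσ]
    ring_nf
  rw [e₁, e₂, intervalIntegral.integral_const_mul] at key
  have b₁ := (integral_sq_mul_mem (u := u T)
    (q := fun x => Real.exp (-(μ * (S.right i - (x - -σ * T))))) (by fun_prop)
    (a := θ * Real.exp (2 * ω * T)) (b := Real.exp (2 * ω * T)) (fun x hx => by
      refine (mul_le_mul_of_nonneg_right hθ (Real.exp_pos _).le).trans ?_
      rw [← Real.exp_add, ← hμσ, ← hrl]
      refine Real.exp_le_exp.2 ?_
      nlinarith [mul_nonneg hμ0 (sub_nonneg.2 hx.1)])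
    (fun x hx => by
      rw [← hμσ]
      refine Real.exp_le_exp.2 ?_
      nlinarith [mul_nonneg hμ0 (sub_nonneg.2 hx.2)])).1
  have b₂ := (integral_sq_mul_mem (u := u 0) hq (a := 0) (b := 1)
    (fun x _ => (Real.exp_pos _).le) (fun x hx => by
      rw [Real.exp_le_one_iff, neg_nonpos]
      exact mul_nonneg hμ0 (sub_nonneg.2 hx.2))).2
  have hO : 0 ≤ ∫ t in (0 : ℝ)..T, ul t ^ 2 * Real.exp (2 * ω * t) :=
    intervalIntegral.integral_nonneg hT fun t _ => by positivity
  have b₃ := mul_le_mul_of_nonneg_right hθ hO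
  have hfin : σ * (θ * Real.exp (2 * ω * T) * (‖u T‖ ^ 2 / σ) +
      θ * (∫ t in (0 : ℝ)..T, ul t ^ 2 * Real.exp (2 * ω * t))) ≤
      σ * (‖u 0‖ ^ 2 / σ + ∫ t in (0 : ℝ)..T, ur t ^ 2 * Real.exp (2 * ω * t)) := by
    have g₁ : σ * (θ * Real.exp (2 * ω * T) * (‖u T‖ ^ 2 / σ)) =
        θ * Real.exp (2 * ω * T) * ‖u T‖ ^ 2 := by field_simp
    have g₂ : σ * (‖u 0‖ ^ 2 / σ) = ‖u 0‖ ^ 2 := by field_simp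
    rw [mul_add, mul_add, g₁, g₂]
    nlinarith [mul_le_mul_of_nonneg_left b₃ hσ.le]
  exact le_of_mul_le_mul_left hfin hσ

end Component

/-- The rate is chosen so that the loss over one road is exactly `θ` at the slowest speed; faster
waves lose less. -/
theorem exists_rate {σ : ℝ} (hσ : 0 < σ) {θ L : ℝ} (hL : 0 < L) (hθ0 : 0 < θ) (hθ1 : θ < 1) :
    ∃ ω > 0, ∀ σ' ≥ σ, θ ≤ Real.exp (-(2 * ω / σ' * L)) := by
  have hlog : 0 < -Real.log θ := neg_pos.2 (Real.log_neg hθ0 hθ1)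
  refine ⟨σ * -Real.log θ / (2 * L), by positivity, fun σ' hσ' => ?_⟩
  have hσ'0 : 0 < σ' := hσ.trans_le hσ'
  rw [← Real.log_le_iff_le_exp hθ0]
  have : 2 * (σ * -Real.log θ / (2 * L)) / σ' * L = σ / σ' * -Real.log θ := by field_simp
  rw [this]
  have h1 : σ / σ' ≤ 1 := (div_le_one hσ'0).2 hσ'
  nlinarith

theorem boundary_contraction {d : Fin 4 → ℝ} {s : ℝ}
    (h : ∀ x : Fin 4 → ℝ, ∑ k, d k * (S.boundaryMatrix.mulVec x k) ^ 2 ≤ s * ∑ k, d k * x k ^ 2)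
    {wl₁ wl₂ wr₁ wr₂ βl₁ βl₂ βr₁ βr₂ : ℝ}
    (h1 : βr₁ = S.r .one * S.decayFactor .one * wr₁) (h2 : wl₁ = wr₂)
    (h3 : wl₂ = S.decayFactor .two * (1 / S.r .two) * βl₂)
    (h4 : βr₂ = S.r .two / S.r .one * βl₁ + (S.r .one - S.r .two) / (1 - S.r .one) * wr₂) :
    d 0 * wl₁ ^ 2 + d 1 * βr₂ ^ 2 + d 2 * βr₁ ^ 2 + d 3 * wl₂ ^ 2 ≤
      s * (d 0 * wr₁ ^ 2 + d 1 * βl₂ ^ 2 + d 2 * βl₁ ^ 2 + d 3 * wr₂ ^ 2) := by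
  have := h ![wr₁, βl₂, βl₁, wr₂]
  simp only [Fin.sum_univ_four, boundaryMatrix, Matrix.mulVec, dotProduct] at this
  simp at this
  rw [h1, h2, h3, h4]
  refine le_trans (le_of_eq ?_) this
  ring

end ARZNetwork

namespace ARZNetwork

variable {S : ARZNetwork}

theorem stateNorm_sq (w v : (i : Road) → S.L2 i) :
    S.stateNorm w v ^ 2 = ‖w .one‖ ^ 2 + ‖w .two‖ ^ 2 + ‖v .one‖ ^ 2 + ‖v .two‖ ^ 2 :=
  Real.sq_sqrt (by positivity)

theorem stateNorm_nonneg (w v : (i : Road) → S.L2 i) : 0 ≤ S.stateNorm w v := Real.sqrt_nonneg _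

theorem integral_boundary_contraction {d : Fin 4 → ℝ} {s ω T : ℝ} (hT : 0 ≤ T)
    (h : ∀ x : Fin 4 → ℝ, ∑ k, d k * (S.boundaryMatrix.mulVec x k) ^ 2 ≤ s * ∑ k, d k * x k ^ 2)
    {w β : (i : Road) → ℝ → S.L2 i} {wl wr βl βr : Road → ℝ → ℝ}
    (hs : IsTargetSolution w β wl wr βl βr) :
    d 0 * (∫ t in (0 : ℝ)..T, wl .one t ^ 2 * Real.exp (2 * ω * t)) +
      d 1 * (∫ t in (0 : ℝ)..T, βr .two t ^ 2 * Real.exp (2 * ω * t)) +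
      d 2 * (∫ t in (0 : ℝ)..T, βr .one t ^ 2 * Real.exp (2 * ω * t)) +
      d 3 * (∫ t in (0 : ℝ)..T, wl .two t ^ 2 * Real.exp (2 * ω * t)) ≤
    s * (d 0 * (∫ t in (0 : ℝ)..T, wr .one t ^ 2 * Real.exp (2 * ω * t)) +
      d 1 * (∫ t in (0 : ℝ)..T, βl .two t ^ 2 * Real.exp (2 * ω * t)) +
      d 2 * (∫ t in (0 : ℝ)..T, βl .one t ^ 2 * Real.exp (2 * ω * t)) +
      d 3 * (∫ t in (0 : ℝ)..T, wr .two t ^ 2 * Real.exp (2 * ω * t))) := by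
  have int : ∀ {f : ℝ → ℝ}, MemLp f 2 (volume.restrict (Icc 0 T)) →
      IntervalIntegrable (fun t => f t ^ 2 * Real.exp (2 * ω * t)) volume 0 T := by
    intro f hf
    rw [intervalIntegrable_iff_integrableOn_Icc_of_le hT]
    exact (integrableOn_sq_of_memLp_two hf).mul_continuousOn
      (g' := fun t => Real.exp (2 * ω * t)) (by fun_prop) isCompact_Icc
  have sum : ∀ {f₀ f₁ f₂ f₃ : ℝ → ℝ}, MemLp f₀ 2 (volume.restrict (Icc 0 T)) →
      MemLp f₁ 2 (volume.restrict (Icc 0 T)) → MemLp f₂ 2 (volume.restrict (Icc 0 T)) →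
      MemLp f₃ 2 (volume.restrict (Icc 0 T)) →
      IntervalIntegrable (fun t => (d 0 * f₀ t ^ 2 + d 1 * f₁ t ^ 2 + d 2 * f₂ t ^ 2 +
        d 3 * f₃ t ^ 2) * Real.exp (2 * ω * t)) volume 0 T ∧
      ∫ t in (0 : ℝ)..T, (d 0 * f₀ t ^ 2 + d 1 * f₁ t ^ 2 + d 2 * f₂ t ^ 2 +
        d 3 * f₃ t ^ 2) * Real.exp (2 * ω * t) =
      d 0 * (∫ t in (0 : ℝ)..T, f₀ t ^ 2 * Real.exp (2 * ω * t)) +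
      d 1 * (∫ t in (0 : ℝ)..T, f₁ t ^ 2 * Real.exp (2 * ω * t)) +
      d 2 * (∫ t in (0 : ℝ)..T, f₂ t ^ 2 * Real.exp (2 * ω * t)) +
      d 3 * (∫ t in (0 : ℝ)..T, f₃ t ^ 2 * Real.exp (2 * ω * t)) := by
    intro f₀ f₁ f₂ f₃ h₀ h₁ h₂ h₃
    have i₀ := (int h₀).const_mul (d 0)
    have i₁ := (int h₁).const_mul (d 1)
    have i₂ := (int h₂).const_mul (d 2)
    have i₃ := (int h₃).const_mul (d 3)
    simp only [add_mul, mul_assoc (d _)]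
    refine ⟨((i₀.add i₁).add i₂).add i₃, ?_⟩
    rw [intervalIntegral.integral_add (by exact (i₀.add i₁).add i₂) i₃,
      intervalIntegral.integral_add (by exact i₀.add i₁) i₂, intervalIntegral.integral_add i₀ i₁]
    simp only [intervalIntegral.integral_const_mul]
  have hin := sum ((hs.transport_w .one).left_trace T) ((hs.transport_β .two).right_trace T)
    ((hs.transport_β .one).right_trace T) ((hs.transport_w .two).left_trace T)
  have hout := sum ((hs.transport_w .one).right_trace T) ((hs.transport_β .two).left_trace T)
    ((hs.transport_β .one).left_trace T) ((hs.transport_w .two).right_trace T)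
  rw [← hin.2, ← hout.2, ← intervalIntegral.integral_const_mul]
  refine intervalIntegral.integral_mono_ae_restrict hT hin.1 (hout.1.const_mul s) ?_
  filter_upwards [ae_restrict_of_ae_restrict_of_subset Icc_subset_Ici_self hs.boundary] with t ht
  obtain ⟨h1, h2, h3, h4⟩ := ht
  rw [← mul_assoc]
  exact mul_le_mul_of_nonneg_right (boundary_contraction h h1 h2 h3 h4) (Real.exp_pos _).le

/-- Exponential stability of the target system. -/
theorem exists_decay_target (hS : Sp1 S.boundaryMatrix < 1) :
    ∃ C ω : ℝ, 0 < C ∧ 0 < ω ∧ ∀ (w β : (i : Road) → ℝ → S.L2 i) (wl wr βl βr : Road → ℝ → ℝ),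
      IsTargetSolution w β wl wr βl βr → ∀ T : ℝ, 0 ≤ T →
      S.stateNorm (fun i => w i T) (fun i => β i T) ≤
        C * Real.exp (-ω * T) * S.stateNorm (fun i => w i 0) (fun i => β i 0) := by
  obtain ⟨d, s, hd, hs0, hs1, hH⟩ := exists_weights_of_Sp1_lt_one hS
  have ha := S.vStar_pos
  have hl := S.lam_pos
  -- The contraction factor `s` may be `0`, whereas the admissible loss per crossing must be
  -- positive for a rate to exist.
  set θ := max s (1 / 2) with hθ
  have hθ0 : 0 < θ := lt_max_of_lt_right (by norm_num)
  have hθ1 : θ < 1 := max_lt hs1 (by norm_num)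
  set σ := min (min (S.vStar .one) (S.vStar .two)) (min (S.lam .one) (S.lam .two)) with hσ
  have hσ0 : 0 < σ := lt_min (lt_min (ha _) (ha _)) (lt_min (hl _) (hl _))
  obtain ⟨ω, hω, hrate⟩ := exists_rate hσ0 S.L_pos hθ0 hθ1
  have hra : ∀ i, θ ≤ Real.exp (-(2 * ω / S.vStar i * S.L)) := fun i => hrate _ (by
    cases i <;> simp [hσ])
  have hrl : ∀ i, θ ≤ Real.exp (-(2 * ω / S.lam i * S.L)) := fun i => hrate _ (by
    cases i <;> simp [hσ])
  -- Each energy balance is divided by its speed, so that boundary terms enter with the weights `d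
  -- k` alone; the interior norms then carry `d k` over the speed.
  set D₀ := d 0 / S.vStar .one
  set D₁ := d 1 / S.lam .two
  set D₂ := d 2 / S.lam .one
  set D₃ := d 3 / S.vStar .two
  have hD₀ : 0 < D₀ := div_pos (hd _) (ha _)
  have hD₁ : 0 < D₁ := div_pos (hd _) (hl _)
  have hD₂ : 0 < D₂ := div_pos (hd _) (hl _)
  have hD₃ : 0 < D₃ := div_pos (hd _) (ha _)
  set m := min (min D₀ D₁) (min D₂ D₃) with hm
  have hm0 : 0 < m := lt_min (lt_min hD₀ hD₁) (lt_min hD₂ hD₃)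
  have m₀ : m ≤ D₀ := by simp [hm]
  have m₁ : m ≤ D₁ := by simp [hm]
  have m₂ : m ≤ D₂ := by simp [hm]
  have m₃ : m ≤ D₃ := by simp [hm]
  set M := D₀ + D₁ + D₂ + D₃ with hM
  have hM0 : 0 < M := by positivity
  refine ⟨Real.sqrt (M / (θ * m)), ω, Real.sqrt_pos.2 (by positivity), hω, ?_⟩
  intro w β wl wr βl βr h T hT
  have hbd := integral_boundary_contraction (ω := ω) hT hH h
  have e₀ := (h.transport_w .one).energy_right (ha _) hω.le (hra _) hT
  have e₁ := (h.transport_β .two).energy_left (hl _) hω.le (hrl _) hT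
  have e₂ := (h.transport_β .one).energy_left (hl _) hω.le (hrl _) hT
  have e₃ := (h.transport_w .two).energy_right (ha _) hω.le (hra _) hT
  have pos : ∀ f : ℝ → ℝ, 0 ≤ ∫ t in (0 : ℝ)..T, f t ^ 2 * Real.exp (2 * ω * t) := fun f =>
    intervalIntegral.integral_nonneg hT fun t _ => by positivity
  have hO : 0 ≤ d 0 * (∫ t in (0 : ℝ)..T, wr .one t ^ 2 * Real.exp (2 * ω * t)) +
      d 1 * (∫ t in (0 : ℝ)..T, βl .two t ^ 2 * Real.exp (2 * ω * t)) +
      d 2 * (∫ t in (0 : ℝ)..T, βl .one t ^ 2 * Real.exp (2 * ω * t)) +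
      d 3 * (∫ t in (0 : ℝ)..T, wr .two t ^ 2 * Real.exp (2 * ω * t)) := by
    have := fun k => (hd k).le
    have p₀ := mul_nonneg (this 0) (pos (wr .one))
    have p₁ := mul_nonneg (this 1) (pos (βl .two))
    have p₂ := mul_nonneg (this 2) (pos (βl .one))
    have p₃ := mul_nonneg (this 3) (pos (wr .two))
    linarith
  have hθO := mul_le_mul_of_nonneg_right (le_max_left s (1 / 2)) hO
  rw [← hθ] at hθO
  have k₀ := mul_le_mul_of_nonneg_left e₀ (hd 0).le
  have k₁ := mul_le_mul_of_nonneg_left e₁ (hd 1).le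
  have k₂ := mul_le_mul_of_nonneg_left e₂ (hd 2).le
  have k₃ := mul_le_mul_of_nonneg_left e₃ (hd 3).le
  set X := Real.exp (2 * ω * T) with hX
  have hX0 : 0 < X := Real.exp_pos _
  -- In the weighted sum, the inflow is at most `s` times the outflow, hence at most `θ` times it,
  -- and this is absorbed by the outflow term on the left.
  have total : θ * X * (D₀ * ‖w .one T‖ ^ 2 + D₁ * ‖β .two T‖ ^ 2 + D₂ * ‖β .one T‖ ^ 2 +
      D₃ * ‖w .two T‖ ^ 2) ≤ D₀ * ‖w .one 0‖ ^ 2 + D₁ * ‖β .two 0‖ ^ 2 + D₂ * ‖β .one 0‖ ^ 2 +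
      D₃ * ‖w .two 0‖ ^ 2 := by
    have c : ∀ a b n : ℝ, a / b * n = a * (n / b) := fun a b n => by ring
    simp only [D₀, D₁, D₂, D₃, c]
    linarith
  have lower : m * S.stateNorm (fun i => w i T) (fun i => β i T) ^ 2 ≤
      D₀ * ‖w .one T‖ ^ 2 + D₁ * ‖β .two T‖ ^ 2 + D₂ * ‖β .one T‖ ^ 2 + D₃ * ‖w .two T‖ ^ 2 := by
    rw [stateNorm_sq]
    have q₀ := mul_le_mul_of_nonneg_right m₀ (sq_nonneg ‖w .one T‖)
    have q₁ := mul_le_mul_of_nonneg_right m₁ (sq_nonneg ‖β .two T‖)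
    have q₂ := mul_le_mul_of_nonneg_right m₂ (sq_nonneg ‖β .one T‖)
    have q₃ := mul_le_mul_of_nonneg_right m₃ (sq_nonneg ‖w .two T‖)
    linarith
  have upper : D₀ * ‖w .one 0‖ ^ 2 + D₁ * ‖β .two 0‖ ^ 2 + D₂ * ‖β .one 0‖ ^ 2 +
      D₃ * ‖w .two 0‖ ^ 2 ≤ M * S.stateNorm (fun i => w i 0) (fun i => β i 0) ^ 2 := by
    rw [stateNorm_sq]
    have q₀ := mul_le_mul_of_nonneg_right (by linarith : D₀ ≤ M) (sq_nonneg ‖w .one 0‖)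
    have q₁ := mul_le_mul_of_nonneg_right (by linarith : D₁ ≤ M) (sq_nonneg ‖β .two 0‖)
    have q₂ := mul_le_mul_of_nonneg_right (by linarith : D₂ ≤ M) (sq_nonneg ‖β .one 0‖)
    have q₃ := mul_le_mul_of_nonneg_right (by linarith : D₃ ≤ M) (sq_nonneg ‖w .two 0‖)
    linarith
  have hN0 := stateNorm_nonneg (fun i => w i 0) (fun i => β i 0)
  rw [← pow_le_pow_iff_left₀ (stateNorm_nonneg _ _) (by positivity) two_ne_zero, mul_pow, mul_pow,
    Real.sq_sqrt (by positivity)]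
  have hexp : Real.exp (-ω * T) ^ 2 * X = 1 := by
    rw [hX, sq, ← Real.exp_add, ← Real.exp_add, ← Real.exp_zero]
    congr 1
    ring
  have h1 : θ * X * (m * S.stateNorm (fun i => w i T) (fun i => β i T) ^ 2) ≤
      M * S.stateNorm (fun i => w i 0) (fun i => β i 0) ^ 2 :=
    (mul_le_mul_of_nonneg_left lower (by positivity)).trans (total.trans upper)
  have h2 := mul_le_mul_of_nonneg_left h1 (by positivity : 0 ≤ Real.exp (-ω * T) ^ 2 / (θ * m))
  calc S.stateNorm (fun i => w i T) (fun i => β i T) ^ 2 = Real.exp (-ω * T) ^ 2 / (θ * m) *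
        (θ * X * (m * S.stateNorm (fun i => w i T) (fun i => β i T) ^ 2)) := by
        have e (a n : ℝ) : a / (θ * m) * (θ * X * (m * n)) = a * X * n := by field_simp
        rw [e, hexp, one_mul]
    _ ≤ _ := h2
    _ = _ := by ring

theorem exists_bound_prod {i : Road} (P : (S.L2 i × S.L2 i) →L[ℝ] S.L2 i) :
    ∃ K, 0 ≤ K ∧ ∀ w y, ‖P (w, y)‖ ^ 2 ≤ K * (‖w‖ ^ 2 + ‖y‖ ^ 2) := by
  refine ⟨‖P‖ ^ 2, by positivity, fun w y => ?_⟩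
  have h := pow_le_pow_left₀ (norm_nonneg _) (P.le_opNorm (w, y)) 2
  rw [mul_pow] at h
  refine h.trans (mul_le_mul_of_nonneg_left ?_ (by positivity))
  rw [Prod.norm_mk]
  rcases max_cases ‖w‖ ‖y‖ with ⟨h1, -⟩ | ⟨h1, -⟩ <;> rw [h1] <;> nlinarith [sq_nonneg ‖w‖, sq_nonneg ‖y‖]

theorem exists_stateNorm_le (P : (i : Road) → (S.L2 i × S.L2 i) →L[ℝ] S.L2 i) :
    ∃ K, 0 < K ∧ ∀ w y : (i : Road) → S.L2 i,
      S.stateNorm w (fun i => P i (w i, y i)) ≤ K * S.stateNorm w y := by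
  obtain ⟨K₁, h₁0, h₁⟩ := exists_bound_prod (P .one)
  obtain ⟨K₂, h₂0, h₂⟩ := exists_bound_prod (P .two)
  refine ⟨Real.sqrt (1 + K₁ + K₂), Real.sqrt_pos.2 (by positivity), fun w y => ?_⟩
  have h0 := stateNorm_nonneg w y
  rw [← pow_le_pow_iff_left₀ (stateNorm_nonneg _ _) (by positivity) two_ne_zero, mul_pow,
    Real.sq_sqrt (by positivity), stateNorm_sq, stateNorm_sq]
  have e₁ := h₁ (w .one) (y .one)
  have e₂ := h₂ (w .two) (y .two)
  have a := sq_nonneg ‖w .one‖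
  have b := sq_nonneg ‖w .two‖
  have c := sq_nonneg ‖y .one‖
  have d := sq_nonneg ‖y .two‖
  nlinarith [mul_nonneg h₁0 b, mul_nonneg h₁0 d, mul_nonneg h₂0 a, mul_nonneg h₂0 c]

/-- Exponential stability of the closed loop system. -/
theorem exists_decay (hS : Sp1 S.boundaryMatrix < 1) :
    ∃ C ω : ℝ, 0 < C ∧ 0 < ω ∧ ∀ Kvw Kvv : Road → ℝ → ℝ → ℝ, S.IsKernel Kvw Kvv →
      ∀ w v : (i : Road) → ℝ → S.L2 i, S.IsClosedLoopSolution Kvw Kvv w v → ∀ t : ℝ, 0 ≤ t →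
      S.stateNorm (fun i => w i t) (fun i => v i t) ≤
        C * Real.exp (-ω * t) * S.stateNorm (fun i => w i 0) (fun i => v i 0) := by
  obtain ⟨C, ω, hC, hω, h⟩ := exists_decay_target hS
  obtain ⟨K₁, hK₁, h₁⟩ := exists_stateNorm_le S.toTarget
  obtain ⟨K₂, hK₂, h₂⟩ := exists_stateNorm_le S.ofTarget
  refine ⟨K₂ * C * K₁, ω, by positivity, hω, fun Kvw Kvv hK w v hwv t ht => ?_⟩
  obtain ⟨wl, wr, βl, βr, htar⟩ := hwv.exists_target hK
  have e := h _ _ _ _ _ _ htar t ht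
  have e₂ := h₂ (fun i => w i t) (fun i => S.toTarget i (w i t, v i t))
  simp only [ofTarget_toTarget] at e₂
  have e₁ := h₁ (fun i => w i 0) (fun i => v i 0)
  calc _ ≤ _ := e₂
    _ ≤ K₂ * (C * Real.exp (-ω * t) * (K₁ * S.stateNorm (fun i => w i 0) (fun i => v i 0))) :=
      mul_le_mul_of_nonneg_left (e.trans (mul_le_mul_of_nonneg_left e₁ (by positivity))) hK₂.le
    _ = _ := by ring

end ARZNetwork

/-! ### Transport of square integrable profiles. -/

theorem MeasureTheory.MemLp.comp_affine {f : ℝ → ℝ} (hf : MemLp f 2 volume) (a : ℝ) {b : ℝ}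
    (hb : b ≠ 0) : MemLp (fun s => f (a + b * s)) 2 volume := by
  have h1 : MemLp (fun s => f (a + s)) 2 volume :=
    hf.comp_measurePreserving (measurePreserving_add_left volume a)
  have h2 : MemLp (fun s => f (a + s)) 2 (Measure.map (b * ·) volume) := by
    rw [Real.map_volume_mul_left hb]
    exact h1.smul_measure ENNReal.ofReal_ne_top
  exact h2.comp_of_map (by fun_prop)

/-- The classical solutions of the transport equation satisfy the weak form. -/
theorem weak_form_of_contDiff {g : ℝ → ℝ} (hg : ContDiff ℝ 1 g) (σ l r T : ℝ) {φ φt φx : ℝ → ℝ → ℝ}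
    (hφ : ContDiff ℝ 1 (Function.uncurry φ))
    (h₁ : ∀ t x, HasDerivAt (fun s => φ s x) (φt t x) t)
    (h₂ : ∀ t x, HasDerivAt (fun y => φ t y) (φx t x) x) :
    (∫ x in l..r, g (x - σ * T) * φ T x) - (∫ x in l..r, g x * φ 0 x) +
      σ * ((∫ t in (0 : ℝ)..T, φ t r * g (r - σ * t)) -
        ∫ t in (0 : ℝ)..T, φ t l * g (l - σ * t)) =
      ∫ t in (0 : ℝ)..T, ∫ x in l..r, g (x - σ * t) * (φt t x + σ * φx t x) := by
  have hgd : ∀ y, HasDerivAt g (deriv g y) y := fun y =>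
    (hg.differentiable one_ne_zero y).hasDerivAt
  have hF : ContDiff ℝ 1 fun z : ℝ × ℝ => g (z.2 - σ * z.1) * Function.uncurry φ z := by
    refine ContDiff.mul (hg.comp ?_) hφ
    fun_prop
  set F : ℝ × ℝ → ℝ := fun z => g (z.2 - σ * z.1) * Function.uncurry φ z with hFdef
  have dF : ∀ z, HasFDerivAt F (fderiv ℝ F z) z := fun z =>
    (hF.differentiable one_ne_zero z).hasFDerivAt
  have cF : Continuous (fderiv ℝ F) := hF.continuous_fderiv one_ne_zero
  have p₁ : ∀ t x, fderiv ℝ F (t, x) (1, 0) =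
      deriv g (x - σ * t) * (-σ) * φ t x + g (x - σ * t) * φt t x := by
    intro t x
    have e : HasDerivAt (fun s : ℝ => (s, x)) (1, 0) t := (hasDerivAt_id t).prodMk (hasDerivAt_const t x)
    refine ((dF (t, x)).comp_hasDerivAt t e).unique ?_
    refine HasDerivAt.mul (c := fun s => g (x - σ * s)) ?_ (h₁ t x)
    refine (hgd (x - σ * t)).comp t ?_
    simpa using ((hasDerivAt_id t).const_mul σ).const_sub x
  have p₂ : ∀ t x, fderiv ℝ F (t, x) (0, 1) =
      deriv g (x - σ * t) * φ t x + g (x - σ * t) * φx t x := by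
    intro t x
    have e : HasDerivAt (fun y : ℝ => (t, y)) (0, 1) x := (hasDerivAt_const x t).prodMk (hasDerivAt_id x)
    refine ((dF (t, x)).comp_hasDerivAt x e).unique ?_
    refine HasDerivAt.mul (c := fun y => g (y - σ * t)) ?_ (h₂ t x)
    have := (hgd (x - σ * t)).comp x ((hasDerivAt_id x).sub_const (σ * t))
    rwa [mul_one] at this
  -- The divergence theorem on the space-time rectangle for the field `(F, σ F)`; its divergence
  -- retains only derivatives of `φ`, as `g (x - σ t)` is constant along characteristics.
  have key := integral2_divergence_prod_of_hasFDerivAt F (fun z => σ * F z) (fderiv ℝ F)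
    (fun z => σ • fderiv ℝ F z) 0 l T r hF.continuous.continuousOn
    (hF.continuous.const_mul σ).continuousOn (fun z _ => dF z) (fun z _ => (dF z).const_mul σ)
    (((cF.clm_apply continuous_const).add ((cF.const_smul σ).clm_apply continuous_const)
      ).continuousOn.integrableOn_compact (isCompact_uIcc.prod isCompact_uIcc))
  have hin : ∀ t x, fderiv ℝ F (t, x) (1, 0) + (σ • fderiv ℝ F (t, x)) (0, 1) =
      g (x - σ * t) * (φt t x + σ * φx t x) := by
    intro t x
    rw [_root_.smul_apply, p₁, p₂, smul_eq_mul]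
    ring
  simp only [hin] at key
  rw [key]
  simp only [hFdef, Function.uncurry, intervalIntegral.integral_const_mul, mul_zero, sub_zero,
    mul_comm (φ _ _)]
  ring

namespace ARZNetwork

variable {S : ARZNetwork} {i : Road}

/-- The restriction to the road `i` of the profile `G`, transported for the time `t` with the
speed `σ`. -/
noncomputable def transported (S : ARZNetwork) (i : Road) (σ t : ℝ) (G : Lp ℝ 2 (volume : Measure ℝ)) :
    S.L2 i :=
  LpToLpRestrictCLM ℝ ℝ ℝ volume 2 (Icc (S.left i) (S.right i))
    (Lp.compMeasurePreserving (fun x => x - σ * t) (measurePreserving_sub_right volume (σ * t)) G)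

theorem transported_ae {σ t : ℝ} {G : Lp ℝ 2 (volume : Measure ℝ)} {g : ℝ → ℝ}
    (hG : G =ᵐ[volume] g) :
    S.transported i σ t G =ᵐ[volume.restrict (Icc (S.left i) (S.right i))]
      fun x => g (x - σ * t) := by
  have hm := measurePreserving_sub_right (volume : Measure ℝ) (σ * t)
  have h1 := hm.quasiMeasurePreserving.ae_eq_comp hG
  filter_upwards [LpToLpRestrictCLM_coeFn ℝ (Icc (S.left i) (S.right i))
    (Lp.compMeasurePreserving (fun x => x - σ * t) hm G),
    ae_restrict_of_ae (Lp.coeFn_compMeasurePreserving G hm), ae_restrict_of_ae h1] with x h2 h3 h4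
  rw [transported, h2, h3, h4]
  rfl

/-- Translations act continuously on `L²`, jointly in the shift and the profile; restriction to the
road is bounded. -/
theorem continuous_transported (S : ARZNetwork) (i : Road) (σ : ℝ) :
    Continuous fun z : Lp ℝ 2 (volume : Measure ℝ) × ℝ => S.transported i σ z.2 z.1 := by
  refine (LpToLpRestrictCLM ℝ ℝ ℝ volume 2 (Icc (S.left i) (S.right i))).continuous.comp ?_
  let f : C(ℝ × ℝ, ℝ) := ⟨fun z => z.2 - σ * z.1, by fun_prop⟩
  have hf : Continuous fun z : Lp ℝ 2 (volume : Measure ℝ) × ℝ => f.curry z.2 :=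
    f.curry.continuous.comp continuous_snd
  exact continuous_fst.compMeasurePreservingLp hf
    (fun z => measurePreserving_sub_right volume (σ * z.2)) ENNReal.ofNat_ne_top

theorem continuous_integral_mul_Lp {h : ℝ → ℝ} (hh : MemLp h 2 volume) :
    Continuous fun G : Lp ℝ 2 (volume : Measure ℝ) => ∫ y, h y * G y := by
  have : (fun G : Lp ℝ 2 (volume : Measure ℝ) => ∫ y, h y * G y) =
      fun G => inner ℝ (hh.toLp h) G := by
    funext G
    rw [L2.inner_def]
    refine integral_congr_ae ?_
    filter_upwards [hh.coeFn_toLp] with x hx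
    rw [hx, RCLike.inner_apply, conj_trivial, mul_comm]
  rw [this]
  exact continuous_const.inner continuous_id

/-- An `L²` profile has no values at individual points, but its time trace at `e`, paired with a
test function, is an inner product with this function and so depends continuously on the profile. -/
theorem memLp_indicator_boundary {p : ℝ → ℝ} (hp : Continuous p) {σ : ℝ} (hσ : σ ≠ 0) (e T : ℝ) :
    MemLp (fun y => (Ioo 0 T).indicator p ((e - y) / σ)) 2 volume := by
  have h : MemLp ((Ioo 0 T).indicator p) 2 volume := by
    rw [memLp_indicator_iff_restrict measurableSet_Ioo]
    exact (memLp_two_of_continuous (l := 0) (r := T) hp).mono_measure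
      (Measure.restrict_mono Ioo_subset_Icc_self le_rfl)
  convert h.comp_affine (e / σ) (b := -σ⁻¹) (by simpa using hσ) using 3
  ring

theorem weak_form_transported_of_contDiff {σ : ℝ} (hσ : σ ≠ 0) {T : ℝ} (hT : 0 ≤ T)
    {φ φt φx : ℝ → ℝ → ℝ} (hφ : ContDiff ℝ 1 (Function.uncurry φ))
    (h₁ : ∀ t x, HasDerivAt (fun s => φ s x) (φt t x) t)
    (h₂ : ∀ t x, HasDerivAt (fun y => φ t y) (φx t x) x)
    {G : Lp ℝ 2 (volume : Measure ℝ)} {g : ℝ → ℝ} (hGg : G =ᵐ[volume] g) (hg : ContDiff ℝ 1 g) :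
    pair (S.transported i σ T G) (φ T) - pair (S.transported i σ 0 G) (φ 0) +
      σ * (|σ|⁻¹ * ((∫ y, (Ioo 0 T).indicator (fun t => φ t (S.right i)) ((S.right i - y) / σ) * G y) -
        ∫ y, (Ioo 0 T).indicator (fun t => φ t (S.left i)) ((S.left i - y) / σ) * G y)) =
      ∫ t in (0 : ℝ)..T, pair (S.transported i σ t G) (fun x => φt t x + σ * φx t x) := by
  have hlr := (S.left_lt_right i).le
  have hp : ∀ t (ψ : ℝ → ℝ), pair (S.transported i σ t G) ψ =
      ∫ x in (S.left i)..(S.right i), g (x - σ * t) * ψ x := by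
    intro t ψ
    rw [intervalIntegral.integral_of_le hlr, ← integral_Icc_eq_integral_Ioc]
    refine integral_congr_ae ?_
    filter_upwards [transported_ae (S := S) (i := i) (σ := σ) (t := t) hGg] with x hx
    rw [hx]
  have hb : ∀ e, (∫ y, (Ioo 0 T).indicator (fun t => φ t e) ((e - y) / σ) * G y) =
      |σ| * ∫ t in (0 : ℝ)..T, φ t e * g (e - σ * t) := by
    intro e
    rw [← integral_indicator_boundary _ g hσ e hT]
    refine integral_congr_ae ?_
    filter_upwards [hGg] with y hy
    rw [hy]
  rw [hb, hb, ← mul_sub, inv_mul_cancel_left₀ (abs_ne_zero.2 hσ), hp, hp]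
  simp_rw [hp]
  rw [← weak_form_of_contDiff hg σ (S.left i) (S.right i) T hφ h₁ h₂]
  simp only [mul_zero, sub_zero]

/-- The weak form of the transport equation for a square integrable profile. -/
theorem weak_form_transported (σ : ℝ) (hσ : σ ≠ 0) {T : ℝ} (hT : 0 ≤ T) {φ φt φx : ℝ → ℝ → ℝ}
    (hφ : ContDiff ℝ 1 (Function.uncurry φ))
    (h₁ : ∀ t x, HasDerivAt (fun s => φ s x) (φt t x) t)
    (h₂ : ∀ t x, HasDerivAt (fun y => φ t y) (φx t x) x)
    (c₁ : Continuous (Function.uncurry φt)) (c₂ : Continuous (Function.uncurry φx))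
    (G : Lp ℝ 2 (volume : Measure ℝ)) :
    pair (S.transported i σ T G) (φ T) - pair (S.transported i σ 0 G) (φ 0) +
      σ * (|σ|⁻¹ * ((∫ y, (Ioo 0 T).indicator (fun t => φ t (S.right i)) ((S.right i - y) / σ) * G y) -
        ∫ y, (Ioo 0 T).indicator (fun t => φ t (S.left i)) ((S.left i - y) / σ) * G y)) =
      ∫ t in (0 : ℝ)..T, pair (S.transported i σ t G) (fun x => φt t x + σ * φx t x) := by
  have cφ := hφ.continuous
  have cψ : Continuous (Function.uncurry fun t x => φt t x + σ * φx t x) :=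
    c₁.add (c₂.const_mul σ)
  have pairc : ∀ (ψ : ℝ → ℝ → ℝ), Continuous (Function.uncurry ψ) →
      Continuous (Function.uncurry fun (G : Lp ℝ 2 (volume : Measure ℝ)) t =>
        pair (S.transported i σ t G) (ψ t)) := by
    intro ψ hψ
    have : (Function.uncurry fun (G : Lp ℝ 2 (volume : Measure ℝ)) t =>
        pair (S.transported i σ t G) (ψ t)) = fun z : Lp ℝ 2 (volume : Measure ℝ) × ℝ =>
        inner ℝ ((memLp_two_of_continuous (l := S.left i) (r := S.right i)
          (hψ.uncurry_left z.2)).toLp (ψ z.2)) (S.transported i σ z.2 z.1) := by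
      funext z
      exact integral_mul_eq_inner _ _
    rw [this]
    exact ((continuous_toLp_curve hψ).comp continuous_snd).inner (continuous_transported S i σ)
  -- Both sides are continuous in the profile and agree for smooth compactly supported ones.
  have dense := Lp.dense_hasCompactSupport_contDiff (F := ℝ) (E := ℝ) (μ := volume) (p := 2)
    ENNReal.ofNat_ne_top
  refine congrFun (Continuous.ext_on dense (f := fun G => pair (S.transported i σ T G) (φ T) -
    pair (S.transported i σ 0 G) (φ 0) + σ * (|σ|⁻¹ *
      ((∫ y, (Ioo 0 T).indicator (fun t => φ t (S.right i)) ((S.right i - y) / σ) * G y) -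
        ∫ y, (Ioo 0 T).indicator (fun t => φ t (S.left i)) ((S.left i - y) / σ) * G y)))
    (g := fun G => ∫ t in (0 : ℝ)..T, pair (S.transported i σ t G) (fun x => φt t x + σ * φx t x))
    ?_ ?_ ?_) G
  · have b : ∀ e, Continuous fun G : Lp ℝ 2 (volume : Measure ℝ) =>
        ∫ y, (Ioo 0 T).indicator (fun t => φ t e) ((e - y) / σ) * G y := fun e =>
      continuous_integral_mul_Lp (h := fun y => (Ioo 0 T).indicator (fun t => φ t e) ((e - y) / σ))
        (memLp_indicator_boundary (p := fun t => φ t e) (cφ.uncurry_right e) hσ e T)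
    have a : ∀ t, Continuous fun G : Lp ℝ 2 (volume : Measure ℝ) =>
        pair (S.transported i σ t G) (φ t) := fun t =>
      Continuous.uncurry_right (f := fun (G : Lp ℝ 2 (volume : Measure ℝ)) t =>
        pair (S.transported i σ t G) (φ t)) t (pairc φ cφ)
    have hb := (((b (S.right i)).sub (b (S.left i))).const_mul |σ|⁻¹).const_mul σ
    exact ((a T).sub (a 0)).add hb
  · exact intervalIntegral.continuous_parametric_intervalIntegral_of_continuous' (pairc _ cψ) 0 T
  · rintro G ⟨g, hGg, -, hg⟩
    exact weak_form_transported_of_contDiff hσ hT hφ h₁ h₂ hGg (hg.of_le (by simp))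

end ARZNetwork

/-- `f` is square integrable over every bounded interval. -/
def LocallySquareIntegrable (f : ℝ → ℝ) : Prop :=
  ∀ R : ℝ, MemLp f 2 (volume.restrict (Icc (-R) R))

namespace LocallySquareIntegrable

variable {f : ℝ → ℝ}

theorem memLp_indicator (hf : LocallySquareIntegrable f) (R : ℝ) :
    MemLp ((Icc (-R) R).indicator f) 2 volume :=
  (memLp_indicator_iff_restrict measurableSet_Icc).2 (hf R)

theorem memLp_Icc (hf : LocallySquareIntegrable f) (a b : ℝ) :
    MemLp f 2 (volume.restrict (Icc a b)) :=
  (hf (max |a| |b|)).mono_measure (Measure.restrict_mono (Icc_subset_Icc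
    (neg_le.1 ((neg_le_abs a).trans (le_max_left _ _)))
    ((le_abs_self b).trans (le_max_right _ _))) le_rfl)

theorem comp_affine (hf : LocallySquareIntegrable f) (a : ℝ) {b : ℝ} (hb : b ≠ 0) :
    LocallySquareIntegrable fun s => f (a + b * s) := by
  intro R
  refine (((hf.memLp_indicator (|a| + |b| * R)).comp_affine a hb).restrict _).ae_eq ?_
  filter_upwards [ae_restrict_mem measurableSet_Icc] with s hs
  rw [indicator_of_mem]
  rw [mem_Icc, ← abs_le] at hs ⊢
  refine (abs_add_le _ _).trans ?_
  rw [abs_mul]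
  gcongr

end LocallySquareIntegrable

/-! ### Locally square integrable profiles and boundary signals. -/

namespace ARZNetwork

variable {S : ARZNetwork} {i : Road}

/-- A locally square integrable profile, transported with the speed `σ`, is a weak solution. -/
theorem exists_isTransportSolution {G : ℝ → ℝ} (hG : LocallySquareIntegrable G) {σ : ℝ}
    (hσ : σ ≠ 0) :
    ∃ u : ℝ → S.L2 i, (∀ t, u t =ᵐ[volume.restrict (Icc (S.left i) (S.right i))]
        fun x => G (x - σ * t)) ∧
      S.IsTransportSolution i σ (fun _ _ => 0) u (fun t => G (S.left i - σ * t))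
        (fun t => G (S.right i - σ * t)) := by
  have hlr := (S.left_lt_right i).le
  have hx : ∀ t, MemLp (fun x => G (x - σ * t)) 2
      (volume.restrict (Icc (S.left i) (S.right i))) := by
    intro t
    have := (hG.comp_affine (-(σ * t)) one_ne_zero).memLp_Icc (S.left i) (S.right i)
    simpa only [one_mul, neg_add_eq_sub] using this
  have ht : ∀ e, LocallySquareIntegrable fun t => G (e - σ * t) := by
    intro e
    simpa only [neg_mul, ← sub_eq_add_neg] using hG.comp_affine e (neg_ne_zero.2 hσ)
  -- Up to time `T` the road only sees feet of characteristics in `[-R T, R T]`, so the profile may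
  -- be truncated there to lie in `L²`.
  set R : ℝ → ℝ := fun T => |S.left i| + |S.right i| + |σ| * T with hR
  let P : ℝ → Lp ℝ 2 (volume : Measure ℝ) := fun T => (hG.memLp_indicator (R T)).toLp _
  have hP : ∀ T, P T =ᵐ[volume] (Icc (-R T) (R T)).indicator G := fun T => MemLp.coeFn_toLp _
  have hmem : ∀ T t x, |t| ≤ T → x ∈ Icc (S.left i) (S.right i) →
      x - σ * t ∈ Icc (-R T) (R T) := by
    intro T t x htT hx
    rw [mem_Icc, ← abs_le]
    refine (abs_sub _ _).trans ?_
    rw [abs_mul, hR]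
    have h1 : |x| ≤ |S.left i| + |S.right i| := by
      rw [abs_le]
      constructor
      · linarith [neg_abs_le (S.left i), hx.1, abs_nonneg (S.right i)]
      · linarith [le_abs_self (S.right i), hx.2, abs_nonneg (S.left i)]
    exact add_le_add h1 (mul_le_mul_of_nonneg_left htT (abs_nonneg σ))
  set u : ℝ → S.L2 i := fun t => (hx t).toLp _ with hu
  have huP : ∀ T t, |t| ≤ T → u t = S.transported i σ t (P T) := by
    intro T t htT
    refine Lp.ext ?_
    filter_upwards [(hx t).coeFn_toLp, transported_ae (S := S) (i := i) (σ := σ) (t := t) (hP T),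
      ae_restrict_mem measurableSet_Icc] with x h1 h2 h3
    rw [hu, h1, h2, indicator_of_mem (hmem T t x htT h3)]
  have huc : Continuous u := by
    rw [continuous_iff_continuousAt]
    intro t₀
    have hc : Continuous fun t => S.transported i σ t (P (|t₀| + 1)) :=
      (continuous_transported S i σ).comp (continuous_const.prodMk continuous_id)
    refine hc.continuousAt.congr ?_
    have : ∀ᶠ t in nhds t₀, |t| < |t₀| + 1 :=
      continuous_abs.continuousAt.eventually_lt continuousAt_const (lt_add_one _)
    filter_upwards [this] with t h
    exact (huP _ t h.le).symm
  refine ⟨u, fun t => (hx t).coeFn_toLp, ?_⟩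
  have key := isTransportSolution_of_pair (σ := σ) (m := fun _ => 0) continuous_const (w := u)
    huc.continuousOn (fun T => (ht (S.left i)).memLp_Icc 0 T)
    (fun T => (ht (S.right i)).memLp_Icc 0 T) ?_
  · simpa only [zero_mul] using key
  intro φ φt φx hφ h₁ h₂ c₁ c₂ T hT
  have hw := weak_form_transported (S := S) (i := i) σ hσ hT hφ h₁ h₂ c₁ c₂ (P T)
  have hb : ∀ e ∈ Icc (S.left i) (S.right i),
      (∫ y, (Ioo 0 T).indicator (fun t => φ t e) ((e - y) / σ) * P T y) =
        |σ| * ∫ t in (0 : ℝ)..T, G (e - σ * t) * φ t e := by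
    intro e he
    have h1 : (∫ y, (Ioo 0 T).indicator (fun t => φ t e) ((e - y) / σ) * P T y) =
        ∫ y, (Ioo 0 T).indicator (fun t => φ t e) ((e - y) / σ) *
          (Icc (-R T) (R T)).indicator G y := by
      refine integral_congr_ae ?_
      filter_upwards [hP T] with y hy
      rw [hy]
    rw [h1, integral_indicator_boundary _ _ hσ e hT]
    congr 1
    refine intervalIntegral.integral_congr fun t ht => ?_
    rw [uIcc_of_le hT] at ht
    rw [indicator_of_mem (hmem T t e (abs_le.2 ⟨by linarith [ht.1], ht.2⟩) he), mul_comm]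
  have hi : ∀ e, IntervalIntegrable (fun t => G (e - σ * t) * φ t e) volume 0 T := by
    intro e
    rw [intervalIntegrable_iff_integrableOn_Icc_of_le hT]
    have h1 : IntegrableOn (fun t => G (e - σ * t)) (Icc 0 T) :=
      ((ht e).memLp_Icc 0 T).integrable one_le_two
    exact h1.mul_continuousOn (hφ.continuous.uncurry_right e).continuousOn isCompact_Icc
  rw [hb _ (right_mem_Icc.2 hlr), hb _ (left_mem_Icc.2 hlr), ← mul_sub,
    inv_mul_cancel_left₀ (abs_ne_zero.2 hσ), ← huP T T (abs_of_nonneg hT).le,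
    ← huP T 0 (by rwa [abs_zero])] at hw
  rw [intervalIntegral.integral_sub (hi _) (hi _), hw]
  refine intervalIntegral.integral_congr fun t ht => ?_
  rw [uIcc_of_le hT] at ht
  rw [huP T t (abs_le.2 ⟨by linarith [ht.1], ht.2⟩)]
  simp [pair]

/-- A transport equation whose speed is positive, with a prescribed inflow at the left end. -/
theorem exists_transport_right {F : ℝ → ℝ} (hF : LocallySquareIntegrable F) {σ : ℝ} (hσ : 0 < σ)
    (u₀ : S.L2 i)
    (h₀ : ∀ s ≤ 0, F s = (Icc (S.left i) (S.right i)).indicator u₀ (S.left i + -σ * s)) :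
    ∃ u : ℝ → S.L2 i, u 0 = u₀ ∧
      S.IsTransportSolution i σ (fun _ _ => 0) u F (fun t => F (t - S.L / σ)) := by
  -- The profile is `y ↦ F ((left - y) / σ)`: the inflow signal for positive times, and the initial
  -- state encoded as its past.
  obtain ⟨u, hu, hs⟩ := exists_isTransportSolution (S := S) (i := i)
    (hF.comp_affine (S.left i / σ) (b := -σ⁻¹) (by simpa using hσ.ne')) hσ.ne'
  refine ⟨u, Lp.ext ?_, ?_⟩
  · filter_upwards [hu 0, ae_restrict_mem measurableSet_Icc] with x h hx
    have e : S.left i / σ + -σ⁻¹ * (x - σ * 0) = -((x - S.left i) / σ) := by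
      field_simp
      ring
    rw [h, e, h₀ _ (neg_nonpos.2 (div_nonneg (sub_nonneg.2 hx.1) hσ.le))]
    have e' : S.left i + -σ * -((x - S.left i) / σ) = x := by
      field_simp
      ring
    rw [e', indicator_of_mem hx]
  · have hL := S.right_sub_left i
    convert hs using 3 with t t
    · field_simp
      ring
    · rw [← hL]
      field_simp
      ring

/-- A transport equation whose speed is negative, with a prescribed inflow at the right end. -/
theorem exists_transport_left {F : ℝ → ℝ} (hF : LocallySquareIntegrable F) {σ : ℝ} (hσ : 0 < σ)
    (u₀ : S.L2 i)
    (h₀ : ∀ s ≤ 0, F s = (Icc (S.left i) (S.right i)).indicator u₀ (S.right i + σ * s)) :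
    ∃ u : ℝ → S.L2 i, u 0 = u₀ ∧
      S.IsTransportSolution i (-σ) (fun _ _ => 0) u (fun t => F (t - S.L / σ)) F := by
  obtain ⟨u, hu, hs⟩ := exists_isTransportSolution (S := S) (i := i)
    (hF.comp_affine (-(S.right i / σ)) (b := σ⁻¹) (by simpa using hσ.ne')) (neg_ne_zero.2 hσ.ne')
  refine ⟨u, Lp.ext ?_, ?_⟩
  · filter_upwards [hu 0, ae_restrict_mem measurableSet_Icc] with x h hx
    have e : -(S.right i / σ) + σ⁻¹ * (x - -σ * 0) = -((S.right i - x) / σ) := by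
      field_simp
      ring
    rw [h, e, h₀ _ (neg_nonpos.2 (div_nonneg (sub_nonneg.2 hx.2) hσ.le))]
    have e' : S.right i + σ * -((S.right i - x) / σ) = x := by
      field_simp
      ring
    rw [e', indicator_of_mem hx]
  · have hL := S.right_sub_left i
    convert hs using 3 with t t
    · rw [← hL]
      field_simp
      ring
    · field_simp
      ring

end ARZNetwork

/-! ### Delay equations by the method of steps. -/

section Delay

variable {ι : Type*} [Fintype ι]

/-- The successive approximations of the solution of the system of delay equations
`F_k(s) = ∑_j H_{kj} F_j(s - τ_j)`, `s > 0`, with the history `F = f` on `s ≤ 0`. -/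
noncomputable def delayIterate (H : Matrix ι ι ℝ) (τ : ι → ℝ) (f : ι → ℝ → ℝ) :
    ℕ → ι → ℝ → ℝ
  | 0 => f
  | n + 1 => fun k s => if s ≤ 0 then f k s else ∑ j, H k j * delayIterate H τ f n j (s - τ j)

variable {H : Matrix ι ι ℝ} {τ : ι → ℝ} {f : ι → ℝ → ℝ} {δ : ℝ}

theorem delayIterate_of_nonpos (n : ℕ) (k : ι) {s : ℝ} (hs : s ≤ 0) :
    delayIterate H τ f n k s = f k s := by
  cases n with
  | zero => rfl
  | succ n => exact if_pos hs

theorem delayIterate_succ (n : ℕ) (k : ι) {s : ℝ} (hs : 0 < s) :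
    delayIterate H τ f (n + 1) k s = ∑ j, H k j * delayIterate H τ f n j (s - τ j) :=
  if_neg hs.not_ge

/-- Every delay is at least `δ`, so each iteration makes the solution final on one further interval
of length `δ`. -/
theorem delayIterate_succ_eq (hτ : ∀ j, δ ≤ τ j) (n : ℕ) (k : ι) {s : ℝ} (hs : s ≤ n * δ) :
    delayIterate H τ f (n + 1) k s = delayIterate H τ f n k s := by
  induction n generalizing k s with
  | zero =>
    rw [Nat.cast_zero, zero_mul] at hs
    rw [delayIterate_of_nonpos _ _ hs, delayIterate_of_nonpos _ _ hs]
  | succ n ih =>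
    rcases le_or_gt s 0 with h | h
    · rw [delayIterate_of_nonpos _ _ h, delayIterate_of_nonpos _ _ h]
    · rw [delayIterate_succ _ _ h, delayIterate_succ _ _ h]
      refine Finset.sum_congr rfl fun j _ => ?_
      rw [ih]
      push_cast at hs
      linarith [hτ j]

theorem delayIterate_eq (hδ : 0 ≤ δ) (hτ : ∀ j, δ ≤ τ j) {m n : ℕ} (hmn : n ≤ m) (k : ι) {s : ℝ}
    (hs : s ≤ n * δ) : delayIterate H τ f m k s = delayIterate H τ f n k s := by
  induction m, hmn using Nat.le_induction with
  | base => rfl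
  | succ m hmn ih =>
    rw [delayIterate_succ_eq hτ m k (hs.trans (by gcongr)), ih]

theorem memLp_delayIterate (hf : ∀ k, MemLp (f k) 2 volume) (n : ℕ) (k : ι) :
    MemLp (delayIterate H τ f n k) 2 volume := by
  induction n generalizing k with
  | zero => exact hf k
  | succ n ih =>
    refine MemLp.piecewise (s := Iic 0) measurableSet_Iic ((hf k).restrict _) (MemLp.restrict _ ?_)
    refine memLp_finsetSum _ fun j _ => MemLp.const_mul ?_ _
    exact (ih j).comp_measurePreserving (measurePreserving_sub_right volume (τ j))

/-- A system of delay equations has a locally square integrable solution. -/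
theorem exists_delay_solution (H : Matrix ι ι ℝ) (hδ : 0 < δ) (hτ : ∀ j, δ ≤ τ j)
    (hf : ∀ k, MemLp (f k) 2 volume) :
    ∃ F : ι → ℝ → ℝ, (∀ k, LocallySquareIntegrable (F k)) ∧ (∀ k, ∀ s ≤ 0, F k s = f k s) ∧
      ∀ k, ∀ s > 0, F k s = ∑ j, H k j * F j (s - τ j) := by
  have hle : ∀ s, s ≤ (⌈s / δ⌉₊ : ℝ) * δ := fun s => (div_le_iff₀ hδ).1 (Nat.le_ceil _)
  have key : ∀ (n : ℕ) k s, s ≤ n * δ →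
      delayIterate H τ f ⌈s / δ⌉₊ k s = delayIterate H τ f n k s := by
    intro n k s hs
    exact (delayIterate_eq hδ.le hτ (Nat.ceil_le.2 ((div_le_iff₀ hδ).2 hs)) k (hle s)).symm
  -- At each `s` the first iterate guaranteed to be final is taken; on a bounded interval the result
  -- agrees with a single iterate, whence local square integrability.
  refine ⟨fun k s => delayIterate H τ f ⌈s / δ⌉₊ k s, fun k R => ?_, fun k s hs =>
    delayIterate_of_nonpos _ k hs, fun k s hs => ?_⟩
  · refine ((memLp_delayIterate (H := H) (τ := τ) hf ⌈R / δ⌉₊ k).restrict _).ae_eq ?_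
    filter_upwards [ae_restrict_mem measurableSet_Icc] with s hs
    exact (key _ k s (hs.2.trans (hle R))).symm
  · have h1 := hle s
    simp only
    rw [key (⌈s / δ⌉₊ + 1) k s (h1.trans (by gcongr; simp)), delayIterate_succ _ _ hs]
    refine Finset.sum_congr rfl fun j _ => ?_
    rw [key ⌈s / δ⌉₊ j (s - τ j) (by linarith [hτ j])]

end Delay

/-! ### Existence for the target system. -/

namespace ARZNetwork

variable {S : ARZNetwork}

theorem memLp_indicator_coe {i : Road} (u : S.L2 i) :
    MemLp ((Icc (S.left i) (S.right i)).indicator u) 2 volume :=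
  (memLp_indicator_iff_restrict measurableSet_Icc).2 (Lp.memLp u)

/-- The target system has a solution for all square integrable initial data. -/
theorem exists_isTargetSolution (w₀ β₀ : (i : Road) → S.L2 i) :
    ∃ (w β : (i : Road) → ℝ → S.L2 i) (wl wr βl βr : Road → ℝ → ℝ),
      IsTargetSolution w β wl wr βl βr ∧ (∀ i, w i 0 = w₀ i) ∧ ∀ i, β i 0 = β₀ i := by
  have ha := S.vStar_pos
  have hl := S.lam_pos
  have hL := S.L_pos
  -- Crossing times, in the component order of `boundaryMatrix`: the outgoing boundary value of a
  -- component is its incoming signal delayed by this time.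
  let τ : Fin 4 → ℝ :=
    ![S.L / S.vStar .one, S.L / S.lam .two, S.L / S.lam .one, S.L / S.vStar .two]
  have hτ : ∀ j, 0 < τ j := by
    intro j
    fin_cases j
    exacts [div_pos hL (ha _), div_pos hL (hl _), div_pos hL (hl _), div_pos hL (ha _)]
  let f : Fin 4 → ℝ → ℝ :=
    ![fun s => (Icc (S.left .one) (S.right .one)).indicator (w₀ .one)
        (S.left .one + -S.vStar .one * s),
      fun s => (Icc (S.left .two) (S.right .two)).indicator (β₀ .two)
        (S.right .two + S.lam .two * s),
      fun s => (Icc (S.left .one) (S.right .one)).indicator (β₀ .one)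
        (S.right .one + S.lam .one * s),
      fun s => (Icc (S.left .two) (S.right .two)).indicator (w₀ .two)
        (S.left .two + -S.vStar .two * s)]
  have hf : ∀ k, MemLp (f k) 2 volume := by
    intro k
    fin_cases k
    · exact (memLp_indicator_coe (w₀ .one)).comp_affine _ (neg_ne_zero.2 (ha _).ne')
    · exact (memLp_indicator_coe (β₀ .two)).comp_affine _ (hl _).ne'
    · exact (memLp_indicator_coe (β₀ .one)).comp_affine _ (hl _).ne'
    · exact (memLp_indicator_coe (w₀ .two)).comp_affine _ (neg_ne_zero.2 (ha _).ne')
  obtain ⟨j₀, hj₀⟩ := Finite.exists_min τ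
  obtain ⟨F, hF, hF₀, hFd⟩ := exists_delay_solution S.boundaryMatrix (hτ j₀) hj₀ hf
  obtain ⟨w₁, hw₁, tw₁⟩ := exists_transport_right (hF 0) (ha .one) (w₀ .one) (hF₀ 0)
  obtain ⟨β₂, hβ₂, tβ₂⟩ := exists_transport_left (hF 1) (hl .two) (β₀ .two) (hF₀ 1)
  obtain ⟨β₁, hβ₁, tβ₁⟩ := exists_transport_left (hF 2) (hl .one) (β₀ .one) (hF₀ 2)
  obtain ⟨w₂, hw₂, tw₂⟩ := exists_transport_right (hF 3) (ha .two) (w₀ .two) (hF₀ 3)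
  refine ⟨fun | .one => w₁ | .two => w₂, fun | .one => β₁ | .two => β₂,
    fun | .one => F 0 | .two => F 3,
    fun | .one => fun t => F 0 (t - S.L / S.vStar .one)
        | .two => fun t => F 3 (t - S.L / S.vStar .two),
    fun | .one => fun t => F 2 (t - S.L / S.lam .one)
        | .two => fun t => F 1 (t - S.L / S.lam .two),
    fun | .one => F 2 | .two => F 1, ⟨?_, ?_, ?_⟩, ?_, ?_⟩
  · rintro (_ | _) <;> assumption
  · rintro (_ | _) <;> assumption
  -- The delay equations hold for `t > 0` only; the instant `0` is negligible.
  · rw [← restrict_Ioi_eq_restrict_Ici]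
    filter_upwards [ae_restrict_mem measurableSet_Ioi] with t ht
    have h := fun k => hFd k t ht
    have e₀ := h 0
    have e₁ := h 1
    have e₂ := h 2
    have e₃ := h 3
    simp [Fin.sum_univ_four, boundaryMatrix, τ] at e₀ e₁ e₂ e₃
    refine ⟨e₂, e₀, by simpa using e₃, e₁⟩
  · rintro (_ | _) <;> assumption
  · rintro (_ | _) <;> assumption

end ARZNetwork

/-- Exponential stability in `L²` of the closed-loop system, on both roads simultaneously. -/
theorem mainTheorem1 (S : ARZNetwork) (hS : Sp1 S.boundaryMatrix < 1) :
    (∃ Kvw Kvv : Road → ℝ → ℝ → ℝ, S.IsKernel Kvw Kvv) ∧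
    ∃ C ω : ℝ, 0 < C ∧ 0 < ω ∧
      ∀ Kvw Kvv : Road → ℝ → ℝ → ℝ, S.IsKernel Kvw Kvv →
      ∀ w₀ v₀ : (i : Road) → S.L2 i,
        (∃ w v : (i : Road) → ℝ → S.L2 i, S.IsClosedLoopSolution Kvw Kvv w v ∧
          (∀ i, w i 0 = w₀ i) ∧ (∀ i, v i 0 = v₀ i)) ∧
        ∀ w v : (i : Road) → ℝ → S.L2 i, S.IsClosedLoopSolution Kvw Kvv w v →
          (∀ i, w i 0 = w₀ i) → (∀ i, v i 0 = v₀ i) →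
          ∀ t : ℝ, 0 ≤ t →
            S.stateNorm (fun i => w i t) (fun i => v i t) ≤
              C * Real.exp (-ω * t) * S.stateNorm w₀ v₀ := by
  refine ⟨⟨_, _, S.isKernel_kernel⟩, ?_⟩
  obtain ⟨C, ω, hC, hω, h⟩ := ARZNetwork.exists_decay hS
  refine ⟨C, ω, hC, hω, fun Kvw Kvv hK w₀ v₀ => ⟨?_, fun w v hwv hw hv t ht => ?_⟩⟩
  -- The initial state is transformed, evolved by the target system, and transformed back.
  · obtain ⟨w, β, wl, wr, βl, βr, hs, hw, hβ⟩ :=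
      ARZNetwork.exists_isTargetSolution w₀ fun i => S.toTarget i (w₀ i, v₀ i)
    exact ⟨w, _, hs.isClosedLoopSolution hK, hw, fun i => by
      rw [hw, hβ, ARZNetwork.ofTarget_toTarget]⟩
  · have := h Kvw Kvv hK w v hwv t ht
    rwa [funext hw, funext hv] at this
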